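/- **Setting.** Let $H=\mathbb Z\times\mathbb N$ ($\mathbb N=\{0,1,2,\dots\}$) be the half-plane square lattice with vertex set $V_H$ and nearest-neighbour edge set $E_H$, and let $\nu_0$ be a probability measure on $\mathbb R$ without atoms and with support $\mathbb R$. Let $\nu=\nu_0^{\otimes E_H}$ be the law of i.i.d. couplings $J=(J_e)_{e\in E_H}$. For an edge $e=\{x,y\}$ and $\sigma\in\{-1,+1\}^{V_H}$ write $\sigma_e=\sigma_x\sigma_y$. For a set $A$ of vertices, $\partial A$ is the set of edges with exactly one endpoint in $A$. The set of ground states is $$\mathcal G(J)=\Big\{\sigma\in\{-1,+1\}^{V_H}:\ \sum_{e\in\partial A}J_e\sigma_e\ge 0\ \text{ for every finite } A\subset V_H\Big\}.$$ Assume that $|\mathcal G(J)|<\infty$ for $\nu$-almost every $J$, let $\mu_J$ be the uniform probability measure on $\mathcal G(J)$, and let $M=\nu(dJ)\,\mu_J\times\mu_J$, a measure on triples $(J,\sigma,\sigma')$. For $\sigma\in\mathcal G(J)$ and $e\in E_H$ let $J^{e,s}$ be $J$ with the value at $e$ replaced by $s$, and let the critical value be $C_e(J,\sigma)=\inf\{s:\sigma\in\mathcal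 G(J^{e,s})\}$ if $\sigma_e=+1$, and $C_e(J,\sigma)=\sup\{s:\sigma\in\mathcal G(J^{e,s})\}$ if $\sigma_e=-1$. Let $M^*$ be the law under $M$ of $(J,\sigma,\sigma',(C_e(J,\sigma))_e,(C_e(J,\sigma'))_e)$. Let $T$ be the translation of $\mathbb Z^2$ by $(0,-1)$, and let $M^*_n=\frac1{n+1}\sum_{k=0}^nT^kM^*$, where $T^kM^*$ is the law of the configuration translated to the half-plane $\{y\ge -k\}$ (extended by arbitrary constants to the rest of $\mathbb Z^2$, which does not affect limits as $n\to\infty$). Let $\widetilde M$ be any probability measure on $$\widetilde\Omega=\mathbb R^{E_{\mathbb Z^2}}\times\{-1,+1\}^{\mathbb Z^2}\times\{-1,+1\}^{\mathbb Z^2}\times\mathbb R^{E_{\mathbb Z^2}}\times\mathbb R^{E_{\mathbb Z^2}}$$ that is the weak limit of a subsequence of $(M^*_n)_n$. For spin configurations $\sigma,\sigma'$ on $\mathbb Z^2$, the interface is $\sigma\Delta\sigma'=\{e\in E_{\mathbb Z^2}:\sigma_e\neq\sigma'_e\}$. It is also viewed as the set of the dual edges $e^*$ crossing the edges $e\in\sigma\Delta\sigma'$,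 hence as a subgraph of the dual lattice $(\mathbb Z+\frac12)^2$ and as a closed subset of $\mathbb R^2$. A domain wall is a connected component (with at least one edge) of this subgraph. A dangling end, a three-branching point, a four-branching point is a dual vertex of degree $1$, $3$, $4$, respectively, in the subgraph. **Proposition.** With $\widetilde M$-probability one, the following statements hold. 1. If $\sigma\Delta\sigma'$ is nonempty, then it has positive density: the proportion of the edges of the box $[-n,n]^2$ (edges with both endpoints in the box) that belong to $\sigma\Delta\sigma'$ converges as $n\to\infty$ to a positive limit. 2. If $\sigma\Delta\sigma'$ is nonempty, then it contains no dangling ends and no three-branching points. 3. If $\sigma\Delta\sigma'$ is nonempty, then it contains no four-branching points. Each dual vertex in a domain wall has degree two, and each domain wall is a doubly infinite, non-self-intersecting dual path. Moreover, each connected component $C$ of the complement of $\sigma\Delta\sigma'$ in $\mathbb R^2$ is unbounded and has at most two topological ends: for every bounded $B\subset\mathbb R^2$, the set $C\setminus B$ has at most two unbounded connected components. -/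

import Mathlib

open MeasureTheory ProbabilityTheory Filter Topology

open scoped ENNReal BoundedContinuousFunction

noncomputable section

namespace EdwardsAnderson

/-! ### The half-plane and plane square lattices

`R = ℕ` gives the half-plane `ℤ × ℕ` and `R = ℤ` gives the plane `ℤ × ℤ`. -/

/-- The two directions in which a nearest-neighbour edge can leave its left/lower endpoint. -/
inductive Dir
  | right
  | up
  deriving DecidableEq

instance : Finite Dir :=
  Finite.of_injective (fun d => decide (d = Dir.up)) (by intro a b; cases a <;> cases b <;> simp)

/-- The `σ`-algebra on the two-point space of spins is the discrete one. -/
instance : DiscreteMeasurableSpace ℤˣ where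
  forall_measurableSet s :=
    ⟨Units.val '' s, MeasurableSet.of_discrete, Set.preimage_image_eq s Units.val_injective⟩

instance : BorelSpace ℤˣ where
  measurable_eq := by
    refine le_antisymm (fun s _ => ?_) (fun s _ => MeasurableSet.of_discrete)
    exact MeasurableSpace.measurableSet_generateFrom (isOpen_discrete s)

/-- Vertices. -/
abbrev Vertex (R : Type) : Type := ℤ × R

/-- Nearest-neighbour edges. The pair `(v, right)` is the edge `{v, v + (1,0)}` and the pair
`(v, up)` is the edge `{v, v + (0,1)}`; every edge of the half-plane or of the plane occurs
exactly once. -/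
abbrev Edge (R : Type) : Type := Vertex R × Dir

/-- The left/lower endpoint of an edge. -/
def src {R : Type} (e : Edge R) : Vertex R := e.1

/-- The right/upper endpoint of an edge. -/
def tgt {R : Type} [Add R] [One R] : Edge R → Vertex R
  | ((x, y), Dir.right) => (x + 1, y)
  | ((x, y), Dir.up) => (x, y + 1)

/-- Spin configurations (`ℤˣ = {1, -1}`). -/
abbrev SpinConf (R : Type) : Type := Vertex R → ℤˣ

/-- Families of real numbers indexed by the edges (couplings, critical values). -/
abbrev EdgeField (R : Type) : Type := Edge R → ℝ

/-- `σ_e = σ_x σ_y` for an edge `e = {x, y}`. -/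
def bond {R : Type} [Add R] [One R] (σ : SpinConf R) (e : Edge R) : ℤˣ :=
  σ (src e) * σ (tgt e)

/-- `∂A`: the edges with exactly one endpoint in `A`. -/
def edgeBoundary {R : Type} [Add R] [One R] (A : Set (Vertex R)) : Set (Edge R) :=
  {e | Xor (src e ∈ A) (tgt e ∈ A)}

/-- The boundary of a finite set of vertices of the half-plane is finite, so the (finitely
supported) sum in `groundStates` is a genuine finite sum. -/
theorem edgeBoundary_finite (A : Finset (Vertex ℕ)) :
    (edgeBoundary (A : Set (Vertex ℕ))).Finite := by
  have h1 : (src ⁻¹' (A : Set (Vertex ℕ)) : Set (Edge ℕ)).Finite := by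
    refine (A.finite_toSet.prod (Set.finite_univ (α := Dir))).subset ?_
    intro e he
    exact ⟨he, trivial⟩
  have h2 : (tgt ⁻¹' (A : Set (Vertex ℕ)) : Set (Edge ℕ)).Finite := by
    have hinj : Function.Injective (fun e : Edge ℕ => (tgt e, e.2)) := by
      rintro ⟨⟨x, y⟩, d⟩ ⟨⟨x', y'⟩, d'⟩ h
      cases d <;> cases d' <;> simp_all [tgt]
    refine Set.Finite.subset
      ((A.finite_toSet.prod (Set.finite_univ (α := Dir))).preimage hinj.injOn) ?_
    intro e he
    exact ⟨he, trivial⟩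
  refine (h1.union h2).subset ?_
  rintro e (⟨h, -⟩ | ⟨h, -⟩)
  · exact Or.inl h
  · exact Or.inr h

/-! ### Ground states on the half-plane and the uniform measure -/

/-- The set `𝒢(J)` of ground states on the half-plane (free boundary condition). -/
def groundStates (J : EdgeField ℕ) : Set (SpinConf ℕ) :=
  {σ | ∀ A : Finset (Vertex ℕ),
    0 ≤ ∑ᶠ e ∈ edgeBoundary (A : Set (Vertex ℕ)), J e * ((bond σ e : ℤ) : ℝ)}

/-- The law `ν` of the couplings: i.i.d. with common law `ν₀`. -/
def couplingLaw (ν₀ : Measure ℝ) [IsProbabilityMeasure ν₀] : Measure (EdgeField ℕ) :=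
  Measure.infinitePi fun _ => ν₀

/-- The uniform measure `μ_J` on `𝒢(J)`. -/
def uniformGS (J : EdgeField ℕ) : Measure (SpinConf ℕ) := uniformOn (groundStates J)

/-- `M = ν(dJ) μ_J × μ_J`, a measure on triples `(J, σ, σ')`. -/
def halfPlaneMeasure (ν₀ : Measure ℝ) [IsProbabilityMeasure ν₀] :
    Measure (EdgeField ℕ × SpinConf ℕ × SpinConf ℕ) :=
  (couplingLaw ν₀).bind fun J =>
    (Measure.dirac J).prod ((uniformGS J).prod (uniformGS J))

/-- The critical value `C_e(J, σ)`: the infimum (if `σ_e = 1`) or supremum (if `σ_e = -1`) of the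
values `s` such that `σ` is a ground state after the coupling of `e` is replaced by `s`. -/
def criticalValue (J : EdgeField ℕ) (σ : SpinConf ℕ) (e : Edge ℕ) : ℝ :=
  if bond σ e = 1 then sInf {s : ℝ | σ ∈ groundStates (Function.update J e s)}
  else sSup {s : ℝ | σ ∈ groundStates (Function.update J e s)}

/-- Configurations `(J, σ, σ', (C_e), (C'_e))`: the space `Ω*` for `R = ℕ`, and `Ω̃` for
`R = ℤ`. -/
abbrev Conf (R : Type) : Type :=
  EdgeField R × SpinConf R × SpinConf R × EdgeField R × EdgeField R

/-- The product `σ`-algebra on the space of configurations is the Borel `σ`-algebra of the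
product topology. -/
instance {R : Type} [Countable R] : BorelSpace (Conf R) :=
  haveI : BorelSpace (SpinConf R × EdgeField R × EdgeField R) := Prod.borelSpace
  haveI : BorelSpace (SpinConf R × SpinConf R × EdgeField R × EdgeField R) := Prod.borelSpace
  Prod.borelSpace

/-- The map `Φ` that adjoins the critical values. -/
def adjoinCritical (p : EdgeField ℕ × SpinConf ℕ × SpinConf ℕ) : Conf ℕ :=
  (p.1, p.2.1, p.2.2, criticalValue p.1 p.2.1, criticalValue p.1 p.2.2)

/-- `M*`, the push-forward of `M` by `Φ`. -/
def extendedMeasure (ν₀ : Measure ℝ) [IsProbabilityMeasure ν₀] : Measure (Conf ℕ) :=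
  (halfPlaneMeasure ν₀).map adjoinCritical

/-! ### Translates of the half-plane measure and the limit on the plane -/

/-- Move a spin configuration on the half-plane down by `k`. It then lives on `{y ≥ -k}`;
below that the value is the arbitrary constant `1`. -/
def shiftSpin (k : ℕ) (σ : SpinConf ℕ) : SpinConf ℤ := fun v =>
  if 0 ≤ v.2 + k then σ (v.1, (v.2 + k).toNat) else 1

/-- Move an edge-indexed family on the half-plane down by `k`; on the edges which are not in the
translated half-plane the value is the arbitrary constant `0`. -/
def shiftEdge (k : ℕ) (J : EdgeField ℕ) : EdgeField ℤ := fun e =>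
  if 0 ≤ e.1.2 + k then J ((e.1.1, (e.1.2 + k).toNat), e.2) else 0

/-- The `k`-th power of the translation by `(0, -1)`, as a map from half-plane configurations to
plane configurations. A cylinder event only looks at coordinates of the translated half-plane as
soon as `k` is large, so the arbitrary values do not influence limits of averages over `k`. -/
def shiftConf (k : ℕ) (ω : Conf ℕ) : Conf ℤ :=
  (shiftEdge k ω.1, shiftSpin k ω.2.1, shiftSpin k ω.2.2.1,
    shiftEdge k ω.2.2.2.1, shiftEdge k ω.2.2.2.2)

/-- `M*_n = (n+1)⁻¹ ∑_{k=0}^n T^k M*`. -/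
def averagedMeasure (ν₀ : Measure ℝ) [IsProbabilityMeasure ν₀] (n : ℕ) : Measure (Conf ℤ) :=
  ((n : ℝ≥0∞) + 1)⁻¹ •
    ∑ k ∈ Finset.range (n + 1), (extendedMeasure ν₀).map (shiftConf k)

/-- `Mt` is a possible choice of the plane measure `M̃`: a probability measure that is the weak
limit of some subsequence of `(M*_n)`. -/
def IsPlaneLimit (ν₀ : Measure ℝ) [IsProbabilityMeasure ν₀] (Mt : Measure (Conf ℤ)) : Prop :=
  IsProbabilityMeasure Mt ∧ ∃ n : ℕ → ℕ, StrictMono n ∧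
    ∀ f : Conf ℤ →ᵇ ℝ,
      Tendsto (fun k => ∫ ω, f ω ∂(averagedMeasure ν₀ (n k))) atTop (𝓝 (∫ ω, f ω ∂Mt))

/-! ### The interface and its dual representation -/

/-- The interface `σ Δ σ'`. -/
def interface (σ σ' : SpinConf ℤ) : Set (Edge ℤ) := {e | bond σ e ≠ bond σ' e}

/-- The edges with both endpoints in the box `[-n, n]²`. -/
def boxEdges (n : ℕ) : Set (Edge ℤ) :=
  {e | (|(src e).1| ≤ n ∧ |(src e).2| ≤ n) ∧ (|(tgt e).1| ≤ n ∧ |(tgt e).2| ≤ n)}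

/-- A set of edges has positive density: the proportion of the edges of the box `[-n, n]²` that
belong to it converges, to a positive limit. -/
def HasPositiveDensity (S : Set (Edge ℤ)) : Prop :=
  ∃ ρ : ℝ, 0 < ρ ∧
    Tendsto (fun n : ℕ => ((S ∩ boxEdges n).ncard : ℝ) / ((boxEdges n).ncard : ℝ)) atTop (𝓝 ρ)

/-- Dual vertices: `(i, j)` stands for the point `(i + 1/2, j + 1/2)`, the centre of the face
with lower left corner `(i, j)`. -/
abbrev DualVertex : Type := ℤ × ℤ

/-- The dual edge `e*` crossing `e`, given by its two endpoints. -/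
def dualEdge : Edge ℤ → DualVertex × DualVertex
  | ((x, y), Dir.right) => ((x, y - 1), (x, y))
  | ((x, y), Dir.up) => ((x - 1, y), (x, y))

/-- A set of edges viewed as a graph on the dual lattice. -/
def dualGraph (S : Set (Edge ℤ)) : SimpleGraph DualVertex where
  Adj u v := ∃ e ∈ S, dualEdge e = (u, v) ∨ dualEdge e = (v, u)
  symm := ⟨fun _ _ ⟨e, he, h⟩ => ⟨e, he, h.symm⟩⟩
  loopless := ⟨by
    rintro ⟨a, b⟩ ⟨⟨⟨x, y⟩, d⟩, -, h⟩
    cases d <;> simp [dualEdge] at h <;> omega⟩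

/-- The degree of a dual vertex in `S`, that is, the number of dual edges of `S` at this vertex
(it is at most four). -/
def dualDegree (S : Set (Edge ℤ)) (u : DualVertex) : ℕ := ((dualGraph S).neighborSet u).ncard

/-- A domain wall: the vertex set of a connected component of `S`, viewed as edges in the dual
lattice. (A dual vertex touched by no edge of `S` is not a domain wall.) -/
def IsDomainWall (S : Set (Edge ℤ)) (D : Set DualVertex) : Prop :=
  ∃ u : DualVertex, ((dualGraph S).neighborSet u).Nonempty ∧
    D = {v | (dualGraph S).Reachable u v}

/-- The dual edges of `S` on the vertex set `D` form a doubly infinite (non-self-intersecting)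
path `… γ(-1) γ(0) γ(1) …` which visits all of `D`. -/
def IsDoublyInfinitePath (S : Set (Edge ℤ)) (D : Set DualVertex) : Prop :=
  ∃ γ : ℤ → DualVertex, Function.Injective γ ∧ Set.range γ = D ∧
    ∀ i j : ℤ, (dualGraph S).Adj (γ i) (γ j) ↔ (j = i + 1 ∨ i = j + 1)

/-- The point of `ℝ²` represented by a dual vertex. -/
def dualPoint (u : DualVertex) : ℝ × ℝ := ((u.1 : ℝ) + 1 / 2, (u.2 : ℝ) + 1 / 2)

/-- The subset of `ℝ²` covered by the (closed) dual edges of `S`. -/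
def dualRealization (S : Set (Edge ℤ)) : Set (ℝ × ℝ) :=
  ⋃ e ∈ S, segment ℝ (dualPoint (dualEdge e).1) (dualPoint (dualEdge e).2)

/-- `C` is a connected component of the subset `X` of the plane. -/
def IsComponentOf (C X : Set (ℝ × ℝ)) : Prop := ∃ p ∈ X, C = connectedComponentIn X p

/-- `C` has no more than two topological ends: removing a bounded set from `C` never leaves more
than two unbounded components. -/
def HasAtMostTwoEnds (C : Set (ℝ × ℝ)) : Prop :=
  ∀ B : Set (ℝ × ℝ), Bornology.IsBounded B →
    {K | IsComponentOf K (C \ B) ∧ ¬ Bornology.IsBounded K}.encard ≤ 2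

end EdwardsAnderson

end

open EdwardsAnderson

/-!
The interface of the two spin configurations is, under the limit measure, a random set `S` of edges
of the plane lattice with three properties; everything else follows from them.

* *`S` is stationary* (`IsPlaneLimit.isStationary_interfaceLaw`). The half-plane measure `M` is
  invariant under horizontal translations because the couplings are i.i.d. and the set of ground
  states is defined equivariantly; averaging over the downward translates makes the limit invariant
  under vertical ones. That `M*` is a genuine image measure is not obvious, as the measurability
  of the critical values and of `J ↦ μ_J × μ_J` is not clear beforehand, but it is forced by the
  existence of a limit of mass one (`IsPlaneLimit.extendedMeasure_ne_zero`).
* *`S` is even*: the number of edges of `S` around each face is even (`isEven_interface`). So there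
  are no dangling ends and no three-branching points.
* *`S` encloses nothing*: it does not contain the boundary of a nonempty finite set `A` of vertices
  (`IsPlaneLimit.ae_enclosesNothing`). On the half-plane, if `∂A` is contained in the interface of
  two ground states, then both `∑_{e ∈ ∂A} J_e σ_e` and its negative are nonnegative, so that a
  nontrivial signed sum of the couplings vanishes, which is a null event because the couplings are
  independent and have no atoms. The event that `∂A` is contained in the interface depends on
  finitely many spins, so its probability passes to the limit.

*Density.* For the action of `ℤ²` on the law of `S`, the mean ergodic theorem (through the point of
least norm of an invariant convex set in `L²`) and a Vitali covering argument give the pointwise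
ergodic theorem for averages over boxes (`IsPlaneAction.exists_tendsto_boxAverage`). The limit is an
invariant function, and a nonnegative function vanishes almost surely on the invariant event that
its averages tend to zero; hence a nonempty `S` has positive density
(`IsStationary.hasPositiveDensity`).

*Four-branching points.* As `S` is even and encloses nothing, its dual graph is a forest without
leaves: a finite set `F` of edges of `S` is determined by the dual vertices at which it has odd
degree, so that `2 ^ |F| ≤ 2 ^ |V|`, that is, `F` has at most as many edges as vertices
(`EnclosesNothing.card_le`). All degrees being two or four, the number of vertices of degree four in
a box is at most of the order of the boundary of the box, hence of zero density, and by
stationarity there are none (`IsStationary.faceDegree_ne_four`). A domain wall is then an infinite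
connected graph with all degrees two, that is, a doubly infinite path
(`exists_doublyInfinitePath`).

*Components of the complement.* The components of the complement of `S` in `ℝ²` are, up to parts of
the boundary of unit squares, unions of the unit squares about the vertices of a cluster: a
component of the lattice without the edges of `S`. A bounded component would be enclosed by `S`.
Three unbounded pieces of a component outside a bounded set would give a finite connected set of
vertices the removal of which leaves three infinite branches of its cluster
(`hasAtMostTwoEnds_of_not_isTrifurcation`). By the argument of Burton and Keane the number of
disjoint translates of such a trifurcation inside a box is at most the size of the boundary of the
box (`card_le_of_hasThreeBranches`), so by stationarity trifurcations do not exist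
(`IsStationary.not_isTrifurcation`).
-/

open MeasureTheory ProbabilityTheory Filter Topology

open scoped ENNReal BoundedContinuousFunction

noncomputable section

namespace EdwardsAnderson

/-! ### Boxes of the square lattice -/

/-- The box of radius `n` about the lattice point `v`. -/
def boxAt (v : ℤ × ℤ) (n : ℕ) : Finset (ℤ × ℤ) :=
  Finset.Icc (v.1 - n) (v.1 + n) ×ˢ Finset.Icc (v.2 - n) (v.2 + n)

theorem mem_boxAt {v w : ℤ × ℤ} {n : ℕ} :
    w ∈ boxAt v n ↔ (v.1 - n ≤ w.1 ∧ w.1 ≤ v.1 + n) ∧ (v.2 - n ≤ w.2 ∧ w.2 ≤ v.2 + n) := by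
  simp [boxAt]

theorem exists_subset_boxAt (R : Finset (ℤ × ℤ)) : ∃ m : ℕ, R ⊆ boxAt 0 m := by
  obtain ⟨m, hm⟩ : ∃ m, ∀ v ∈ R, max v.1.natAbs v.2.natAbs ≤ m :=
    ⟨R.sup fun v => max v.1.natAbs v.2.natAbs, fun v hv =>
      Finset.le_sup (f := fun v : ℤ × ℤ => max v.1.natAbs v.2.natAbs) hv⟩
  refine ⟨m, fun v hv => ?_⟩
  have := hm v hv
  simp only [mem_boxAt, Prod.fst_zero, Prod.snd_zero]
  omega

theorem card_boxAt (v : ℤ × ℤ) (n : ℕ) : (boxAt v n).card = (2 * n + 1) ^ 2 := by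
  have h (a : ℤ) : (a + n + 1 - (a - n)).toNat = 2 * n + 1 := by omega
  simp [boxAt, h, sq]

theorem sum_boxAt_add {M : Type*} [AddCommMonoid M] (g : ℤ × ℤ → M) (v w : ℤ × ℤ) (n : ℕ) :
    ∑ u ∈ boxAt w n, g (u + v) = ∑ u ∈ boxAt (w + v) n, g u := by
  refine Finset.sum_bij (fun u _ => u + v) ?_ ?_ ?_ ?_
  · intro u hu
    simp only [mem_boxAt, Prod.fst_add, Prod.snd_add] at hu ⊢
    omega
  · intro a _ b _ h
    exact add_right_cancel h
  · intro u hu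
    refine ⟨u - v, ?_, by simp⟩
    simp only [mem_boxAt, Prod.fst_add, Prod.snd_add, Prod.fst_sub, Prod.snd_sub] at hu ⊢
    omega
  · intro _ _
    rfl

/-! ### A maximal inequality for actions of `ℤ²` -/

/-- The lattice form of the Vitali covering argument: if every point of `E` is the centre of a box
in which `a` has mean greater than `c`, then `c` times the size of `E` is at most nine times the
total mass of `a`. -/
theorem card_mul_le_of_mean_gt (a : ℤ × ℤ → ℝ≥0∞) (c : ℝ≥0∞) (E : Finset (ℤ × ℤ))
    (r : ℤ × ℤ → ℕ) (L N : ℕ) (hr : ∀ v ∈ E, r v ≤ L) (hE : E ⊆ boxAt 0 N)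
    (h : ∀ v ∈ E, c * (2 * r v + 1 : ℕ) ^ 2 ≤ ∑ w ∈ boxAt v (r v), a w) :
    c * E.card ≤ 9 * ∑ w ∈ boxAt 0 (N + L), a w := by
  classical
  obtain ⟨u, huE, hdis, hcov⟩ := Vitali.exists_disjoint_subfamily_covering_enlargement
    (fun v => (boxAt v (r v) : Set (ℤ × ℤ))) (E : Set (ℤ × ℤ)) (fun v => (r v : ℝ)) 2
    (by norm_num) (fun _ _ => by positivity) L (fun v hv => by exact_mod_cast hr v hv)
    (fun v _ => ⟨v, by simp [mem_boxAt]⟩)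
  obtain ⟨U, rfl⟩ : ∃ U : Finset (ℤ × ℤ), (U : Set (ℤ × ℤ)) = u :=
    ⟨(E.finite_toSet.subset huE).toFinset, by simp⟩
  have hUE : ∀ v ∈ U, v ∈ E := fun v hv => huE hv
  have hsub : E ⊆ U.biUnion fun v => boxAt v (3 * r v) := by
    intro v hv
    obtain ⟨b, hb, ⟨w, hw1, hw2⟩, hle⟩ := hcov v hv
    have hle' : r v ≤ 2 * r b := by exact_mod_cast hle
    simp only [Finset.mem_coe, mem_boxAt] at hw1 hw2
    simp only [Finset.mem_biUnion]
    refine ⟨b, hb, ?_⟩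
    simp only [mem_boxAt]
    push_cast
    omega
  have hcard : E.card ≤ ∑ v ∈ U, 9 * (2 * r v + 1) ^ 2 := by
    refine (Finset.card_le_card hsub).trans (Finset.card_biUnion_le.trans ?_)
    refine Finset.sum_le_sum fun v _ => ?_
    rw [card_boxAt]
    calc (2 * (3 * r v) + 1) ^ 2 ≤ (3 * (2 * r v + 1)) ^ 2 := Nat.pow_le_pow_left (by omega) 2
      _ = 9 * (2 * r v + 1) ^ 2 := by ring
  calc c * E.card ≤ c * ((∑ v ∈ U, 9 * (2 * r v + 1) ^ 2 : ℕ) : ℝ≥0∞) := by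
        gcongr
    _ = 9 * ∑ v ∈ U, c * (2 * r v + 1 : ℕ) ^ 2 := by
        push_cast
        rw [Finset.mul_sum, Finset.mul_sum]
        refine Finset.sum_congr rfl fun v _ => ?_
        ring
    _ ≤ 9 * ∑ v ∈ U, ∑ w ∈ boxAt v (r v), a w := by
        gcongr with v hv
        exact h v (hUE v hv)
    _ = 9 * ∑ w ∈ U.biUnion (fun v => boxAt v (r v)), a w := by
        rw [Finset.sum_biUnion]
        intro v hv w hw hvw
        have := hdis hv hw hvw
        exact Finset.disjoint_coe.1 this
    _ ≤ 9 * ∑ w ∈ boxAt 0 (N + L), a w := by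
        gcongr
        intro w hw
        obtain ⟨v, hv, hw⟩ := Finset.mem_biUnion.1 hw
        have h1 := hE (hUE v hv)
        have h2 := hr v (hUE v hv)
        simp only [mem_boxAt] at hw h1 ⊢
        simp only [Prod.fst_zero, Prod.snd_zero] at h1 ⊢
        push_cast
        omega

section MaximalInequality

variable {Ω : Type*} [MeasurableSpace Ω]

/-- A measure preserving action of the group `ℤ²`. -/
structure IsPlaneAction (P : Measure Ω) (T : ℤ × ℤ → Ω → Ω) : Prop where
  zero : ∀ ω, T 0 ω = ω
  add : ∀ v w ω, T v (T w ω) = T (v + w) ω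
  mp : ∀ v, MeasurePreserving (T v) P P

/-- Transference of the covering lemma to a finite horizon. -/
theorem IsPlaneAction.maximal_finite {P : Measure Ω} [IsProbabilityMeasure P]
    {T : ℤ × ℤ → Ω → Ω} (hT : IsPlaneAction P T) {φ : Ω → ℝ≥0∞} (hφ : Measurable φ)
    (c : ℝ≥0∞) (L : ℕ) :
    c * P {ω | ∃ n ≤ L, c * (2 * n + 1 : ℕ) ^ 2 ≤ ∑ w ∈ boxAt 0 n, φ (T w ω)} ≤
      36 * ∫⁻ ω, φ ω ∂P := by
  classical
  set E₀ : Set Ω := {ω | ∃ n ≤ L, c * (2 * n + 1 : ℕ) ^ 2 ≤ ∑ w ∈ boxAt 0 n, φ (T w ω)} with hE₀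
  have hmeas : MeasurableSet E₀ := by
    have : E₀ = ⋃ n ∈ Set.Iic L,
        {ω | c * (2 * n + 1 : ℕ) ^ 2 ≤ ∑ w ∈ boxAt 0 n, φ (T w ω)} := by
      ext ω
      simp [hE₀]
    rw [this]
    refine MeasurableSet.biUnion (Set.to_countable _) fun n _ => ?_
    exact measurableSet_le measurable_const
      (Finset.measurable_sum _ fun w _ => hφ.comp (hT.mp w).measurable)
  have hpt : ∀ ω, c * ∑ v ∈ boxAt 0 L, E₀.indicator 1 (T v ω) ≤
      9 * ∑ w ∈ boxAt 0 (L + L), φ (T w ω) := by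
    intro ω
    have hch : ∀ v : ℤ × ℤ, ∃ n : ℕ, T v ω ∈ E₀ →
        n ≤ L ∧ c * (2 * n + 1 : ℕ) ^ 2 ≤ ∑ w ∈ boxAt v n, φ (T w ω) := by
      intro v
      by_cases hv : T v ω ∈ E₀
      · obtain ⟨n, hn, hle⟩ := hv
        refine ⟨n, fun _ => ⟨hn, ?_⟩⟩
        simp_rw [hT.add] at hle
        rwa [sum_boxAt_add (fun w => φ (T w ω)), zero_add] at hle
      · exact ⟨0, fun h => absurd h hv⟩
    choose r hr using hch
    have key := card_mul_le_of_mean_gt (fun w => φ (T w ω)) c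
      ((boxAt 0 L).filter fun v => T v ω ∈ E₀) r L L
      (fun v hv => (hr v (Finset.mem_filter.1 hv).2).1) (Finset.filter_subset _ _)
      (fun v hv => (hr v (Finset.mem_filter.1 hv).2).2)
    convert key using 2
    rw [Finset.card_filter, Nat.cast_sum]
    refine Finset.sum_congr rfl fun v _ => ?_
    by_cases hv : T v ω ∈ E₀ <;> simp [hv]
  have hint : c * ((boxAt 0 L).card * P E₀) ≤ 9 * ((boxAt 0 (L + L)).card * ∫⁻ ω, φ ω ∂P) := by
    have := lintegral_mono (μ := P) hpt
    have m1 : ∀ v, Measurable fun ω => E₀.indicator (1 : Ω → ℝ≥0∞) (T v ω) := fun v =>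
      (measurable_one.indicator hmeas).comp (hT.mp v).measurable
    have m2 : ∀ v, Measurable fun ω => φ (T v ω) := fun v => hφ.comp (hT.mp v).measurable
    rw [lintegral_const_mul _ (Finset.measurable_sum _ fun v _ => m1 v),
      lintegral_const_mul _ (Finset.measurable_sum _ fun v _ => m2 v),
      lintegral_finsetSum _ fun v _ => m1 v, lintegral_finsetSum _ fun v _ => m2 v] at this
    simpa only [(hT.mp _).lintegral_comp (measurable_one.indicator hmeas),
      (hT.mp _).lintegral_comp hφ, lintegral_indicator_one hmeas, Finset.sum_const,
      nsmul_eq_mul] using this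
  rw [card_boxAt, card_boxAt] at hint
  -- the box of radius `2L` is at most four times as large as the box of radius `L`
  have h4 : (((2 * (L + L) + 1) ^ 2 : ℕ) : ℝ≥0∞) ≤ 4 * (((2 * L + 1) ^ 2 : ℕ) : ℝ≥0∞) := by
    have : (2 * (L + L) + 1) ^ 2 ≤ 4 * (2 * L + 1) ^ 2 :=
      (Nat.pow_le_pow_left (by omega : 2 * (L + L) + 1 ≤ 2 * (2 * L + 1)) 2).trans_eq (by ring)
    exact_mod_cast this
  have hK0 : (((2 * L + 1) ^ 2 : ℕ) : ℝ≥0∞) ≠ 0 := by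
    simp
  have hKt : (((2 * L + 1) ^ 2 : ℕ) : ℝ≥0∞) ≠ ∞ := ENNReal.natCast_ne_top _
  refine (ENNReal.mul_le_mul_iff_right hK0 hKt).1 ?_
  calc (((2 * L + 1) ^ 2 : ℕ) : ℝ≥0∞) * (c * P E₀)
      = c * ((((2 * L + 1) ^ 2 : ℕ) : ℝ≥0∞) * P E₀) := by ring
    _ ≤ 9 * ((((2 * (L + L) + 1) ^ 2 : ℕ) : ℝ≥0∞) * ∫⁻ ω, φ ω ∂P) := hint
    _ ≤ 9 * ((4 * (((2 * L + 1) ^ 2 : ℕ) : ℝ≥0∞)) * ∫⁻ ω, φ ω ∂P) := by gcongr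
    _ = (((2 * L + 1) ^ 2 : ℕ) : ℝ≥0∞) * (36 * ∫⁻ ω, φ ω ∂P) := by ring

/-- The weak type maximal inequality for averages over boxes. -/
theorem IsPlaneAction.maximal {P : Measure Ω} [IsProbabilityMeasure P]
    {T : ℤ × ℤ → Ω → Ω} (hT : IsPlaneAction P T) {φ : Ω → ℝ≥0∞} (hφ : Measurable φ)
    (c : ℝ≥0∞) (hc : c ≠ ∞) :
    c * P {ω | ∃ n : ℕ, c * (2 * n + 1 : ℕ) ^ 2 ≤ ∑ w ∈ boxAt 0 n, φ (T w ω)} ≤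
      36 * ∫⁻ ω, φ ω ∂P := by
  have hU : {ω | ∃ n : ℕ, c * (2 * n + 1 : ℕ) ^ 2 ≤ ∑ w ∈ boxAt 0 n, φ (T w ω)} =
      ⋃ L : ℕ, {ω | ∃ n ≤ L, c * (2 * n + 1 : ℕ) ^ 2 ≤ ∑ w ∈ boxAt 0 n, φ (T w ω)} := by
    ext ω
    simp only [Set.mem_ofPred_eq, Set.mem_iUnion]
    exact ⟨fun ⟨n, h⟩ => ⟨n, n, le_rfl, h⟩, fun ⟨_, n, _, h⟩ => ⟨n, h⟩⟩
  rw [hU]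
  have hmono : Monotone fun L : ℕ =>
      {ω | ∃ n ≤ L, c * (2 * n + 1 : ℕ) ^ 2 ≤ ∑ w ∈ boxAt 0 n, φ (T w ω)} :=
    fun L L' hLL ω ⟨n, hn, h⟩ => ⟨n, hn.trans hLL, h⟩
  exact le_of_tendsto' (ENNReal.Tendsto.const_mul (tendsto_measure_iUnion_atTop hmono)
    (Or.inr hc)) fun L => hT.maximal_finite hφ c L

end MaximalInequality

/-! ### The pointwise ergodic theorem for actions of `ℤ²` -/

/-- A family of linear isometries that preserves a nonempty closed convex set has a common fixed
point in it, namely the point of least norm. -/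
theorem exists_fixed_of_isometries {E ι : Type*} [NormedAddCommGroup E] [InnerProductSpace ℝ E]
    [CompleteSpace E] (U : ι → E →ₗᵢ[ℝ] E) {K : Set E} (hne : K.Nonempty) (hcl : IsClosed K)
    (hconv : Convex ℝ K) (hU : ∀ i, ∀ x ∈ K, U i x ∈ K) : ∃ h ∈ K, ∀ i, U i h = h := by
  obtain ⟨h, hK, hmin⟩ := exists_norm_eq_iInf_of_complete_convex hne hcl.isComplete hconv 0
  refine ⟨h, hK, fun i => ?_⟩
  have h1 := (norm_eq_iInf_iff_real_inner_le_zero hconv hK).1 hmin (U i h) (hU i h hK)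
  have h2 : ‖U i h - h‖ ^ 2 = ‖h‖ ^ 2 - 2 * inner ℝ (U i h) h + ‖h‖ ^ 2 := by
    rw [norm_sub_sq_real, LinearIsometry.norm_map]
  rw [zero_sub, inner_neg_left, inner_sub_right, real_inner_self_eq_norm_sq,
    real_inner_comm] at h1
  have h3 : ‖U i h - h‖ ^ 2 ≤ 0 := by linarith
  exact sub_eq_zero.1 (norm_eq_zero.1 (pow_eq_zero_iff two_ne_zero |>.1
    (le_antisymm h3 (sq_nonneg _))))

section ErgodicTheorem

variable {Ω : Type*}

/-- The average of `f` over the translates in the box of radius `n`. -/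
def boxAverage (T : ℤ × ℤ → Ω → Ω) (f : Ω → ℝ) (n : ℕ) (ω : Ω) : ℝ :=
  (∑ v ∈ boxAt 0 n, f (T v ω)) / (2 * n + 1) ^ 2

theorem boxAverage_of_const {T : ℤ × ℤ → Ω → Ω} {f : Ω → ℝ} {ω : Ω} {a : ℝ}
    (h : ∀ v, f (T v ω) = a) (n : ℕ) : boxAverage T f n ω = a := by
  have : ((2 : ℝ) * n + 1) ^ 2 ≠ 0 := by positivity
  simp only [boxAverage, h, Finset.sum_const, card_boxAt, nsmul_eq_mul]
  push_cast
  field_simp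

theorem boxAverage_add (T : ℤ × ℤ → Ω → Ω) (f g : Ω → ℝ) (n : ℕ) (ω : Ω) :
    boxAverage T (f + g) n ω = boxAverage T f n ω + boxAverage T g n ω := by
  simp [boxAverage, Finset.sum_add_distrib, add_div]

theorem boxAverage_sub (T : ℤ × ℤ → Ω → Ω) (f g : Ω → ℝ) (n : ℕ) (ω : Ω) :
    boxAverage T (f - g) n ω = boxAverage T f n ω - boxAverage T g n ω := by
  simp [boxAverage, Finset.sum_sub_distrib, sub_div]

theorem boxAverage_smul (T : ℤ × ℤ → Ω → Ω) (c : ℝ) (f : Ω → ℝ) (n : ℕ) (ω : Ω) :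
    boxAverage T (c • f) n ω = c * boxAverage T f n ω := by
  simp [boxAverage, ← Finset.mul_sum, mul_div_assoc]

theorem abs_boxAverage_le (T : ℤ × ℤ → Ω → Ω) (f : Ω → ℝ) (n : ℕ) (ω : Ω) :
    |boxAverage T f n ω| ≤ boxAverage T (fun ω => |f ω|) n ω := by
  rw [boxAverage, boxAverage, abs_div, abs_of_nonneg (by positivity : (0 : ℝ) ≤ (2 * n + 1) ^ 2)]
  gcongr
  exact Finset.abs_sum_le_sum_abs _ _

variable [MeasurableSpace Ω]

/-- A bounded function and any of its translates have asymptotically the same averages. -/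
theorem IsPlaneAction.tendsto_boxAverage_comp_sub {P : Measure Ω} {T : ℤ × ℤ → Ω → Ω}
    (hT : IsPlaneAction P T) {f : Ω → ℝ} {C : ℝ} (hC : ∀ ω, |f ω| ≤ C) (v : ℤ × ℤ) (ω : Ω) :
    Tendsto (fun n => boxAverage T (f ∘ T v) n ω - boxAverage T f n ω) atTop (𝓝 0) := by
  set m : ℕ := max v.1.natAbs v.2.natAbs with hm
  have hC0 : 0 ≤ C := (abs_nonneg _).trans (hC ω)
  -- both boxes lie in the box of radius `n + m` and miss only `O(n)` points of it
  have hbox : ∀ (w : ℤ × ℤ) (n : ℕ), boxAt w n ⊆ boxAt 0 (n + m) →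
      |∑ u ∈ boxAt 0 (n + m), f (T u ω) - ∑ u ∈ boxAt w n, f (T u ω)| ≤
        C * (2 * m * (4 * n + 2 * m + 2)) := by
    intro w n hsub
    have hs := Finset.sum_sdiff hsub (f := fun u => f (T u ω))
    have hcard : ((boxAt 0 (n + m) \ boxAt w n).card : ℝ) = 2 * m * (4 * n + 2 * m + 2) := by
      rw [Finset.card_sdiff_of_subset hsub, Nat.cast_sub (Finset.card_le_card hsub), card_boxAt,
        card_boxAt]
      push_cast
      ring
    calc |∑ u ∈ boxAt 0 (n + m), f (T u ω) - ∑ u ∈ boxAt w n, f (T u ω)|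
        = |∑ u ∈ boxAt 0 (n + m) \ boxAt w n, f (T u ω)| := by
          rw [← hs, add_sub_cancel_right]
      _ ≤ ∑ u ∈ boxAt 0 (n + m) \ boxAt w n, |f (T u ω)| := Finset.abs_sum_le_sum_abs _ _
      _ ≤ ∑ u ∈ boxAt 0 (n + m) \ boxAt w n, C := Finset.sum_le_sum fun u _ => hC _
      _ = C * (2 * m * (4 * n + 2 * m + 2)) := by
          rw [Finset.sum_const, nsmul_eq_mul, hcard, mul_comm]
  have hle : ∀ n : ℕ, ‖boxAverage T (f ∘ T v) n ω - boxAverage T f n ω‖ ≤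
      2 * C * (2 * m) * (2 * m + 4) * (1 / ((n : ℝ) + 1)) := by
    intro n
    have h1 := hbox 0 n fun u hu => by
      simp only [mem_boxAt, Prod.fst_zero, Prod.snd_zero] at hu ⊢
      push_cast
      omega
    have h2 := hbox v n fun u hu => by
      simp only [mem_boxAt, Prod.fst_zero, Prod.snd_zero] at hu ⊢
      push_cast
      omega
    have hsum : ∑ u ∈ boxAt 0 n, (f ∘ T v) (T u ω) = ∑ u ∈ boxAt v n, f (T u ω) := by
      simp only [Function.comp_apply, hT.add, add_comm v]
      rw [sum_boxAt_add (fun u => f (T u ω)), zero_add]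
    have h3 : |∑ u ∈ boxAt v n, f (T u ω) - ∑ u ∈ boxAt 0 n, f (T u ω)| ≤
        2 * C * (2 * m) * ((2 * m + 4) * (n + 1)) := by
      have h4 : (4 * n + 2 * m + 2 : ℝ) ≤ (2 * m + 4) * (n + 1) := by
        have : (0 : ℝ) ≤ m * n := by positivity
        nlinarith
      have h5 : 2 * (C * (2 * m * (4 * n + 2 * m + 2))) ≤
          2 * C * (2 * m) * ((2 * m + 4) * (n + 1)) := by
        calc 2 * (C * (2 * m * (4 * n + 2 * m + 2)))
            = 2 * C * (2 * m) * (4 * n + 2 * m + 2) := by ring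
          _ ≤ _ := by gcongr
      rw [abs_le] at h1 h2 ⊢
      constructor <;> linarith [h1.1, h1.2, h2.1, h2.2]
    rw [boxAverage, boxAverage, hsum, ← sub_div, Real.norm_eq_abs, abs_div,
      abs_of_nonneg (by positivity : (0 : ℝ) ≤ (2 * n + 1) ^ 2), div_le_iff₀ (by positivity)]
    refine h3.trans ?_
    have h6 : (n + 1 : ℝ) ≤ 1 / (n + 1) * (2 * n + 1) ^ 2 := by
      rw [one_div, ← div_eq_inv_mul, le_div_iff₀ (by positivity)]
      nlinarith [(n.cast_nonneg : (0 : ℝ) ≤ n)]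
    calc 2 * C * (2 * m) * ((2 * m + 4) * (n + 1))
        = 2 * C * (2 * m) * (2 * m + 4) * (n + 1) := by ring
      _ ≤ 2 * C * (2 * m) * (2 * m + 4) * (1 / (n + 1) * (2 * n + 1) ^ 2) := by gcongr
      _ = _ := by ring
  refine squeeze_zero_norm hle ?_
  simpa using (tendsto_one_div_add_atTop_nhds_zero_nat (𝕜 := ℝ)).const_mul
    (2 * C * (2 * m) * (2 * m + 4))

/-- The mean ergodic theorem, in the form needed for pointwise convergence: some invariant `h` is
approximated in `L¹` by functions that have asymptotically the same box averages as `f`. -/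
theorem IsPlaneAction.exists_invariant_approx {P : Measure Ω} [IsProbabilityMeasure P]
    {T : ℤ × ℤ → Ω → Ω} (hT : IsPlaneAction P T) {f : Ω → ℝ} (hf : Measurable f) {C : ℝ}
    (hC : ∀ ω, |f ω| ≤ C) :
    ∃ h : Ω → ℝ, Measurable h ∧ (∀ᵐ ω ∂P, ∀ v, h (T v ω) = h ω) ∧
      ∀ ε : ℝ≥0∞, 0 < ε → ∃ g : Ω → ℝ, Measurable g ∧
        (∀ ω, Tendsto (fun n => boxAverage T g n ω - boxAverage T f n ω) atTop (𝓝 0)) ∧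
        ∫⁻ ω, ‖g ω - h ω‖ₑ ∂P ≤ ε := by
  have hmem : MemLp f 2 P := MemLp.of_bound hf.aestronglyMeasurable C
    (Eventually.of_forall fun ω => hC ω)
  set F : Lp ℝ 2 P := hmem.toLp f with hF
  let U : ℤ × ℤ → Lp ℝ 2 P →ₗᵢ[ℝ] Lp ℝ 2 P := fun v =>
    Lp.compMeasurePreservingₗᵢ ℝ (T v) (hT.mp v)
  have hUcoe : ∀ v (G : Lp ℝ 2 P), (U v G : Ω → ℝ) =ᵐ[P] G ∘ T v := fun v G =>
    Lp.coeFn_compMeasurePreserving G (hT.mp v)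
  have hUU : ∀ v w G, U v (U w G) = U (w + v) G := by
    intro v w G
    refine Lp.ext ?_
    filter_upwards [hUcoe v (U w G), hUcoe (w + v) G,
      (hT.mp v).quasiMeasurePreserving.ae (hUcoe w G)] with ω h1 h2 h3
    rw [h1, h2, Function.comp_apply, h3, Function.comp_apply, Function.comp_apply, hT.add]
  set K := closure (convexHull ℝ (Set.range fun v => U v F)) with hK
  have hUK : ∀ v, ∀ x ∈ K, U v x ∈ K := by
    intro v x hx
    have h1 : Set.MapsTo (U v) (convexHull ℝ (Set.range fun v => U v F))
        (convexHull ℝ (Set.range fun v => U v F)) := by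
      rw [Set.mapsTo_iff_image_subset]
      have : U v '' convexHull ℝ (Set.range fun v => U v F) =
          convexHull ℝ (U v '' Set.range fun v => U v F) :=
        (U v).toLinearMap.image_convexHull _
      rw [this]
      refine convexHull_mono ?_
      rintro _ ⟨_, ⟨w, rfl⟩, rfl⟩
      exact ⟨w + v, (hUU v w F).symm⟩
    exact h1.closure (U v).continuous hx
  obtain ⟨H, hHK, hHfix⟩ := exists_fixed_of_isometries U
    ((Set.range_nonempty _).convexHull.closure) isClosed_closure
    (convex_convexHull ℝ _).closure hUK
  refine ⟨H, (Lp.stronglyMeasurable H).measurable, ?_, ?_⟩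
  · rw [ae_all_iff]
    intro v
    have := hUcoe v H
    rw [hHfix v] at this
    filter_upwards [this] with ω hω
    exact hω.symm
  intro ε hε
  -- the functions with the same asymptotic averages as `f` form a convex set
  have hconv : convexHull ℝ (Set.range fun v => U v F) ⊆
      {G : Lp ℝ 2 P | ∃ g : Ω → ℝ, Measurable g ∧ (G : Ω → ℝ) =ᵐ[P] g ∧
        ∀ ω, Tendsto (fun n => boxAverage T g n ω - boxAverage T f n ω) atTop (𝓝 0)} := by
    refine convexHull_min ?_ ?_
    · rintro _ ⟨v, rfl⟩
      refine ⟨f ∘ T v, hf.comp (hT.mp v).measurable, ?_,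
        hT.tendsto_boxAverage_comp_sub hC v⟩
      filter_upwards [hUcoe v F, (hT.mp v).quasiMeasurePreserving.ae hmem.coeFn_toLp] with ω h1 h2
      rw [h1, Function.comp_apply, h2, Function.comp_apply]
    · rintro G₁ ⟨g₁, m₁, e₁, t₁⟩ G₂ ⟨g₂, m₂, e₂, t₂⟩ a b _ _ hab
      refine ⟨a • g₁ + b • g₂, (m₁.const_smul a).add (m₂.const_smul b), ?_, fun ω => ?_⟩
      · filter_upwards [Lp.coeFn_add (a • G₁) (b • G₂), Lp.coeFn_smul a G₁, Lp.coeFn_smul b G₂,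
          e₁, e₂] with ω h1 h2 h3 h4 h5
        rw [h1, Pi.add_apply, h2, h3, Pi.add_apply, Pi.smul_apply, Pi.smul_apply, Pi.smul_apply,
          Pi.smul_apply, h4, h5]
      · have := ((t₁ ω).const_mul a).add ((t₂ ω).const_mul b)
        simp only [mul_zero, add_zero] at this
        refine this.congr fun n => ?_
        rw [boxAverage_add, boxAverage_smul, boxAverage_smul]
        linear_combination (-boxAverage T f n ω) * hab
  obtain ⟨G, hG, hdist⟩ : ∃ G ∈ convexHull ℝ (Set.range fun v => U v F), edist H G < ε :=
    EMetric.mem_closure_iff.1 hHK ε hε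
  obtain ⟨g, mg, eg, tg⟩ := hconv hG
  refine ⟨g, mg, tg, ?_⟩
  have h1 : ∫⁻ ω, ‖g ω - H ω‖ₑ ∂P = eLpNorm (G - H : Ω → ℝ) 1 P := by
    rw [eLpNorm_one_eq_lintegral_enorm]
    refine lintegral_congr_ae ?_
    filter_upwards [eg] with ω hω
    rw [Pi.sub_apply, hω]
  rw [h1]
  refine (eLpNorm_le_eLpNorm_of_exponent_le one_le_two ?_).trans ?_
  · exact (Lp.aestronglyMeasurable G).sub (Lp.aestronglyMeasurable H)
  · rw [← Lp.edist_def, edist_comm]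
    exact hdist.le

/-- The pointwise ergodic theorem for box averages of a bounded function. -/
theorem IsPlaneAction.exists_tendsto_boxAverage {P : Measure Ω} [IsProbabilityMeasure P]
    {T : ℤ × ℤ → Ω → Ω} (hT : IsPlaneAction P T) {f : Ω → ℝ} (hf : Measurable f) {C : ℝ}
    (hC : ∀ ω, |f ω| ≤ C) :
    ∃ h : Ω → ℝ, Measurable h ∧ (∀ᵐ ω ∂P, ∀ v, h (T v ω) = h ω) ∧
      ∀ᵐ ω ∂P, Tendsto (fun n => boxAverage T f n ω) atTop (𝓝 (h ω)) := by
  obtain ⟨h, mh, hinv, happ⟩ := hT.exists_invariant_approx hf hC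
  refine ⟨h, mh, hinv, ?_⟩
  have hbad : ∀ k : ℕ, ∀ᵐ ω ∂P, ∀ᶠ n in atTop,
      |boxAverage T f n ω - h ω| < 2 * (1 / ((k : ℝ) + 1)) := by
    intro k
    set δ : ℝ := 1 / ((k : ℝ) + 1) with hδ
    have hδ0 : 0 < δ := by positivity
    have hδE : ENNReal.ofReal δ ≠ 0 := by simpa using hδ0
    have hδT : ENNReal.ofReal δ ≠ ∞ := ENNReal.ofReal_ne_top
    rw [ae_iff]
    refine le_antisymm (le_of_forall_pos_le_add fun η hη => ?_) (zero_le)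
    rw [zero_add]
    by_cases hηt : η = ∞
    · rw [hηt]
      exact le_top
    obtain ⟨g, mg, tg, hg⟩ := happ (ENNReal.ofReal δ * η / 36)
      (ENNReal.div_pos (mul_ne_zero hδE hη.ne') (by norm_num))
    have hmax := hT.maximal (φ := fun ω => ‖g ω - h ω‖ₑ) (mg.sub mh).enorm (ENNReal.ofReal δ) hδT
    have hsub : {ω | ¬ ∀ᶠ n in atTop, |boxAverage T f n ω - h ω| < 2 * δ} ⊆
        {ω | ¬ ∀ v, h (T v ω) = h ω} ∪ {ω | ∃ n : ℕ, ENNReal.ofReal δ * (2 * n + 1 : ℕ) ^ 2 ≤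
          ∑ w ∈ boxAt 0 n, ‖g (T w ω) - h (T w ω)‖ₑ} := by
      intro ω hω
      by_contra hcon
      rw [Set.mem_union, not_or] at hcon
      obtain ⟨h1, h2⟩ := hcon
      have h1' : ∀ v, h (T v ω) = h ω := by simpa using h1
      have h2' : ∀ n : ℕ, ∑ w ∈ boxAt 0 n, ‖g (T w ω) - h (T w ω)‖ₑ <
          ENNReal.ofReal δ * (2 * n + 1 : ℕ) ^ 2 := by
        intro n
        by_contra hn
        exact h2 ⟨n, not_lt.1 hn⟩
      refine hω ?_
      have hgh : ∀ n, |boxAverage T g n ω - h ω| < δ := by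
        intro n
        rw [← boxAverage_of_const h1' n, ← boxAverage_sub]
        refine (abs_boxAverage_le _ _ _ _).trans_lt ?_
        rw [boxAverage, div_lt_iff₀ (by positivity)]
        have h3 := h2' n
        simp only [← ofReal_norm] at h3
        rw [← ENNReal.ofReal_sum_of_nonneg fun _ _ => norm_nonneg _, ← Nat.cast_pow,
          ← ENNReal.ofReal_natCast, ← ENNReal.ofReal_mul hδ0.le,
          ENNReal.ofReal_lt_ofReal_iff (by positivity)] at h3
        simpa using h3
      filter_upwards [(tendsto_order.1 (tg ω)).1 (-δ) (by linarith),
        (tendsto_order.1 (tg ω)).2 δ hδ0] with n hn1 hn2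
      have := hgh n
      rw [abs_lt] at this ⊢
      constructor <;> linarith [this.1, this.2]
    refine (measure_mono hsub).trans ((measure_union_le _ _).trans ?_)
    rw [ae_iff.1 hinv, zero_add]
    refine (ENNReal.mul_le_mul_iff_right hδE hδT).1 (hmax.trans ?_)
    calc 36 * ∫⁻ ω, ‖g ω - h ω‖ₑ ∂P ≤ 36 * (ENNReal.ofReal δ * η / 36) := by gcongr
      _ = ENNReal.ofReal δ * η := ENNReal.mul_div_cancel (by norm_num) (by norm_num)
  filter_upwards [ae_all_iff.2 hbad] with ω hω
  rw [Metric.tendsto_atTop']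
  intro ε hε
  obtain ⟨k, hk⟩ := exists_nat_one_div_lt (half_pos hε)
  obtain ⟨N, hN⟩ := eventually_atTop.1 (hω k)
  refine ⟨N, fun n hn => ?_⟩
  rw [Real.dist_eq]
  exact (hN n hn.le).trans (by linarith)

/-- For a nonnegative bounded function the limit of the box averages is positive on every orbit on
which the function does not vanish identically. -/
theorem IsPlaneAction.exists_tendsto_boxAverage_pos {P : Measure Ω} [IsProbabilityMeasure P]
    {T : ℤ × ℤ → Ω → Ω} (hT : IsPlaneAction P T) {f : Ω → ℝ} (hf : Measurable f) {C : ℝ}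
    (hC : ∀ ω, |f ω| ≤ C) (hf0 : ∀ ω, 0 ≤ f ω) :
    ∀ᵐ ω ∂P, (∃ v, f (T v ω) ≠ 0) →
      ∃ ρ : ℝ, 0 < ρ ∧ Tendsto (fun n => boxAverage T f n ω) atTop (𝓝 ρ) := by
  obtain ⟨h, mh, hinv, hlim⟩ := hT.exists_tendsto_boxAverage hf hC
  have hC0 : ∀ ω : Ω, 0 ≤ C := fun ω => (abs_nonneg _).trans (hC ω)
  set Z : Set Ω := {ω | h ω = 0} with hZ
  have mZ : MeasurableSet Z := mh (measurableSet_singleton 0)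
  have mavg : ∀ n, Measurable fun ω => boxAverage T f n ω := fun n =>
    (Finset.measurable_sum _ fun v _ => hf.comp (hT.mp v).measurable).div_const _
  -- the integral of `f` over the invariant event `h = 0` is that of each box average
  have hint : ∀ g : Ω → ℝ, Measurable g → (∀ ω, |g ω| ≤ C) → Integrable (Z.indicator g) P :=
    fun g mg hg => (Integrable.of_bound mg.aestronglyMeasurable C
      (Eventually.of_forall hg)).indicator mZ
  have htr : ∀ v, ∫ ω, Z.indicator (f ∘ T v) ω ∂P = ∫ ω, Z.indicator f ω ∂P := by
    intro v
    have h1 : ∫ ω, Z.indicator f ω ∂P = ∫ ω, Z.indicator f (T v ω) ∂P := by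
      conv_lhs => rw [← (hT.mp v).map_eq]
      exact integral_map (hT.mp v).measurable.aemeasurable
        (hf.indicator mZ).aestronglyMeasurable
    rw [h1]
    refine integral_congr_ae ?_
    filter_upwards [hinv] with ω hω
    simp only [Set.indicator_apply, hZ, Set.mem_ofPred_eq, hω v, Function.comp_apply]
  have havg : ∀ n, ∫ ω, Z.indicator (fun ω => boxAverage T f n ω) ω ∂P =
      ∫ ω, Z.indicator f ω ∂P := by
    intro n
    have h1 : ∀ ω, Z.indicator (fun ω => boxAverage T f n ω) ω =
        (∑ v ∈ boxAt 0 n, Z.indicator (f ∘ T v) ω) / (2 * n + 1) ^ 2 := by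
      intro ω
      by_cases hω : ω ∈ Z <;> simp [hω, boxAverage]
    simp_rw [h1]
    rw [integral_div, integral_finsetSum _ fun v _ =>
      hint _ (hf.comp (hT.mp v).measurable) fun ω => hC _]
    simp only [htr, Finset.sum_const, card_boxAt, nsmul_eq_mul]
    have : ((2 : ℝ) * n + 1) ^ 2 ≠ 0 := by positivity
    push_cast
    field_simp
  have hzero : ∫ ω, Z.indicator f ω ∂P = 0 := by
    have hdom := tendsto_integral_of_dominated_convergence (μ := P)
      (F := fun n ω => Z.indicator (fun ω => boxAverage T f n ω) ω) (f := fun _ => (0 : ℝ))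
      (fun _ => C) (fun n => ((mavg n).indicator mZ).aestronglyMeasurable) (integrable_const C)
      (fun n => Eventually.of_forall fun ω => ?_) ?_
    · simp only [havg, integral_zero] at hdom
      exact tendsto_nhds_unique tendsto_const_nhds hdom
    · refine (norm_indicator_le_norm_self _ _).trans ?_
      refine (abs_boxAverage_le _ _ _ _).trans ?_
      rw [boxAverage, div_le_iff₀ (by positivity)]
      refine (Finset.sum_le_sum fun v _ => hC _).trans ?_
      rw [Finset.sum_const, card_boxAt, nsmul_eq_mul]
      push_cast
      linarith
    · filter_upwards [hlim] with ω hω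
      by_cases hωZ : ω ∈ Z
      · have : h ω = 0 := hωZ
        simpa [hωZ, this] using hω
      · simp [hωZ]
  have hvan : ∀ᵐ ω ∂P, ω ∈ Z → f ω = 0 := by
    have := (integral_eq_zero_iff_of_nonneg (fun ω => Set.indicator_nonneg (fun ω _ => hf0 ω) ω)
      (hint f hf hC)).1 hzero
    filter_upwards [this] with ω hω hωZ
    simpa [hωZ] using hω
  have hvan' : ∀ᵐ ω ∂P, ∀ v, T v ω ∈ Z → f (T v ω) = 0 :=
    ae_all_iff.2 fun v => (hT.mp v).quasiMeasurePreserving.ae hvan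
  filter_upwards [hlim, hinv, hvan'] with ω h1 h2 h3 hne
  obtain ⟨v, hv⟩ := hne
  refine ⟨h ω, lt_of_le_of_ne ?_ fun h0 => ?_, h1⟩
  · refine ge_of_tendsto' h1 fun n => ?_
    rw [boxAverage]
    exact div_nonneg (Finset.sum_nonneg fun v _ => hf0 _) (by positivity)
  · exact hv (h3 v (by rw [hZ, Set.mem_ofPred_eq, h2 v]; exact h0.symm))

end ErgodicTheorem

/-! ### Stationary random sets of edges and their density -/

/-- The translate of a set of edges by `-v`. -/
def translate (v : ℤ × ℤ) (S : Set (Edge ℤ)) : Set (Edge ℤ) := {e | (e.1 + v, e.2) ∈ S}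

theorem mem_translate {v : ℤ × ℤ} {S : Set (Edge ℤ)} {e : Edge ℤ} :
    e ∈ translate v S ↔ (e.1 + v, e.2) ∈ S := Iff.rfl

theorem measurable_translate (v : ℤ × ℤ) : Measurable (translate v) :=
  measurable_set_iff.2 fun e => measurable_set_mem (e.1 + v, e.2)

theorem translate_zero (S : Set (Edge ℤ)) : translate 0 S = S := by
  ext e
  simp [mem_translate]

theorem translate_translate (v w : ℤ × ℤ) (S : Set (Edge ℤ)) :
    translate v (translate w S) = translate (v + w) S := by
  ext e
  simp [mem_translate, add_assoc]

/-- The law of a random set of edges is stationary if it is invariant under translations. -/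
def IsStationary (P : Measure (Set (Edge ℤ))) : Prop :=
  ∀ v, MeasurePreserving (translate v) P P

theorem IsStationary.isPlaneAction {P : Measure (Set (Edge ℤ))} (hP : IsStationary P) :
    IsPlaneAction P translate :=
  ⟨translate_zero, translate_translate, hP⟩

theorem measurableSet_mem_edges (e : Edge ℤ) : MeasurableSet {S : Set (Edge ℤ) | e ∈ S} :=
  measurableSet_setOfPred.2 (measurable_set_mem e)

open Classical in
/-- The number of edges of `S` that leave the origin to the right or upwards. -/
def originCount (S : Set (Edge ℤ)) : ℝ :=
  (if ((0, Dir.right) : Edge ℤ) ∈ S then 1 else 0) + (if ((0, Dir.up) : Edge ℤ) ∈ S then 1 else 0)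

theorem measurable_originCount : Measurable originCount :=
  (Measurable.ite (measurableSet_mem_edges _) measurable_const measurable_const).add
    (Measurable.ite (measurableSet_mem_edges _) measurable_const measurable_const)

theorem originCount_nonneg (S : Set (Edge ℤ)) : 0 ≤ originCount S := by
  unfold originCount
  positivity

theorem abs_originCount_le (S : Set (Edge ℤ)) : |originCount S| ≤ 2 := by
  rw [abs_of_nonneg (originCount_nonneg S)]
  unfold originCount
  split_ifs <;> norm_num

open Classical in
/-- Up to a boundary term, the number of edges of `S` in a box is the sum of the translates of
`originCount`. -/
theorem ncard_inter_boxEdges (S : Set (Edge ℤ)) (n : ℕ) :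
    ((S ∩ boxEdges n).ncard : ℝ) ≤ ∑ v ∈ boxAt 0 n, originCount (translate v S) ∧
      ∑ v ∈ boxAt 0 n, originCount (translate v S) ≤
        (S ∩ boxEdges n).ncard + 2 * (2 * n + 1) := by
  set B : Finset (Edge ℤ) := boxAt 0 n ×ˢ {Dir.right, Dir.up} with hB
  have hmemB : ∀ e : Edge ℤ, e ∈ B ↔ e.1 ∈ boxAt 0 n := by
    rintro ⟨v, d⟩
    cases d <;> simp [hB]
  have hsum : ∑ v ∈ boxAt 0 n, originCount (translate v S) = (B.filter (· ∈ S)).card := by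
    rw [Finset.card_filter, Nat.cast_sum, hB, Finset.sum_product]
    refine Finset.sum_congr rfl fun v _ => ?_
    rw [Finset.sum_insert (by simp), Finset.sum_singleton]
    simp [originCount, mem_translate]
  have hsplit : S ∩ boxEdges n = ((B.filter (· ∈ S)).filter (· ∈ boxEdges n) : Finset _) := by
    ext e
    simp only [Set.mem_inter_iff, Finset.coe_filter, Finset.mem_filter, Set.mem_ofPred_eq, hmemB]
    constructor
    · rintro ⟨h1, h2⟩
      refine ⟨⟨?_, h1⟩, h2⟩
      have h3 := h2.1
      simp only [src, abs_le] at h3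
      simp only [mem_boxAt, Prod.fst_zero, Prod.snd_zero]
      omega
    · rintro ⟨⟨_, h1⟩, h2⟩
      exact ⟨h1, h2⟩
  have hrest : ((B.filter (· ∈ S)).filter (· ∉ boxEdges n)).card ≤ 2 * (2 * n + 1) := by
    have hsub : (B.filter (· ∈ S)).filter (· ∉ boxEdges n) ⊆
        (Finset.Icc (-n : ℤ) n).image (fun y => (((n : ℤ), y), Dir.right)) ∪
          (Finset.Icc (-n : ℤ) n).image (fun x => ((x, (n : ℤ)), Dir.up)) := by
      rintro ⟨⟨x, y⟩, d⟩ he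
      simp only [Finset.mem_filter, hmemB, mem_boxAt, Prod.fst_zero, Prod.snd_zero] at he
      cases d <;>
      simp only [boxEdges, src, tgt, Set.mem_ofPred_eq, abs_le, Finset.mem_union,
        Finset.mem_image, Finset.mem_Icc, Prod.mk.injEq, and_true, reduceCtorEq, and_false,
        exists_false, or_false, false_or] at he ⊢
      · exact ⟨y, by omega, by omega, rfl⟩
      · exact ⟨x, by omega, rfl, by omega⟩
    refine (Finset.card_le_card hsub).trans ((Finset.card_union_le _ _).trans ?_)
    have h1 : (Finset.Icc (-n : ℤ) n).card = 2 * n + 1 := by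
      rw [Int.card_Icc]
      omega
    have h2 := (Finset.card_image_le (s := Finset.Icc (-n : ℤ) n)
      (f := fun y => (((n : ℤ), y), Dir.right)))
    have h3 := (Finset.card_image_le (s := Finset.Icc (-n : ℤ) n)
      (f := fun x => ((x, (n : ℤ)), Dir.up)))
    omega
  rw [hsum, hsplit, Set.ncard_coe_finset]
  have := Finset.card_filter_add_card_filter_not (s := B.filter (· ∈ S)) (· ∈ boxEdges n)
  constructor
  · exact_mod_cast Finset.card_filter_le _ _
  · have h : (B.filter (· ∈ S)).card ≤
        ((B.filter (· ∈ S)).filter (· ∈ boxEdges n)).card + 2 * (2 * n + 1) := by omega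
    exact_mod_cast h

theorem tendsto_ncard_inter_boxEdges {S : Set (Edge ℤ)} {ρ : ℝ}
    (h : Tendsto (fun n => boxAverage translate originCount n S) atTop (𝓝 ρ)) :
    Tendsto (fun n : ℕ => ((S ∩ boxEdges n).ncard : ℝ) / (2 * n + 1) ^ 2) atTop (𝓝 ρ) := by
  have h0 : Tendsto (fun n : ℕ => 2 * (1 / ((n : ℝ) + 1))) atTop (𝓝 0) := by
    simpa using (tendsto_one_div_add_atTop_nhds_zero_nat (𝕜 := ℝ)).const_mul 2
  have h1 : Tendsto (fun n : ℕ => boxAverage translate originCount n S - 2 * (1 / ((n : ℝ) + 1)))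
      atTop (𝓝 ρ) := by simpa using h.sub h0
  refine tendsto_of_tendsto_of_tendsto_of_le_of_le h1 h (fun n => ?_) fun n => ?_
  · have := (ncard_inter_boxEdges S n).2
    have hpos : (0 : ℝ) < (2 * n + 1) ^ 2 := by positivity
    have h2 : 2 * (2 * n + 1 : ℝ) / (2 * n + 1) ^ 2 ≤ 2 * (1 / ((n : ℝ) + 1)) := by
      rw [mul_one_div, div_le_div_iff₀ hpos (by positivity)]
      nlinarith [(n.cast_nonneg : (0 : ℝ) ≤ n)]
    have h3 : boxAverage translate originCount n S ≤
        ((S ∩ boxEdges n).ncard + 2 * (2 * n + 1)) / (2 * n + 1) ^ 2 := by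
      unfold boxAverage
      gcongr
    rw [add_div] at h3
    simp only
    linarith
  · simp only [boxAverage]
    gcongr
    exact (ncard_inter_boxEdges S n).1

/-- A stationary random set of edges almost surely has positive density, unless it is empty. -/
theorem IsStationary.hasPositiveDensity {P : Measure (Set (Edge ℤ))} [IsProbabilityMeasure P]
    (hP : IsStationary P) : ∀ᵐ S ∂P, S.Nonempty → HasPositiveDensity S := by
  filter_upwards [hP.isPlaneAction.exists_tendsto_boxAverage_pos measurable_originCount
    abs_originCount_le originCount_nonneg] with S hS hne
  obtain ⟨⟨v, d⟩, he⟩ := hne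
  obtain ⟨ρ, hρ, hlim⟩ := hS ⟨v, by
    have h0 : ((0 : Vertex ℤ) + v, d) ∈ S := by simpa using he
    unfold originCount
    cases d
    · rw [if_pos (mem_translate.2 h0)]
      split_ifs <;> norm_num
    · rw [if_pos (c := ((0, Dir.up) : Edge ℤ) ∈ translate v S) h0]
      split_ifs <;> norm_num⟩
  have hall : Tendsto (fun n => boxAverage translate originCount n Set.univ) atTop (𝓝 2) := by
    have : ∀ n, boxAverage translate originCount n Set.univ = 2 :=
      boxAverage_of_const fun v => by
        simp [originCount, mem_translate]
        norm_num
    simp only [this]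
    exact tendsto_const_nhds
  refine ⟨ρ / 2, half_pos hρ, ?_⟩
  have h1 := (tendsto_ncard_inter_boxEdges hlim).div (tendsto_ncard_inter_boxEdges hall) two_ne_zero
  refine h1.congr fun n => ?_
  rw [Pi.div_apply, Set.univ_inter]
  exact div_div_div_cancel_right₀ (by positivity) _ _

/-! ### Two-regular graphs -/

section TwoRegular

variable {V : Type*} {G : SimpleGraph V}

/-- A two-sided walk without backtracking that uses up the neighbours of its vertices. -/
structure IsTwoSidedWalk (G : SimpleGraph V) (γ : ℤ → V) : Prop where
  adj : ∀ i, G.Adj (γ i) (γ (i + 1))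
  ne : ∀ i, γ (i - 1) ≠ γ (i + 1)
  eq_or_eq : ∀ i x, G.Adj (γ i) x → x = γ (i - 1) ∨ x = γ (i + 1)

theorem IsTwoSidedWalk.adj' {γ : ℤ → V} (h : IsTwoSidedWalk G γ) (i : ℤ) :
    G.Adj (γ i) (γ (i - 1)) := by
  have := h.adj (i - 1)
  rw [sub_add_cancel] at this
  exact this.symm

/-- In a component all of whose vertices have degree two, following the other neighbour again and
again gives a two-sided walk. -/
theorem exists_isTwoSidedWalk (u₀ : V)
    (hdeg : ∀ v, G.Reachable u₀ v → (G.neighborSet v).ncard = 2) :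
    ∃ γ : ℤ → V, γ 0 = u₀ ∧ IsTwoSidedWalk G γ := by
  classical
  have hother : ∀ v w, ∃ x, G.Reachable u₀ v → G.Adj v w →
      G.Adj v x ∧ x ≠ w ∧ ∀ y, G.Adj v y → y = w ∨ y = x := by
    intro v w
    by_cases h : G.Reachable u₀ v ∧ G.Adj v w
    · obtain ⟨a, b, hab, hN⟩ := Set.ncard_eq_two.1 (hdeg v h.1)
      have hmem : ∀ y, G.Adj v y ↔ y = a ∨ y = b := fun y => by
        rw [← SimpleGraph.mem_neighborSet, hN]
        simp
      rcases (hmem w).1 h.2 with rfl | rfl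
      · exact ⟨b, fun _ _ => ⟨(hmem b).2 (Or.inr rfl), hab.symm, fun y hy => (hmem y).1 hy⟩⟩
      · exact ⟨a, fun _ _ => ⟨(hmem a).2 (Or.inl rfl), hab, fun y hy => ((hmem y).1 hy).symm⟩⟩
    · exact ⟨v, fun h1 h2 => absurd ⟨h1, h2⟩ h⟩
  choose o ho using hother
  let Dart : Type _ := {p : V × V // G.Reachable u₀ p.1 ∧ G.Adj p.1 p.2}
  have hr : ∀ p : Dart, G.Reachable u₀ p.1.2 := fun p => p.2.1.trans p.2.2.reachable
  have hoo : ∀ v w, G.Reachable u₀ v → G.Adj v w → o v (o v w) = w := by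
    intro v w hv hvw
    obtain ⟨h1, h2, h3⟩ := ho v w hv hvw
    obtain ⟨h4, h5, h6⟩ := ho v (o v w) hv h1
    rcases h3 _ h4 with h | h
    · exact h
    · exact absurd h h5
  let e : Equiv.Perm Dart :=
    { toFun := fun p => ⟨(p.1.2, o p.1.2 p.1.1), hr p, (ho _ _ (hr p) p.2.2.symm).1⟩
      invFun := fun p => ⟨(o p.1.1 p.1.2, p.1.1),
        p.2.1.trans (ho _ _ p.2.1 p.2.2).1.reachable, (ho _ _ p.2.1 p.2.2).1.symm⟩
      left_inv := fun p => Subtype.ext (Prod.ext (hoo _ _ (hr p) p.2.2.symm) rfl)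
      right_inv := fun p => Subtype.ext (Prod.ext rfl (hoo _ _ p.2.1 p.2.2)) }
  obtain ⟨w₀, hw₀⟩ : ∃ w, G.Adj u₀ w := by
    obtain ⟨a, b, _, hN⟩ := Set.ncard_eq_two.1 (hdeg u₀ (SimpleGraph.Reachable.refl _))
    refine ⟨a, ?_⟩
    rw [← SimpleGraph.mem_neighborSet, hN]
    simp
  let d : ℤ → Dart := fun i => (e ^ i) ⟨(u₀, w₀), SimpleGraph.Reachable.refl _, hw₀⟩
  have hd : ∀ i, d (i + 1) = e (d i) := fun i => by
    simp only [d]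
    rw [add_comm, zpow_add, zpow_one, Equiv.Perm.mul_apply]
  have h1 : ∀ i, (d (i + 1)).1.1 = (d i).1.2 := fun i => by
    rw [hd]
    rfl
  have h2 : ∀ i, (d (i + 1)).1.2 = o (d i).1.2 (d i).1.1 := fun i => by
    rw [hd]
    rfl
  have h3 : ∀ i, (d (i - 1)).1.2 = (d i).1.1 := fun i => by
    have := h1 (i - 1)
    rw [sub_add_cancel] at this
    exact this.symm
  have h4 : ∀ i, o (d i).1.1 (d (i - 1)).1.1 = (d i).1.2 := fun i => by
    have := h2 (i - 1)
    rw [sub_add_cancel, h3] at this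
    exact this.symm
  have h5 : ∀ i, G.Adj (d i).1.1 (d (i - 1)).1.1 := fun i => by
    have := (d (i - 1)).2.2.symm
    rwa [h3] at this
  refine ⟨fun i => (d i).1.1, by simp [d], ⟨fun i => ?_, fun i => ?_, fun i x hx => ?_⟩⟩
  · rw [h1]
    exact (d i).2.2
  · rw [h1, ← h4]
    exact (ho _ _ (d i).2.1 (h5 i)).2.1.symm
  · rw [h1, ← h4]
    exact (ho _ _ (d i).2.1 (h5 i)).2.2 x hx

/-- Two points of a two-sided walk that agree together with their successors have the same
continuations in both directions. -/
theorem IsTwoSidedWalk.eq_of_eq {γ δ : ℤ → V} (hγ : IsTwoSidedWalk G γ) (hδ : IsTwoSidedWalk G δ)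
    (h0 : γ 0 = δ 0) (h1 : γ 1 = δ 1) : γ = δ := by
  have key : ∀ t : ℤ, γ t = δ t ∧ γ (t + 1) = δ (t + 1) := by
    intro t
    induction t using Int.induction_on with
    | zero => exact ⟨h0, by simpa using h1⟩
    | succ n ih =>
      refine ⟨ih.2, ?_⟩
      have h := hγ.adj (n + 1)
      rw [ih.2] at h
      rcases hδ.eq_or_eq _ _ h with h | h
      · rw [add_sub_cancel_right, ← ih.1] at h
        have := hγ.ne (n + 1)
        rw [add_sub_cancel_right] at this
        exact absurd h.symm this
      · exact h
    | pred n ih =>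
      have h := hγ.adj' (-n)
      rw [ih.1] at h
      rw [sub_add_cancel]
      refine ⟨?_, ih.1⟩
      rcases hδ.eq_or_eq _ _ h with h | h
      · exact h
      · rw [← ih.2] at h
        exact absurd h (hγ.ne _)
  exact funext fun t => (key t).1

theorem IsTwoSidedWalk.shift {γ : ℤ → V} (h : IsTwoSidedWalk G γ) (a : ℤ) :
    IsTwoSidedWalk G fun t => γ (a + t) where
  adj i := by simpa only [add_assoc] using h.adj (a + i)
  ne i := by simpa only [add_assoc, add_sub_assoc] using h.ne (a + i)
  eq_or_eq i x hx := by simpa only [add_assoc, add_sub_assoc] using h.eq_or_eq (a + i) x hx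

theorem IsTwoSidedWalk.reverse {γ : ℤ → V} (h : IsTwoSidedWalk G γ) :
    IsTwoSidedWalk G fun t => γ (-t) where
  adj i := by
    have := h.adj' (-i)
    rwa [show -i - 1 = -(i + 1) by ring] at this
  ne i := by
    have := (h.ne (-i)).symm
    rwa [show -i + 1 = -(i - 1) by ring, show -i - 1 = -(i + 1) by ring] at this
  eq_or_eq i x hx := by
    have := (h.eq_or_eq (-i) x hx).symm
    rwa [show -i + 1 = -(i - 1) by ring, show -i - 1 = -(i + 1) by ring] at this

/-- A two-sided walk with infinite range is injective: a first coincidence would make it either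
periodic or symmetric under a reflection, and the latter contradicts the absence of
backtracking. -/
theorem IsTwoSidedWalk.injective {γ : ℤ → V} (h : IsTwoSidedWalk G γ)
    (hinf : (Set.range γ).Infinite) : Function.Injective γ := by
  have key : ∀ i j : ℤ, i < j → γ i ≠ γ j := by
    intro i j hij heq
    have hadj := h.adj j
    rw [← heq] at hadj
    rcases h.eq_or_eq _ _ hadj with h1 | h1
    · -- reflection about the midpoint of `i` and `j`
      have hrefl := (h.shift j).eq_of_eq ((h.shift (i)).reverse)
        (by simpa using heq.symm) (by simpa [sub_eq_add_neg] using h1)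
      have hrefl' : ∀ t, γ (j + t) = γ (i - t) := fun t => by
        have := congrFun hrefl t
        simpa [sub_eq_add_neg] using this
      rcases Int.even_or_odd' (j - i) with ⟨m, hm | hm⟩
      · have h2 := hrefl' (1 - m)
        rw [show j + (1 - m) = (i + m) + 1 by omega, show i - (1 - m) = (i + m) - 1 by omega] at h2
        exact h.ne _ h2.symm
      · have h2 := hrefl' (-m)
        rw [show j + -m = (i + m) + 1 by omega, show i - -m = i + m by omega] at h2
        exact (h.adj (i + m)).ne h2.symm
    · have hper := (h.shift j).eq_of_eq (h.shift i) (by simpa using heq.symm) (by simpa using h1)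
      have hper' : ∀ t, γ (t + (j - i)) = γ t := fun t => by
        have : γ (j + (t - i)) = γ (i + (t - i)) := congrFun hper (t - i)
        rwa [show j + (t - i) = t + (j - i) by ring, show i + (t - i) = t by ring] at this
      refine hinf (((Set.finite_Ico 0 (j - i)).image γ).subset ?_)
      rintro _ ⟨t, rfl⟩
      have hP : Function.Periodic γ (j - i) := hper'
      refine ⟨t % (j - i), ⟨Int.emod_nonneg _ (by omega), Int.emod_lt_of_pos _ (by omega)⟩, ?_⟩
      have := hP.sub_zsmul_eq (x := t) (t / (j - i))
      rwa [smul_eq_mul, mul_comm, ← Int.emod_def] at this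
  intro i j hij
  rcases lt_trichotomy i j with h1 | h1 | h1
  · exact absurd hij (key i j h1)
  · exact h1
  · exact absurd hij.symm (key j i h1)

/-- An infinite component in which all degrees are two is a doubly infinite path. -/
theorem exists_doublyInfinitePath (u₀ : V) (hinf : {v | G.Reachable u₀ v}.Infinite)
    (hdeg : ∀ v, G.Reachable u₀ v → (G.neighborSet v).ncard = 2) :
    ∃ γ : ℤ → V, Function.Injective γ ∧ Set.range γ = {v | G.Reachable u₀ v} ∧
      ∀ i j : ℤ, G.Adj (γ i) (γ j) ↔ (j = i + 1 ∨ i = j + 1) := by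
  obtain ⟨γ, h0, hγ⟩ := exists_isTwoSidedWalk u₀ hdeg
  have hrange : Set.range γ = {v | G.Reachable u₀ v} := by
    refine Set.Subset.antisymm ?_ ?_
    · rintro _ ⟨i, rfl⟩
      induction i using Int.induction_on with
      | zero => exact h0 ▸ SimpleGraph.Reachable.refl _
      | succ n ih => exact SimpleGraph.Reachable.trans ih (hγ.adj _).reachable
      | pred n ih => exact SimpleGraph.Reachable.trans ih (hγ.adj' _).reachable
    · intro v hv
      rw [Set.mem_ofPred_eq, SimpleGraph.reachable_iff_reflTransGen] at hv
      induction hv with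
      | refl => exact ⟨0, h0⟩
      | tail _ hadj ih =>
        obtain ⟨i, rfl⟩ := ih
        rcases hγ.eq_or_eq _ _ hadj with rfl | rfl
        · exact ⟨_, rfl⟩
        · exact ⟨_, rfl⟩
  have hinj := hγ.injective (hrange ▸ hinf)
  refine ⟨γ, hinj, hrange, fun i j => ⟨fun h => ?_, ?_⟩⟩
  · rcases hγ.eq_or_eq _ _ h with h | h
    · have := hinj h
      omega
    · exact Or.inl (hinj h)
  · rintro (rfl | rfl)
    · exact hγ.adj i
    · exact (hγ.adj j).symm

end TwoRegular

/-! ### Faces and dual degrees -/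

/-- The four edges around the face `u`. -/
def faceEdges (u : DualVertex) : Finset (Edge ℤ) :=
  {((u.1, u.2), Dir.right), ((u.1, u.2 + 1), Dir.right), ((u.1, u.2), Dir.up),
    ((u.1 + 1, u.2), Dir.up)}

theorem mem_faceEdges {u : DualVertex} {e : Edge ℤ} :
    e ∈ faceEdges u ↔ u = (dualEdge e).1 ∨ u = (dualEdge e).2 := by
  obtain ⟨⟨x, y⟩, d⟩ := e
  obtain ⟨i, j⟩ := u
  cases d <;> simp [faceEdges, dualEdge] <;> omega

theorem dualEdge_ne (e : Edge ℤ) : (dualEdge e).1 ≠ (dualEdge e).2 := by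
  obtain ⟨⟨x, y⟩, d⟩ := e
  cases d <;> simp [dualEdge]

theorem dualGraph_adj_iff {S : Set (Edge ℤ)} {u v : DualVertex} :
    (dualGraph S).Adj u v ↔ ∃ e ∈ S, dualEdge e = (u, v) ∨ dualEdge e = (v, u) := Iff.rfl

open Classical in
/-- The number of edges of `S` around the face `u`. -/
def faceDegree (S : Set (Edge ℤ)) (u : DualVertex) : ℕ := ((faceEdges u).filter (· ∈ S)).card

theorem dualDegree_eq_faceDegree (S : Set (Edge ℤ)) (u : DualVertex) :
    dualDegree S u = faceDegree S u := by
  classical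
  -- the face across the edge `e` from `u`
  let f : Edge ℤ → DualVertex := fun e => (dualEdge e).1 + (dualEdge e).2 - u
  have himg : (dualGraph S).neighborSet u = ((faceEdges u).filter (· ∈ S)).image f := by
    ext v
    simp only [SimpleGraph.mem_neighborSet, dualGraph_adj_iff, Finset.coe_image,
      Finset.coe_filter, Set.mem_image, Set.mem_ofPred_eq, mem_faceEdges, f]
    constructor
    · rintro ⟨e, he, h | h⟩
      · exact ⟨e, ⟨Or.inl (by rw [h]), he⟩, by rw [h]; simp⟩
      · exact ⟨e, ⟨Or.inr (by rw [h]), he⟩, by rw [h]; simp⟩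
    · rintro ⟨e, ⟨h | h, he⟩, rfl⟩
      · exact ⟨e, he, Or.inl (Prod.ext h.symm (by simp [h]))⟩
      · exact ⟨e, he, Or.inr (Prod.ext (by simp [h]) h.symm)⟩
  rw [dualDegree, himg, Set.ncard_coe_finset, Finset.card_image_of_injOn, faceDegree]
  intro e he e' he' h
  simp only [Finset.coe_filter, Set.mem_ofPred_eq, f] at he he' h
  have h1 := he.1
  have h2 := he'.1
  obtain ⟨i, j⟩ := u
  simp only [faceEdges, Finset.mem_insert, Finset.mem_singleton] at h1 h2
  rcases h1 with rfl | rfl | rfl | rfl <;> rcases h2 with rfl | rfl | rfl | rfl <;>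
    first | rfl | (simp [dualEdge] at h; omega) | (simp [dualEdge] at h)

theorem faceDegree_le (S : Set (Edge ℤ)) (u : DualVertex) : faceDegree S u ≤ 4 := by
  classical
  exact (Finset.card_filter_le _ _).trans Finset.card_le_four

theorem faceDegree_pos_iff {S : Set (Edge ℤ)} {u : DualVertex} :
    0 < faceDegree S u ↔ ∃ e ∈ S, e ∈ faceEdges u := by
  rw [faceDegree, Finset.card_pos]
  simp only [Finset.Nonempty, Finset.mem_filter, and_comm]

theorem neighborSet_nonempty_iff {S : Set (Edge ℤ)} {u : DualVertex} :
    ((dualGraph S).neighborSet u).Nonempty ↔ 0 < faceDegree S u := by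
  rw [faceDegree_pos_iff]
  constructor
  · rintro ⟨v, e, he, h⟩
    refine ⟨e, he, mem_faceEdges.2 ?_⟩
    rcases h with h | h <;> simp [h]
  · rintro ⟨e, he, h⟩
    rcases mem_faceEdges.1 h with rfl | rfl
    · exact ⟨_, e, he, Or.inl rfl⟩
    · exact ⟨_, e, he, Or.inr rfl⟩

/-- A set of edges is even if an even number of its edges surrounds each face, that is, if it is a
cycle modulo two of the dual lattice. -/
def IsEven (S : Set (Edge ℤ)) : Prop := ∀ u, Even (faceDegree S u)

open Classical in
/-- The indicator function of `S` with values in `ZMod 2`. -/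
def parity (S : Set (Edge ℤ)) (e : Edge ℤ) : ZMod 2 := if e ∈ S then 1 else 0

theorem parity_eq_one {S : Set (Edge ℤ)} {e : Edge ℤ} : parity S e = 1 ↔ e ∈ S := by
  unfold parity
  split_ifs with h <;> simp [h]

theorem parity_eq_zero {S : Set (Edge ℤ)} {e : Edge ℤ} : parity S e = 0 ↔ e ∉ S := by
  unfold parity
  split_ifs with h <;> simp [h]

theorem faceDegree_cast (S : Set (Edge ℤ)) (u : DualVertex) :
    (faceDegree S u : ZMod 2) = parity S ((u.1, u.2), Dir.right) +
      parity S ((u.1, u.2 + 1), Dir.right) + parity S ((u.1, u.2), Dir.up) +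
      parity S ((u.1 + 1, u.2), Dir.up) := by
  classical
  rw [faceDegree, Finset.card_filter, Nat.cast_sum, faceEdges,
    Finset.sum_insert (by simp [Prod.ext_iff]), Finset.sum_insert (by simp),
    Finset.sum_insert (by simp [Prod.ext_iff]), Finset.sum_singleton]
  simp [parity, add_assoc]

theorem even_faceDegree_iff {S : Set (Edge ℤ)} {u : DualVertex} :
    Even (faceDegree S u) ↔ parity S ((u.1, u.2), Dir.right) +
      parity S ((u.1, u.2 + 1), Dir.right) + parity S ((u.1, u.2), Dir.up) +
      parity S ((u.1 + 1, u.2), Dir.up) = 0 := by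
  rw [← faceDegree_cast, ZMod.natCast_eq_zero_iff_even]

/-- An interface crosses the boundary of each face an even number of times. -/
theorem isEven_interface (σ σ' : SpinConf ℤ) : IsEven (interface σ σ') := by
  let g : Vertex ℤ → ZMod 2 := fun v => if σ v * σ' v = 1 then 0 else 1
  have hg : ∀ e, parity (interface σ σ') e = g (src e) + g (tgt e) := by
    intro e
    simp only [parity, interface, bond, Set.mem_ofPred_eq, g]
    rcases Int.units_eq_one_or (σ (src e)) with h1 | h1 <;>
    rcases Int.units_eq_one_or (σ (tgt e)) with h2 | h2 <;>
    rcases Int.units_eq_one_or (σ' (src e)) with h3 | h3 <;>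
    rcases Int.units_eq_one_or (σ' (tgt e)) with h4 | h4 <;>
    simp [h1, h2, h3, h4] <;> decide
  intro u
  rw [even_faceDegree_iff, hg, hg, hg, hg]
  simp only [src, tgt]
  generalize g (u.1, u.2) = a
  generalize g (u.1, u.2 + 1) = b
  generalize g (u.1 + 1, u.2) = c
  generalize g (u.1 + 1, u.2 + 1) = d
  revert a b c d
  decide

/-! ### Finite cycles enclose finite sets of vertices -/

/-- A nonempty finite even set of edges contains the boundary of a nonempty finite set of
vertices: those with an odd number of edges of the set to their left. -/
theorem exists_edgeBoundary_subset {F : Set (Edge ℤ)} (hfin : F.Finite) (heven : IsEven F)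
    (hne : F.Nonempty) :
    ∃ A : Finset (Vertex ℤ), A.Nonempty ∧ edgeBoundary (A : Set (Vertex ℤ)) ⊆ F := by
  obtain ⟨K, hK⟩ : ∃ K : ℤ, ∀ e ∈ F, (-K < e.1.1 ∧ e.1.1 < K) ∧ -K < e.1.2 ∧ e.1.2 < K := by
    obtain ⟨K, hK⟩ := (hfin.image fun e => |e.1.1| + |e.1.2|).bddAbove
    refine ⟨K + 1, fun e he => ?_⟩
    have h1 : |e.1.1| + |e.1.2| ≤ K := hK ⟨e, he, rfl⟩
    have h2 := abs_le.1 (show |e.1.1| ≤ K by linarith [abs_nonneg e.1.2])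
    have h3 := abs_le.1 (show |e.1.2| ≤ K by linarith [abs_nonneg e.1.1])
    omega
  have hout : ∀ x y d, (x ≤ -K ∨ K ≤ x ∨ y ≤ -K ∨ K ≤ y) → parity F ((x, y), d) = 0 := by
    intro x y d h
    rw [parity_eq_zero]
    intro he
    have := hK _ he
    simp only at this
    omega
  let τ : ℤ → ℤ → ZMod 2 := fun x y => ∑ x' ∈ Finset.Ico (-K) x, parity F ((x', y), Dir.right)
  have hleft : ∀ x y, x ≤ -K → τ x y = 0 := fun x y hx => by
    simp only [τ, Finset.Ico_eq_empty_of_le hx, Finset.sum_empty]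
  have hright : ∀ x y, τ (x + 1) y + τ x y = parity F ((x, y), Dir.right) := by
    intro x y
    by_cases hx : x < -K
    · rw [hleft _ _ (by omega), hleft _ _ (by omega), hout _ _ _ (by omega), add_zero]
    · have h1 : Finset.Ico (-K) (x + 1) = insert x (Finset.Ico (-K) x) := by
        ext z
        simp only [Finset.mem_Ico, Finset.mem_insert]
        omega
      simp only [τ]
      rw [h1, Finset.sum_insert (by simp), add_assoc, CharTwo.add_self_eq_zero, add_zero]
  have hup : ∀ x y, τ x (y + 1) + τ x y = parity F ((x, y), Dir.up) := by
    intro x y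
    rcases le_total x (-K) with hx | hx
    · rw [hleft _ _ hx, hleft _ _ hx, hout _ _ _ (Or.inl hx), add_zero]
    · induction x, hx using Int.leInduction with
      | base => rw [hleft _ _ le_rfl, hleft _ _ le_rfl, hout _ _ _ (Or.inl le_rfl), add_zero]
      | succ x hx ih =>
        have h1 := hright x y
        have h2 := hright x (y + 1)
        have h3 := even_faceDegree_iff.1 (heven (x, y))
        simp only at h3
        rw [← h1, ← h2, ← ih] at h3
        generalize parity F ((x + 1, y), Dir.up) = p at *
        generalize τ (x + 1) (y + 1) = a at *
        generalize τ (x + 1) y = b at *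
        generalize τ x (y + 1) = c at *
        generalize τ x y = d at *
        clear h1 h2 ih
        revert h3
        revert a b c d p
        decide
  have hrow : ∀ x y, (y ≤ -K ∨ K ≤ y) → τ x y = 0 := fun x y hy =>
    Finset.sum_eq_zero fun x' _ => hout _ _ _ (by omega)
  have hfar : ∀ x y, K ≤ x → τ x y = 0 := by
    intro x y hx
    rcases le_total K y with hy | hy
    · exact hrow x y (Or.inr hy)
    · induction y, hy using Int.leInductionDown with
      | base => exact hrow x K (Or.inr le_rfl)
      | pred y hy ih =>
        have h1 := hup x (y - 1)
        rw [sub_add_cancel, ih, hout _ _ _ (by omega), zero_add] at h1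
        exact h1
  have hA : {v : Vertex ℤ | τ v.1 v.2 = 1}.Finite := by
    refine ((Set.finite_Icc (-K) K).prod (Set.finite_Icc (-K) K)).subset ?_
    rintro ⟨x, y⟩ h
    have h' : τ x y = 1 := h
    have h1 : ¬ x ≤ -K := fun hx => by simp [hleft x y hx] at h'
    have h2 : ¬ K ≤ x := fun hx => by simp [hfar x y hx] at h'
    have h3 : ¬ y ≤ -K := fun hy => by simp [hrow x y (Or.inl hy)] at h'
    have h4 : ¬ K ≤ y := fun hy => by simp [hrow x y (Or.inr hy)] at h'
    exact ⟨⟨by omega, by omega⟩, ⟨by omega, by omega⟩⟩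
  have hedge : ∀ e : Edge ℤ, τ (tgt e).1 (tgt e).2 + τ (src e).1 (src e).2 = parity F e := by
    rintro ⟨⟨x, y⟩, d⟩
    cases d
    · exact hright x y
    · exact hup x y
  refine ⟨hA.toFinset, ?_, ?_⟩
  · obtain ⟨e, he⟩ := hne
    have h1 := hedge e
    rw [parity_eq_one.2 he] at h1
    have h2 : ∀ a b : ZMod 2, a + b = 1 → a = 1 ∨ b = 1 := by decide
    rcases h2 _ _ h1 with h | h
    · exact ⟨tgt e, by simpa using h⟩
    · exact ⟨src e, by simpa using h⟩
  · intro e he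
    simp only [edgeBoundary, Set.Finite.coe_toFinset, Set.mem_ofPred_eq] at he
    rw [← parity_eq_one, ← hedge e]
    have h2 : ∀ a b : ZMod 2, Xor (b = 1) (a = 1) → a + b = 1 := by
      intro a b
      unfold Xor
      revert a b
      decide
    exact h2 _ _ he

/-- No nonempty finite set of vertices has its whole boundary in `S`. -/
def EnclosesNothing (S : Set (Edge ℤ)) : Prop :=
  ∀ A : Finset (Vertex ℤ), A.Nonempty → ¬ edgeBoundary (A : Set (Vertex ℤ)) ⊆ S

theorem EnclosesNothing.eq_empty {S F : Set (Edge ℤ)} (hS : EnclosesNothing S) (hFS : F ⊆ S)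
    (hfin : F.Finite) (heven : IsEven F) : F = ∅ := by
  by_contra hne
  obtain ⟨A, hA, hAF⟩ := exists_edgeBoundary_subset hfin heven (Set.nonempty_iff_ne_empty.2 hne)
  exact hS A hA (hAF.trans hFS)

theorem faceDegree_eq_of_forall {S F : Set (Edge ℤ)} {u : DualVertex}
    (h : ∀ e ∈ faceEdges u, e ∈ F ↔ e ∈ S) : faceDegree F u = faceDegree S u := by
  classical
  rw [faceDegree, faceDegree, Finset.filter_congr h]

/-- In an even set of edges that encloses nothing, every domain wall is infinite. -/
theorem infinite_component {S : Set (Edge ℤ)} (heven : IsEven S) (hS : EnclosesNothing S)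
    {u : DualVertex} (hu : 0 < faceDegree S u) : {v | (dualGraph S).Reachable u v}.Infinite := by
  intro hfin
  set D := {v | (dualGraph S).Reachable u v} with hD
  set F : Set (Edge ℤ) := {e | e ∈ S ∧ (dualEdge e).1 ∈ D} with hF
  have hends : ∀ e ∈ S, (dualEdge e).1 ∈ D ↔ (dualEdge e).2 ∈ D := by
    intro e he
    have hadj : (dualGraph S).Adj (dualEdge e).1 (dualEdge e).2 := ⟨e, he, Or.inl rfl⟩
    exact ⟨fun h => SimpleGraph.Reachable.trans h hadj.reachable,
      fun h => SimpleGraph.Reachable.trans h hadj.symm.reachable⟩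
  have hFD : ∀ v ∈ D, ∀ e ∈ faceEdges v, (e ∈ F ↔ e ∈ S) := by
    intro v hv e he
    refine ⟨fun h => h.1, fun h => ⟨h, ?_⟩⟩
    rcases mem_faceEdges.1 he with rfl | rfl
    · exact hv
    · exact (hends e h).2 hv
  have hFfin : F.Finite := by
    refine (hfin.biUnion fun v _ => (faceEdges v).finite_toSet).subset fun e he => ?_
    exact Set.mem_biUnion he.2 (mem_faceEdges.2 (Or.inl rfl))
  have hFeven : IsEven F := by
    intro v
    by_cases hv : v ∈ D
    · rw [faceDegree_eq_of_forall (hFD v hv)]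
      exact heven v
    · have : faceDegree F v = 0 := by
        by_contra h
        obtain ⟨e, he, hev⟩ := faceDegree_pos_iff.1 (Nat.pos_of_ne_zero h)
        rcases mem_faceEdges.1 hev with rfl | rfl
        · exact hv he.2
        · exact hv ((hends e he.1).1 he.2)
      simp [this]
  obtain ⟨e, he, heu⟩ := faceDegree_pos_iff.1 hu
  have := hS.eq_empty (fun e he => he.1) hFfin hFeven
  have hmem : e ∈ F := (hFD u (SimpleGraph.Reachable.refl u) e heu).2 he
  rw [this] at hmem
  exact hmem

/-- If there are no vertices of degree four, the domain walls are doubly infinite paths. -/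
theorem IsDomainWall.isDoublyInfinitePath {S : Set (Edge ℤ)} (heven : IsEven S)
    (hS : EnclosesNothing S) (h4 : ∀ u, faceDegree S u ≠ 4) {D : Set DualVertex}
    (hD : IsDomainWall S D) : (∀ u ∈ D, dualDegree S u = 2) ∧ IsDoublyInfinitePath S D := by
  obtain ⟨u, hu, rfl⟩ := hD
  have hdeg : ∀ v, (dualGraph S).Reachable u v → dualDegree S v = 2 := by
    intro v hv
    have hpos : 0 < faceDegree S v := by
      rw [← neighborSet_nonempty_iff]
      rw [SimpleGraph.reachable_iff_reflTransGen] at hv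
      rcases Relation.ReflTransGen.cases_tail hv with h | ⟨w, _, h⟩
      · exact h ▸ hu
      · exact ⟨w, h.symm⟩
    rw [dualDegree_eq_faceDegree]
    have h1 := h4 v
    have h2 := faceDegree_le S v
    obtain ⟨k, hk⟩ := heven v
    omega
  exact ⟨hdeg, exists_doublyInfinitePath u
    (infinite_component heven hS (neighborSet_nonempty_iff.1 hu)) hdeg⟩

/-! ### Counting four-branching points -/

/-- A finite set of dual edges of a set that encloses nothing has at most as many edges as
vertices: a set of edges is determined by the set of vertices at which its degree is odd. -/
theorem EnclosesNothing.card_le {S : Set (Edge ℤ)} (hS : EnclosesNothing S)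
    (F : Finset (Edge ℤ)) (V : Finset DualVertex) (hFS : (F : Set (Edge ℤ)) ⊆ S)
    (hFV : ∀ e ∈ F, (dualEdge e).1 ∈ V ∧ (dualEdge e).2 ∈ V) : F.card ≤ V.card := by
  classical
  let odd : Finset (Edge ℤ) → Finset DualVertex := fun A =>
    V.filter fun u => ¬ Even (faceDegree (A : Set (Edge ℤ)) u)
  have hinj : Set.InjOn odd (F.powerset : Set (Finset (Edge ℤ))) := by
    intro A hA B hB hAB
    have hA' : A ⊆ F := by simpa using hA
    have hB' : B ⊆ F := by simpa using hB
    have hpar : ∀ e, parity (symmDiff A B : Finset _) e =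
        parity (A : Set (Edge ℤ)) e + parity (B : Set (Edge ℤ)) e := by
      intro e
      simp only [parity, Finset.mem_coe, Finset.mem_symmDiff]
      by_cases h1 : e ∈ A <;> by_cases h2 : e ∈ B <;> (simp [h1, h2]; try decide)
    have hsub : symmDiff A B ⊆ F := fun e he => by
      rcases Finset.mem_symmDiff.1 he with h | h
      · exact hA' h.1
      · exact hB' h.1
    have heven : IsEven ((symmDiff A B : Finset _) : Set (Edge ℤ)) := by
      intro u
      by_cases hu : u ∈ V
      · have h1 : ¬ Even (faceDegree (A : Set (Edge ℤ)) u) ↔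
            ¬ Even (faceDegree (B : Set (Edge ℤ)) u) := by
          have := congrArg (u ∈ ·) hAB
          simpa [odd, hu] using this
        rw [not_iff_not] at h1
        have h2 : (faceDegree ((symmDiff A B : Finset _) : Set (Edge ℤ)) u : ZMod 2) =
            faceDegree (A : Set (Edge ℤ)) u + faceDegree (B : Set (Edge ℤ)) u := by
          rw [faceDegree_cast, faceDegree_cast, faceDegree_cast, hpar, hpar, hpar, hpar]
          ring
        rw [← Nat.cast_add, ZMod.natCast_eq_natCast_iff'] at h2
        rw [Nat.even_iff, h2, ← Nat.even_iff, Nat.even_add]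
        exact h1
      · have : faceDegree ((symmDiff A B : Finset _) : Set (Edge ℤ)) u = 0 := by
          by_contra h
          obtain ⟨e, he, heu⟩ := faceDegree_pos_iff.1 (Nat.pos_of_ne_zero h)
          have h3 := hFV e (hsub he)
          rcases mem_faceEdges.1 heu with rfl | rfl
          · exact hu h3.1
          · exact hu h3.2
        rw [this]
        exact Even.zero
    have hempty := hS.eq_empty (fun e he => hFS (hsub he)) (Finset.finite_toSet _) heven
    rw [Finset.coe_eq_empty] at hempty
    exact symmDiff_eq_bot.1 hempty
  have hmaps : Set.MapsTo odd (F.powerset : Set (Finset (Edge ℤ))) V.powerset := fun A _ => by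
    simp only [Finset.coe_powerset, Set.mem_preimage, Set.mem_powerset_iff, Finset.coe_subset]
    exact Finset.filter_subset _ _
  have := Finset.card_le_card_of_injOn odd hmaps hinj
  rw [Finset.card_powerset, Finset.card_powerset] at this
  exact (Nat.pow_le_pow_iff_right (by norm_num)).1 this

open Classical in
/-- The number of four-branching points in a box is at most of the order of its boundary. -/
theorem EnclosesNothing.card_four_le {S : Set (Edge ℤ)} (heven : IsEven S)
    (hS : EnclosesNothing S) (N : ℕ) :
    ((boxAt 0 N).filter fun u => faceDegree S u = 4).card ≤ 8 * (N + 1) := by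
  set V : Finset DualVertex := (boxAt 0 (N + 1)).filter fun u => 0 < faceDegree S u with hV
  set F : Finset (Edge ℤ) := (V.biUnion faceEdges).filter fun e =>
    e ∈ S ∧ (dualEdge e).1 ∈ V ∧ (dualEdge e).2 ∈ V with hF
  have hFV : F.card ≤ V.card := hS.card_le F V
    (fun e he => (Finset.mem_filter.1 he).2.1) fun e he => (Finset.mem_filter.1 he).2.2
  have hsum : ∑ u ∈ V, (F.filter fun e => e ∈ faceEdges u).card = 2 * F.card := by
    have hdc := Finset.sum_card_bipartiteAbove_eq_sum_card_bipartiteBelow (s := V) (t := F)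
      (fun u e => e ∈ faceEdges u)
    refine hdc.trans ?_
    rw [mul_comm, ← smul_eq_mul, ← Finset.sum_const]
    refine Finset.sum_congr rfl fun e he => ?_
    have h1 := (Finset.mem_filter.1 he).2.2
    have : Finset.bipartiteBelow (fun u e => e ∈ faceEdges u) V e =
        {(dualEdge e).1, (dualEdge e).2} := by
      ext u
      simp only [Finset.bipartiteBelow, Finset.mem_filter, mem_faceEdges, Finset.mem_insert,
        Finset.mem_singleton]
      constructor
      · exact fun h => h.2
      · rintro (rfl | rfl)
        · exact ⟨h1.1, Or.inl rfl⟩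
        · exact ⟨h1.2, Or.inr rfl⟩
    rw [this, Finset.card_pair (dualEdge_ne e)]
  set W : Finset DualVertex := (boxAt 0 N).filter fun u => 0 < faceDegree S u with hW
  have hWV : W ⊆ V := by
    intro u hu
    rw [hW, Finset.mem_filter] at hu
    rw [hV, Finset.mem_filter]
    refine ⟨?_, hu.2⟩
    have := hu.1
    simp only [mem_boxAt, Prod.fst_zero, Prod.snd_zero] at this ⊢
    push_cast
    omega
  have hdegW : ∀ u ∈ W, faceDegree S u ≤ (F.filter fun e => e ∈ faceEdges u).card := by
    intro u hu
    refine Finset.card_le_card fun e he => ?_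
    rw [Finset.mem_filter] at he
    have hV' : ∀ w : DualVertex, w = (dualEdge e).1 ∨ w = (dualEdge e).2 → w ∈ V := by
      intro w hw
      rw [hV, Finset.mem_filter]
      refine ⟨?_, faceDegree_pos_iff.2 ⟨e, he.2, mem_faceEdges.2 hw⟩⟩
      have h1 := (Finset.mem_filter.1 hu).1
      have h2 := mem_faceEdges.1 he.1
      obtain ⟨⟨x, y⟩, d⟩ := e
      obtain ⟨i, j⟩ := u
      obtain ⟨k, l⟩ := w
      cases d <;> simp only [dualEdge, Prod.mk.injEq, mem_boxAt, Prod.fst_zero, Prod.snd_zero]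
        at hw h1 h2 ⊢ <;> push_cast <;> omega
    rw [Finset.mem_filter, hF, Finset.mem_filter]
    exact ⟨⟨Finset.mem_biUnion.2 ⟨u, hWV hu, he.1⟩, he.2, hV' _ (Or.inl rfl), hV' _ (Or.inr rfl)⟩,
      he.1⟩
  have hlow : 2 * W.card + 2 * ((boxAt 0 N).filter fun u => faceDegree S u = 4).card ≤
      ∑ u ∈ W, faceDegree S u := by
    have h4 : ((boxAt 0 N).filter fun u => faceDegree S u = 4) =
        W.filter fun u => faceDegree S u = 4 := by
      rw [hW, Finset.filter_filter]
      refine Finset.filter_congr fun u _ => ⟨fun h => ⟨by omega, h⟩, fun h => h.2⟩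
    have hc : 2 * W.card = ∑ u ∈ W, 2 := by rw [Finset.sum_const, smul_eq_mul, mul_comm]
    rw [h4, hc, Finset.card_filter, Finset.mul_sum, ← Finset.sum_add_distrib]
    refine Finset.sum_le_sum fun u hu => ?_
    have h1 := (Finset.mem_filter.1 hu).2
    obtain ⟨k, hk⟩ := heven u
    split_ifs <;> omega
  have hup : ∑ u ∈ W, faceDegree S u ≤ 2 * F.card := by
    rw [← hsum]
    exact (Finset.sum_le_sum hdegW).trans (Finset.sum_le_sum_of_subset hWV)
  have hVW : V.card ≤ W.card + 8 * (N + 1) := by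
    have hsub : V ⊆ W ∪ (boxAt 0 (N + 1) \ boxAt 0 N) := by
      intro u hu
      rw [hV, Finset.mem_filter] at hu
      rw [Finset.mem_union, Finset.mem_sdiff, hW, Finset.mem_filter]
      tauto
    have hbox : boxAt 0 N ⊆ boxAt 0 (N + 1) := by
      intro u hu
      simp only [mem_boxAt, Prod.fst_zero, Prod.snd_zero] at hu ⊢
      push_cast
      omega
    have h1 := (Finset.card_le_card hsub).trans (Finset.card_union_le _ _)
    rw [Finset.card_sdiff_of_subset hbox, card_boxAt, card_boxAt] at h1
    have h2 : (2 * (N + 1) + 1) ^ 2 = (2 * N + 1) ^ 2 + 8 * (N + 1) := by ring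
    omega
  omega

/-! ### Local events of zero density -/

open Classical in
/-- An event whose translates along a sublattice occur in each box at most as often as the size of
the boundary of the box is null. -/
theorem IsStationary.measure_eq_zero {P : Measure (Set (Edge ℤ))} [IsProbabilityMeasure P]
    (hP : IsStationary P) {E : Set (Set (Edge ℤ))} (hE : MeasurableSet E) (k : ℤ) (C : ℕ)
    (h : ∀ᵐ S ∂P, ∀ N : ℕ,
      ((boxAt 0 N).filter fun u => translate (k • u) S ∈ E).card ≤ C * (N + 1)) : P E = 0 := by
  have hbound : ∀ N : ℕ, ((N : ℝ≥0∞) + 1) * P E ≤ C := by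
    intro N
    have h1 : ∫⁻ S, ∑ u ∈ boxAt 0 N, E.indicator 1 (translate (k • u) S) ∂P ≤
        ∫⁻ _, (C * (N + 1) : ℕ) ∂P := by
      refine lintegral_mono_ae ?_
      filter_upwards [h] with S hS
      refine le_trans (le_of_eq ?_) (Nat.cast_le.2 (hS N))
      rw [Finset.card_filter, Nat.cast_sum]
      refine Finset.sum_congr rfl fun u _ => ?_
      by_cases hu : translate (k • u) S ∈ E
      · rw [Set.indicator_of_mem hu, if_pos hu, Pi.one_apply, Nat.cast_one]
      · rw [Set.indicator_of_notMem hu, if_neg hu, Nat.cast_zero]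
    have m : Measurable (E.indicator (1 : Set (Edge ℤ) → ℝ≥0∞)) := measurable_one.indicator hE
    have m' : ∀ u, Measurable fun S => E.indicator (1 : Set (Edge ℤ) → ℝ≥0∞) (translate u S) :=
      fun u => m.comp (hP u).measurable
    rw [lintegral_finsetSum _ fun u _ => m' (k • u), lintegral_const,
      measure_univ, mul_one] at h1
    simp only [(hP _).lintegral_comp m, lintegral_indicator_one hE, Finset.sum_const, card_boxAt,
      nsmul_eq_mul] at h1
    have h2 : ((N : ℝ≥0∞) + 1) * (((N : ℝ≥0∞) + 1) * P E) ≤ ((N : ℝ≥0∞) + 1) * C := by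
      calc ((N : ℝ≥0∞) + 1) * (((N : ℝ≥0∞) + 1) * P E) = (((N + 1) ^ 2 : ℕ) : ℝ≥0∞) * P E := by
            push_cast
            ring
        _ ≤ (((2 * N + 1) ^ 2 : ℕ) : ℝ≥0∞) * P E := by
            gcongr
            omega
        _ ≤ _ := h1
        _ = ((N : ℝ≥0∞) + 1) * C := by
            push_cast
            ring
    exact (ENNReal.mul_le_mul_iff_right (by simp) (by simp)).1 h2
  by_contra h0
  obtain ⟨n, hn⟩ := ENNReal.exists_nat_mul_gt h0 (ENNReal.natCast_ne_top C)
  exact absurd ((mul_le_mul_left (le_self_add : (n : ℝ≥0∞) ≤ n + 1) _).trans (hbound n))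
    (not_le.2 hn)

theorem mem_faceEdges_translate {u v : ℤ × ℤ} {e : Edge ℤ} :
    (e.1 + v, e.2) ∈ faceEdges (u + v) ↔ e ∈ faceEdges u := by
  obtain ⟨⟨x, y⟩, d⟩ := e
  obtain ⟨i, j⟩ := u
  obtain ⟨a, b⟩ := v
  cases d <;>
    simp only [faceEdges, Finset.mem_insert, Finset.mem_singleton, Prod.mk.injEq, Prod.mk_add_mk,
      reduceCtorEq, and_true, and_false, or_false, false_or] <;> omega

theorem faceDegree_translate (S : Set (Edge ℤ)) (u v : ℤ × ℤ) :
    faceDegree (translate v S) u = faceDegree S (u + v) := by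
  classical
  refine Finset.card_bij (fun e _ => (e.1 + v, e.2)) ?_ ?_ ?_
  · intro e he
    rw [Finset.mem_filter] at he ⊢
    exact ⟨mem_faceEdges_translate.2 he.1, he.2⟩
  · intro a _ b _ hab
    simpa [Prod.ext_iff] using hab
  · intro e he
    rw [Finset.mem_filter] at he
    have h1 : ((e.1 - v) + v, e.2) = e := by simp
    refine ⟨(e.1 - v, e.2), ?_, h1⟩
    rw [Finset.mem_filter]
    refine ⟨mem_faceEdges_translate.1 (by rw [h1]; exact he.1), ?_⟩
    rw [mem_translate, h1]
    exact he.2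

theorem measurable_faceDegree (u : DualVertex) : Measurable fun S => faceDegree S u := by
  classical
  have : (fun S => faceDegree S u) =
      fun S : Set (Edge ℤ) => ∑ e ∈ faceEdges u, if e ∈ S then 1 else 0 := by
    funext S
    rw [faceDegree, Finset.card_filter]
  rw [this]
  exact Finset.measurable_sum _ fun e _ =>
    Measurable.ite (measurableSet_mem_edges e) measurable_const measurable_const

/-- A stationary random even set of edges that encloses nothing has no four-branching points. -/
theorem IsStationary.faceDegree_ne_four {P : Measure (Set (Edge ℤ))} [IsProbabilityMeasure P]
    (hP : IsStationary P) (heven : ∀ᵐ S ∂P, IsEven S) (henc : ∀ᵐ S ∂P, EnclosesNothing S) :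
    ∀ᵐ S ∂P, ∀ u, faceDegree S u ≠ 4 := by
  have h0 : P {S | faceDegree S 0 = 4} = 0 := by
    refine hP.measure_eq_zero (measurable_faceDegree 0 (measurableSet_singleton 4)) 1 8 ?_
    filter_upwards [heven, henc] with S h1 h2 N
    convert h2.card_four_le h1 N using 4 with u
    simp [faceDegree_translate]
  have h0' : ∀ᵐ S ∂P, faceDegree S 0 ≠ 4 := by
    rw [ae_iff]
    simpa using h0
  rw [ae_all_iff]
  intro u
  filter_upwards [(hP u).quasiMeasurePreserving.ae h0'] with S hS
  rwa [faceDegree_translate, zero_add] at hS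

/-! ### The Burton–Keane counting argument -/

section Branches

variable {V : Type*}

/-- The graph `G` with all edges that touch `R` removed. -/
def avoiding (G : SimpleGraph V) (R : Set V) : SimpleGraph V where
  Adj a b := G.Adj a b ∧ a ∉ R ∧ b ∉ R
  symm := ⟨fun _ _ h => ⟨h.1.symm, h.2.2, h.2.1⟩⟩
  loopless := ⟨fun _ h => h.1.ne rfl⟩

theorem avoiding_mono (G : SimpleGraph V) {R R' : Set V} (h : R ⊆ R') :
    avoiding G R' ≤ avoiding G R := fun _ _ hab =>
  ⟨hab.1, fun ha => hab.2.1 (h ha), fun hb => hab.2.2 (h hb)⟩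

/-- `R` is connected in `G` through edges inside `R`. -/
def IsConnectedIn (G : SimpleGraph V) (R : Set V) : Prop :=
  ∀ a ∈ R, ∀ b ∈ R, (avoiding G Rᶜ).Reachable a b

/-- `x` is a neighbour of `R` outside `R`; its component in `avoiding G R` is a branch at `R`. -/
def IsBranchRoot (G : SimpleGraph V) (R : Set V) (x : V) : Prop :=
  x ∉ R ∧ ∃ r ∈ R, G.Adj r x

variable {G : SimpleGraph V}

theorem IsConnectedIn.reachable {R T : Set V} (hR : IsConnectedIn G R) (hd : Disjoint R T)
    {a b : V} (ha : a ∈ R) (hb : b ∈ R) : (avoiding G T).Reachable a b :=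
  (hR a ha b hb).mono (avoiding_mono G fun _ ht hr => Set.disjoint_left.1 hd hr ht)

theorem not_reachable_of_mem {R : Set V} {x y : V} (hx : x ∉ R) (hy : y ∈ R) :
    ¬ (avoiding G R).Reachable x y := by
  intro h
  rw [SimpleGraph.reachable_iff_reflTransGen] at h
  rcases Relation.ReflTransGen.cases_tail h with h | ⟨z, _, h⟩
  · exact hx (h ▸ hy)
  · exact h.2.2 hy

/-- A component of the graph without `T` that misses `T'` is connected in the graph
without `T'`. -/
theorem reachable_avoiding_of_miss {T T' : Set V} {x z : V}
    (hmiss : ∀ r ∈ T', ¬ (avoiding G T).Reachable x r) (h : (avoiding G T).Reachable x z) :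
    (avoiding G T').Reachable x z := by
  rw [SimpleGraph.reachable_iff_reflTransGen] at h
  induction h with
  | refl => exact SimpleGraph.Reachable.refl _
  | @tail b c h1 h2 ih =>
    have hb : (avoiding G T).Reachable x b := (SimpleGraph.reachable_iff_reflTransGen _ _).2 h1
    refine ih.trans (SimpleGraph.Adj.reachable ⟨h2.1, fun h => hmiss _ h hb, fun h => ?_⟩)
    exact hmiss _ h (hb.trans h2.reachable)

theorem exists_two_not_reachable {H : SimpleGraph V} {x : Fin 3 → V}
    (hx : ∀ k l, k ≠ l → ¬ H.Reachable (x k) (x l)) (a b : V) :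
    ∃ k, ¬ H.Reachable (x k) a ∧ ¬ H.Reachable (x k) b := by
  by_contra! hcon
  have h : ∀ k, H.Reachable (x k) a ∨ H.Reachable (x k) b := fun k =>
    or_iff_not_imp_left.2 (hcon k)
  have key : ∀ k l, k ≠ l → ∀ c, H.Reachable (x k) c → H.Reachable (x l) c → False :=
    fun k l hkl c h1 h2 => hx k l hkl (h1.trans h2.symm)
  rcases h 0 with h0 | h0 <;> rcases h 1 with h1 | h1 <;> rcases h 2 with h2 | h2
  all_goals first
    | exact key 0 1 (by decide) _ h0 h1
    | exact key 0 2 (by decide) _ h0 h2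
    | exact key 1 2 (by decide) _ h1 h2

/-- `R` has three branches, each of which meets the set `Y`. -/
def HasThreeBranches (G : SimpleGraph V) (R Y : Set V) : Prop :=
  ∃ x : Fin 3 → V, (∀ k, IsBranchRoot G R (x k)) ∧
    (∀ k l, k ≠ l → ¬ (avoiding G R).Reachable (x k) (x l)) ∧
    ∀ k, ∃ y ∈ Y, (avoiding G R).Reachable (x k) y

/-- A branch at `T` that misses the connected set `R` disjoint from `T` is, together with `T`,
contained in one component of the graph without `R`. -/
theorem IsBranchRoot.reachable {R T : Set V} {x t z : V} (hT : IsConnectedIn G T)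
    (hd : Disjoint T R) (hx : IsBranchRoot G T x) (ht : t ∈ T)
    (hmiss : ∀ r ∈ R, ¬ (avoiding G T).Reachable x r) (hz : (avoiding G T).Reachable x z) :
    (avoiding G R).Reachable t z := by
  obtain ⟨r, hr, hadj⟩ := hx.2
  refine (hT.reachable hd ht hr).trans (SimpleGraph.Reachable.trans
    (SimpleGraph.Adj.reachable ⟨hadj, fun h => Set.disjoint_left.1 hd hr h, fun h => ?_⟩)
    (reachable_avoiding_of_miss hmiss hz))
  exact hmiss x h (SimpleGraph.Reachable.refl _)

/-- The Burton–Keane lemma: disjoint connected sets with three branches that meet `Y` are at most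
as many as the points of `Y`. Some branch contains none of the other sets; removing its
set together with the points of `Y` on that branch leaves the hypotheses intact. -/
theorem card_le_of_hasThreeBranches {ι : Type*} [DecidableEq ι] {R : ι → Set V}
    (s : Finset ι) (Y : Finset V) (hconn : ∀ i ∈ s, IsConnectedIn G (R i))
    (hdisj : ∀ i ∈ s, ∀ j ∈ s, i ≠ j → Disjoint (R i) (R j))
    (hbr : ∀ i ∈ s, HasThreeBranches G (R i) Y) : s.card ≤ Y.card := by
  classical
  induction hn : s.card generalizing s Y with
  | zero => exact Nat.zero_le _
  | succ n ih =>
    have hne : s.Nonempty := Finset.card_pos.1 (by omega)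
    have hpt : ∀ i, ∃ p, i ∈ s → p ∈ R i := by
      intro i
      by_cases hi : i ∈ s
      · obtain ⟨x, hx, _⟩ := hbr i hi
        obtain ⟨r, hr, _⟩ := (hx 0).2
        exact ⟨r, fun _ => hr⟩
      · obtain ⟨j, hj⟩ := hne
        obtain ⟨x, _⟩ := hbr j hj
        exact ⟨x 0, fun h => absurd h hi⟩
    choose p hp using hpt
    have hmiss : ∀ i ∈ s, ∀ j ∈ s, i ≠ j → ∀ x, ¬ (avoiding G (R i)).Reachable x (p j) →
        ∀ r ∈ R j, ¬ (avoiding G (R i)).Reachable x r := by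
      intro i hi j hj hij x hx r hr h
      exact hx (h.trans ((hconn j hj).reachable (hdisj j hj i hi hij.symm) hr (hp j hj)))
    -- the number of sets of the family on the branch at `R i` with root `x`
    let m : ι × V → ℕ := fun q =>
      (s.filter fun j => (avoiding G (R q.1)).Reachable q.2 (p j)).card
    let Q : Set (ι × V) := {q | q.1 ∈ s ∧ IsBranchRoot G (R q.1) q.2 ∧
      ∃ y ∈ Y, (avoiding G (R q.1)).Reachable q.2 y}
    have hQ : Q.Nonempty := by
      obtain ⟨i, hi⟩ := hne
      obtain ⟨x, hx1, _, hx3⟩ := hbr i hi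
      exact ⟨(i, x 0), hi, hx1 0, by simpa using hx3 0⟩
    obtain ⟨⟨i, x⟩, ⟨hi, hx, y, hyY, hxy⟩, hmin⟩ := (measure m).wf.has_min Q hQ
    simp only at hi hx hxy
    -- by minimality this branch contains no other set of the family
    have hclear : ∀ j ∈ s, ¬ (avoiding G (R i)).Reachable x (p j) := by
      intro j hj hxj
      have hji : j ≠ i := by
        rintro rfl
        exact not_reachable_of_mem hx.1 (hp j hj) hxj
      obtain ⟨x', hx'1, hx'2, hx'3⟩ := hbr j hj
      obtain ⟨k, hk, _⟩ := exists_two_not_reachable hx'2 (p i) (p i)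
      have hsub : ∀ z, (avoiding G (R j)).Reachable (x' k) z → (avoiding G (R i)).Reachable x z :=
        fun z hz => hxj.trans ((hx'1 k).reachable (hconn j hj) (hdisj j hj i hi hji) (hp j hj)
          (hmiss j hj i hi hji _ hk) hz)
      refine hmin (j, x' k) ⟨hj, hx'1 k, by simpa using hx'3 k⟩ ?_
      refine Finset.card_lt_card ⟨fun l hl => ?_, fun hss => ?_⟩
      · rw [Finset.mem_filter] at hl ⊢
        exact ⟨hl.1, hsub _ hl.2⟩
      · have := hss (Finset.mem_filter.2 ⟨hj, hxj⟩)
        exact not_reachable_of_mem (hx'1 k).1 (hp j hj) (Finset.mem_filter.1 this).2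
    set Y' := Y.filter fun y => ¬ (avoiding G (R i)).Reachable x y with hY'
    have hlt : Y'.card < Y.card := Finset.card_lt_card
      ⟨Finset.filter_subset _ _, fun hss => (Finset.mem_filter.1 (hss hyY)).2 hxy⟩
    have hcard : (s.erase i).card = n := by
      rw [Finset.card_erase_of_mem hi]
      omega
    have hrec := ih (s.erase i) Y' (fun j hj => hconn j (Finset.mem_of_mem_erase hj))
      (fun j hj l hl => hdisj j (Finset.mem_of_mem_erase hj) l (Finset.mem_of_mem_erase hl))
      (fun j hj => ?_) hcard
    · omega
    obtain ⟨hji, hj⟩ := Finset.mem_erase.1 hj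
    obtain ⟨x', hx'1, hx'2, hx'3⟩ := hbr j hj
    refine ⟨x', hx'1, hx'2, fun k => ?_⟩
    by_cases hk : (avoiding G (R j)).Reachable (x' k) (p i)
    · -- a branch of `R i` other than the removed one and the one containing `R j`
      obtain ⟨x'', hx''1, hx''2, hx''3⟩ := hbr i hi
      obtain ⟨l, hl1, hl2⟩ := exists_two_not_reachable hx''2 x (p j)
      obtain ⟨z, hzY, hz⟩ := hx''3 l
      refine ⟨z, ?_, hk.trans ((hx''1 l).reachable (hconn i hi) (hdisj i hi j hj hji.symm)
        (hp i hi) (hmiss i hi j hj hji.symm _ hl2) hz)⟩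
      rw [hY', Finset.mem_coe, Finset.mem_filter]
      exact ⟨hzY, fun h => hl1 (hz.trans h.symm)⟩
    · obtain ⟨z, hzY, hz⟩ := hx'3 k
      refine ⟨z, ?_, hz⟩
      rw [hY', Finset.mem_coe, Finset.mem_filter]
      refine ⟨hzY, fun h => hclear j hj (h.trans ?_)⟩
      exact ((hx'1 k).reachable (hconn j hj) (hdisj j hj i hi hji) (hp j hj)
        (hmiss j hj i hi hji _ hk) hz).symm

end Branches

/-! ### Trifurcations of the clusters -/

section Trifurcation

variable {V V' : Type*}

/-- `R` is connected and there are infinite, pairwise different branches at `R` with the roots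
`x 0`, `x 1` and `x 2`. -/
structure IsTrifurcation (G : SimpleGraph V) (R : Set V) (x : Fin 3 → V) : Prop where
  conn : IsConnectedIn G R
  root : ∀ k, IsBranchRoot G R (x k)
  sep : ∀ k l, k ≠ l → ¬ (avoiding G R).Reachable (x k) (x l)
  inf : ∀ k, {y | (avoiding G R).Reachable (x k) y}.Infinite

/-- An isomorphism of graphs restricts to the complements of a set and of its image. -/
def avoidingIso {G : SimpleGraph V} {G' : SimpleGraph V'} (f : G ≃g G') (R : Set V) :
    avoiding G R ≃g avoiding G' (f '' R) where
  toEquiv := f.toEquiv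
  map_rel_iff' := by
    intro a b
    have h : ∀ a, f.toEquiv a ∈ f '' R ↔ a ∈ R := fun a => f.injective.mem_set_image
    simp only [avoiding, h]
    exact and_congr_left' f.map_adj_iff

theorem IsTrifurcation.map {G : SimpleGraph V} {G' : SimpleGraph V'} (f : G ≃g G') {R : Set V}
    {x : Fin 3 → V} (h : IsTrifurcation G R x) : IsTrifurcation G' (f '' R) (f ∘ x) where
  conn := by
    rintro _ ⟨a, ha, rfl⟩ _ ⟨b, hb, rfl⟩
    rw [← Set.image_compl_eq f.bijective]
    exact (avoidingIso f Rᶜ).reachable_iff.2 (h.conn a ha b hb)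
  root k := by
    obtain ⟨h1, r, hr, hadj⟩ := h.root k
    exact ⟨fun hx => h1 (f.injective.mem_set_image.1 hx), f r, ⟨r, hr, rfl⟩, f.map_adj_iff.2 hadj⟩
  sep k l hkl hr := h.sep k l hkl ((avoidingIso f R).reachable_iff.1 hr)
  inf k := by
    refine ((h.inf k).image f.injective.injOn).mono ?_
    rintro _ ⟨y, hy, rfl⟩
    exact (avoidingIso f R).reachable_iff.2 hy

/-- If adjacency in a random graph on a countable set is measurable, so is reachability. -/
theorem measurableSet_reachable [Countable V] {Ω : Type*} [MeasurableSpace Ω]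
    {g : Ω → SimpleGraph V} (hg : ∀ a b, MeasurableSet {ω | (g ω).Adj a b}) (a b : V) :
    MeasurableSet {ω | (g ω).Reachable a b} := by
  classical
  let A : ℕ → V → Set Ω := fun n => Nat.rec (fun b => {_ω | a = b})
    (fun _ B b => ⋃ c, B c ∩ {ω | (g ω).Adj c b}) n
  have hA0 : ∀ b, A 0 b = {_ω | a = b} := fun _ => rfl
  have hA : ∀ n b, A (n + 1) b = ⋃ c, A n c ∩ {ω | (g ω).Adj c b} := fun _ _ => rfl
  have hmeas : ∀ n b, MeasurableSet (A n b) := by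
    intro n
    induction n with
    | zero =>
      intro b
      rw [hA0]
      exact MeasurableSet.const _
    | succ n ih =>
      intro b
      rw [hA]
      exact MeasurableSet.iUnion fun c => (ih c).inter (hg c b)
  have : {ω | (g ω).Reachable a b} = ⋃ n, A n b := by
    ext ω
    simp only [Set.mem_ofPred_eq, Set.mem_iUnion]
    constructor
    · intro h
      rw [SimpleGraph.reachable_iff_reflTransGen] at h
      induction h with
      | refl => exact ⟨0, rfl⟩
      | @tail c d _ h2 ih =>
        obtain ⟨n, hn⟩ := ih
        exact ⟨n + 1, by rw [hA]; exact Set.mem_iUnion.2 ⟨c, hn, h2⟩⟩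
    · rintro ⟨n, hn⟩
      induction n generalizing b with
      | zero => exact (show a = b from hn) ▸ SimpleGraph.Reachable.refl _
      | succ n ih =>
        rw [hA] at hn
        obtain ⟨c, hc, hcb⟩ := Set.mem_iUnion.1 hn
        exact (ih c hc).trans (SimpleGraph.Adj.reachable hcb)
  rw [this]
  exact MeasurableSet.iUnion fun n => hmeas n b

theorem measurableSet_isTrifurcation [Countable V] {Ω : Type*} [MeasurableSpace Ω]
    {g : Ω → SimpleGraph V} (hg : ∀ a b, MeasurableSet {ω | (g ω).Adj a b}) (R : Set V)
    (x : Fin 3 → V) : MeasurableSet {ω | IsTrifurcation (g ω) R x} := by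
  have hav : ∀ (T : Set V) (a b : V), MeasurableSet {ω | (avoiding (g ω) T).Reachable a b} := by
    intro T a b
    refine measurableSet_reachable (fun a b => ?_) a b
    exact (hg a b).inter (MeasurableSet.const _)
  have h : {ω | IsTrifurcation (g ω) R x} =
      {ω | ∀ a, a ∈ R → ∀ b, b ∈ R → (avoiding (g ω) Rᶜ).Reachable a b} ∩
      ({ω | ∀ k, x k ∉ R ∧ ∃ r, r ∈ R ∧ (g ω).Adj r (x k)} ∩
      ({ω | ∀ k l, k ≠ l → ¬ (avoiding (g ω) R).Reachable (x k) (x l)} ∩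
      {ω | ∀ k, ∀ F : Finset V, ∃ y, y ∉ F ∧ (avoiding (g ω) R).Reachable (x k) y})) := by
    ext ω
    constructor
    · exact fun h => ⟨h.conn, h.root, h.sep, fun k F => by
        obtain ⟨y, hy, hyF⟩ := (h.inf k).exists_notMem_finset F
        exact ⟨y, hyF, hy⟩⟩
    · rintro ⟨h1, h2, h3, h4⟩
      refine ⟨h1, h2, h3, fun k hfin => ?_⟩
      obtain ⟨y, hy, hyr⟩ := h4 k hfin.toFinset
      exact hy (by simpa using hyr)
  have hav' : ∀ (T : Set V) (a b : V), Measurable fun ω => (avoiding (g ω) T).Reachable a b :=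
    fun T a b => measurableSet_setOfPred.1 (hav T a b)
  rw [h]
  refine MeasurableSet.inter ?_ (MeasurableSet.inter ?_ (MeasurableSet.inter ?_ ?_))
  · exact measurableSet_setOfPred.2 (Measurable.forall fun a => Measurable.forall fun _ =>
      Measurable.forall fun b => Measurable.forall fun _ => hav' _ a b)
  · exact measurableSet_setOfPred.2 (Measurable.forall fun k => measurable_const.and
      (Measurable.exists fun r => measurable_const.and (measurableSet_setOfPred.1 (hg r (x k)))))
  · exact measurableSet_setOfPred.2 (Measurable.forall fun k => Measurable.forall fun l =>
      Measurable.forall fun _ => (hav' R (x k) (x l)).not)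
  · exact measurableSet_setOfPred.2 (Measurable.forall fun k => Measurable.forall fun F =>
      Measurable.exists fun y => measurable_const.and (hav' R (x k) y))

end Trifurcation

/-- The graph on the vertices of the plane whose edges are those outside `S`; its components are
the clusters separated by the domain walls of `S`. -/
def clusterGraph (S : Set (Edge ℤ)) : SimpleGraph (Vertex ℤ) where
  Adj u v := ∃ e, e ∉ S ∧ ((src e = u ∧ tgt e = v) ∨ (src e = v ∧ tgt e = u))
  symm := ⟨fun _ _ ⟨e, he, h⟩ => ⟨e, he, h.symm⟩⟩
  loopless := ⟨by
    rintro ⟨a, b⟩ ⟨⟨⟨x, y⟩, d⟩, -, h⟩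
    cases d <;> simp [src, tgt] at h <;> omega⟩

theorem clusterGraph_adj_of_notMem {S : Set (Edge ℤ)} {e : Edge ℤ} (he : e ∉ S) :
    (clusterGraph S).Adj (src e) (tgt e) := ⟨e, he, Or.inl ⟨rfl, rfl⟩⟩

theorem measurableSet_clusterGraph_adj (a b : Vertex ℤ) :
    MeasurableSet {S | (clusterGraph S).Adj a b} := by
  exact measurableSet_setOfPred.2 (Measurable.exists fun e =>
    (measurableSet_setOfPred.1 (measurableSet_mem_edges e)).not.and measurable_const)

theorem clusterGraph_adj_mem_boxAt {S : Set (Edge ℤ)} {a b : Vertex ℤ}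
    (h : (clusterGraph S).Adj a b) {L : ℕ} (ha : a ∈ boxAt 0 L) : b ∈ boxAt 0 (L + 1) := by
  obtain ⟨⟨⟨x, y⟩, d⟩, -, ⟨rfl, rfl⟩ | ⟨rfl, rfl⟩⟩ := h <;> cases d <;>
    simp only [src, tgt, mem_boxAt, Prod.fst_zero, Prod.snd_zero] at ha ⊢ <;> push_cast <;> omega

/-- Translation as an isomorphism of cluster graphs. -/
def clusterGraphTranslate (S : Set (Edge ℤ)) (v : ℤ × ℤ) :
    clusterGraph (translate v S) ≃g clusterGraph S where
  toEquiv := Equiv.addRight v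
  map_rel_iff' := by
    have hsrc : ∀ e : Edge ℤ, src (e.1 + v, e.2) = src e + v := fun e => rfl
    have htgt : ∀ e : Edge ℤ, tgt (e.1 + v, e.2) = tgt e + v := by
      rintro ⟨⟨x, y⟩, d⟩
      obtain ⟨a, b⟩ := v
      cases d <;> simp [tgt] <;> ring
    intro a b
    simp only [Equiv.coe_addRight]
    constructor
    · rintro ⟨e, he, h⟩
      have he' : ((e.1 - v) + v, e.2) = e := by simp
      refine ⟨(e.1 - v, e.2), by rwa [mem_translate, he'], ?_⟩
      have h1 := hsrc (e.1 - v, e.2)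
      have h2 := htgt (e.1 - v, e.2)
      simp only at h1 h2
      rw [he'] at h1 h2
      rw [h1, h2] at h
      simpa only [add_left_inj] using h
    · rintro ⟨e, he, h⟩
      refine ⟨(e.1 + v, e.2), he, ?_⟩
      rw [hsrc, htgt]
      simpa only [add_left_inj] using h

/-- An infinite branch at a set inside a box leaves the box through its outer boundary. -/
theorem exists_reachable_boundary {S : Set (Edge ℤ)} {R : Set (Vertex ℤ)} {x : Vertex ℤ} {L : ℕ}
    (hR : R ⊆ boxAt 0 L) (hx : IsBranchRoot (clusterGraph S) R x)
    (hinf : {y | (avoiding (clusterGraph S) R).Reachable x y}.Infinite) :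
    ∃ y ∈ boxAt 0 (L + 1) \ boxAt 0 L, (avoiding (clusterGraph S) R).Reachable x y := by
  by_contra! hcon
  have hmem : ∀ y, (avoiding (clusterGraph S) R).Reachable x y → y ∈ boxAt 0 (L + 1) →
      y ∈ boxAt 0 L := by
    intro y hy hyb
    by_contra h
    exact hcon y (Finset.mem_sdiff.2 ⟨hyb, h⟩) hy
  refine hinf ((boxAt 0 L).finite_toSet.subset fun y hy => ?_)
  rw [Set.mem_ofPred_eq, SimpleGraph.reachable_iff_reflTransGen] at hy
  induction hy with
  | refl =>
    obtain ⟨r, hr, hadj⟩ := hx.2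
    exact hmem x (SimpleGraph.Reachable.refl _) (clusterGraph_adj_mem_boxAt hadj (hR hr))
  | @tail b c h1 h2 ih =>
    have h1' := (SimpleGraph.reachable_iff_reflTransGen _ _).2 h1
    exact hmem c (h1'.trans h2.reachable) (clusterGraph_adj_mem_boxAt h2.1 ih)

/-- A stationary random set of edges almost surely has no trifurcations. -/
theorem IsStationary.not_isTrifurcation {P : Measure (Set (Edge ℤ))} [IsProbabilityMeasure P]
    (hP : IsStationary P) : ∀ᵐ S ∂P, ∀ (R : Finset (Vertex ℤ)) (x : Fin 3 → Vertex ℤ),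
      ¬ IsTrifurcation (clusterGraph S) (R : Set (Vertex ℤ)) x := by
  classical
  rw [ae_all_iff]
  intro R
  rw [ae_all_iff]
  intro x
  obtain ⟨m, hm⟩ := exists_subset_boxAt R
  have h0 : P {S | IsTrifurcation (clusterGraph S) (R : Set (Vertex ℤ)) x} = 0 := by
    -- the spacing `2 * m + 1` makes the translates of `R` disjoint
    refine hP.measure_eq_zero (measurableSet_isTrifurcation measurableSet_clusterGraph_adj _ _)
      (2 * m + 1 : ℕ) (8 * (3 * m + 2)) (Eventually.of_forall fun S N => ?_)
    set L : ℕ := (2 * m + 1) * N + m with hL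
    let T : ℤ × ℤ → Set (Vertex ℤ) := fun u =>
      clusterGraphTranslate S (((2 * m + 1 : ℕ) : ℤ) • u) '' (R : Set (Vertex ℤ))
    have hT : ∀ u w, w ∈ T u → (((2 * m + 1 : ℕ) : ℤ) * u.1 - m ≤ w.1 ∧
        w.1 ≤ ((2 * m + 1 : ℕ) : ℤ) * u.1 + m) ∧ (((2 * m + 1 : ℕ) : ℤ) * u.2 - m ≤ w.2 ∧
        w.2 ≤ ((2 * m + 1 : ℕ) : ℤ) * u.2 + m) := by
      rintro u w ⟨v, hv, rfl⟩
      have hv' := hm hv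
      simp only [mem_boxAt, Prod.fst_zero, Prod.snd_zero] at hv'
      have h1 : (clusterGraphTranslate S (((2 * m + 1 : ℕ) : ℤ) • u) v) =
        v + ((2 * m + 1 : ℕ) : ℤ) • u := rfl
      rw [h1]
      simp only [Prod.fst_add, Prod.snd_add, Prod.smul_fst, Prod.smul_snd, smul_eq_mul]
      omega
    have hbox : ∀ u ∈ boxAt 0 N, T u ⊆ boxAt 0 L := by
      intro u hu w hw
      have h1 := hT u w hw
      simp only [mem_boxAt, Prod.fst_zero, Prod.snd_zero, Finset.mem_coe] at hu ⊢
      have hk : (0 : ℤ) ≤ ((2 * m + 1 : ℕ) : ℤ) := by positivity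
      have h2 := mul_le_mul_of_nonneg_left hu.1.1 hk
      have h3 := mul_le_mul_of_nonneg_left hu.1.2 hk
      have h4 := mul_le_mul_of_nonneg_left hu.2.1 hk
      have h5 := mul_le_mul_of_nonneg_left hu.2.2 hk
      have h6 : (L : ℤ) = ((2 * m + 1 : ℕ) : ℤ) * N + m := by
        rw [hL]
        push_cast
        ring
      rw [h6]
      refine ⟨⟨?_, ?_⟩, ?_, ?_⟩ <;> linarith [h1.1.1, h1.1.2, h1.2.1, h1.2.2]
    have hdisj : ∀ u u', u ≠ u' → Disjoint (T u) (T u') := by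
      intro u u' huu
      rw [Set.disjoint_left]
      intro w hw hw'
      have h1 := hT u w hw
      have h2 := hT u' w hw'
      have key : ∀ a b c : ℤ, ((2 * m + 1 : ℕ) : ℤ) * a - m ≤ c →
          c ≤ ((2 * m + 1 : ℕ) : ℤ) * b + m → a ≤ b := by
        intro a b c h3 h4
        by_contra hab
        have : b + 1 ≤ a := by omega
        have h5 := mul_le_mul_of_nonneg_left this
          (by positivity : (0 : ℤ) ≤ ((2 * m + 1 : ℕ) : ℤ))
        push_cast at h3 h4 h5
        linarith
      exact huu (Prod.ext
        (le_antisymm (key _ _ _ h1.1.1 h2.1.2) (key _ _ _ h2.1.1 h1.1.2))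
        (le_antisymm (key _ _ _ h1.2.1 h2.2.2) (key _ _ _ h2.2.1 h1.2.2)))
    have htri : ∀ u ∈ (boxAt 0 N).filter fun u =>
        translate (((2 * m + 1 : ℕ) : ℤ) • u) S ∈
          {S | IsTrifurcation (clusterGraph S) (R : Set (Vertex ℤ)) x},
        IsTrifurcation (clusterGraph S) (T u)
          (clusterGraphTranslate S (((2 * m + 1 : ℕ) : ℤ) • u) ∘ x) := fun u hu =>
      IsTrifurcation.map _ (Finset.mem_filter.1 hu).2
    refine (card_le_of_hasThreeBranches (G := clusterGraph S) (R := T) _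
      (boxAt 0 (L + 1) \ boxAt 0 L) (fun u hu => (htri u hu).conn)
      (fun u _ u' _ huu => hdisj u u' huu) (fun u hu => ?_)).trans ?_
    · have h := htri u hu
      refine ⟨_, h.root, h.sep, fun k => ?_⟩
      exact exists_reachable_boundary (hbox u (Finset.mem_filter.1 hu).1) (h.root k) (h.inf k)
    · have hbox : boxAt 0 L ⊆ boxAt 0 (L + 1) := by
        intro u hu
        simp only [mem_boxAt, Prod.fst_zero, Prod.snd_zero] at hu ⊢
        push_cast
        omega
      rw [Finset.card_sdiff_of_subset hbox, card_boxAt, card_boxAt]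
      have h2 : (2 * (L + 1) + 1) ^ 2 = (2 * L + 1) ^ 2 + 8 * (L + 1) := by ring
      have h3 : L + 1 ≤ (3 * m + 2) * (N + 1) := by
        have : 0 ≤ m * N := Nat.zero_le _
        rw [hL]
        nlinarith
      rw [h2, Nat.add_sub_cancel_left, mul_assoc]
      omega
  exact measure_eq_zero_iff_ae_notMem.1 h0

/-! ### Connected sets of vertices and trifurcations -/

section Connected

variable {V : Type*} {G : SimpleGraph V}

theorem isConnectedIn_singleton (v : V) : IsConnectedIn G {v} := by
  rintro a rfl b rfl
  exact SimpleGraph.Reachable.refl _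

theorem IsConnectedIn.insert_of_adj {R : Set V} (hR : IsConnectedIn G R) {b c : V} (hb : b ∈ R)
    (hadj : G.Adj b c) : IsConnectedIn G (insert c R) := by
  have key : ∀ a ∈ insert c R, (avoiding G (insert c R)ᶜ).Reachable a b := by
    rintro a (rfl | ha)
    · exact SimpleGraph.Adj.reachable ⟨hadj.symm, fun h => h (Set.mem_insert _ _),
        fun h => h (Set.mem_insert_of_mem _ hb)⟩
    · exact (hR a ha b hb).mono
        (avoiding_mono G (Set.compl_subset_compl.2 (Set.subset_insert _ _)))
  exact fun a ha a' ha' => (key a ha).trans (key a' ha').symm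

theorem IsConnectedIn.exists_finset_superset [DecidableEq V] {v : V} (F : Finset V)
    (hF : ∀ w ∈ F, G.Reachable v w) :
    ∃ R : Finset V, v ∈ R ∧ F ⊆ R ∧ IsConnectedIn G (R : Set V) := by
  induction F using Finset.induction_on with
  | empty => exact ⟨{v}, by simp, by simp, by simpa using isConnectedIn_singleton v⟩
  | insert w F hwF ih =>
    obtain ⟨R, hv, hFR, hR⟩ := ih fun w hw => hF w (Finset.mem_insert_of_mem hw)
    have hw := hF w (Finset.mem_insert_self _ _)
    have key : ∃ R' : Finset V, R ⊆ R' ∧ w ∈ R' ∧ IsConnectedIn G (R' : Set V) := by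
      clear hF ih hwF
      rw [SimpleGraph.reachable_iff_reflTransGen] at hw
      induction hw with
      | refl => exact ⟨R, subset_rfl, hv, hR⟩
      | @tail b c _ h2 ih =>
        obtain ⟨R', h3, h4, h5⟩ := ih
        refine ⟨insert c R', h3.trans (Finset.subset_insert _ _), Finset.mem_insert_self _ _, ?_⟩
        rw [Finset.coe_insert]
        exact h5.insert_of_adj h4 h2
    obtain ⟨R', h1, h2, h3⟩ := key
    exact ⟨R', h1 hv, Finset.insert_subset h2 (hFR.trans h1), h3⟩

theorem exists_isBranchRoot {R : Set V} {v w : V} (h : G.Reachable w v) (hv : v ∈ R) (hw : w ∉ R) :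
    ∃ x, IsBranchRoot G R x ∧ (avoiding G R).Reachable w x := by
  rw [SimpleGraph.reachable_iff_reflTransGen] at h
  induction h using Relation.ReflTransGen.head_induction_on with
  | refl => exact absurd hv hw
  | @head a c h1 _ ih =>
    by_cases hc : c ∈ R
    · exact ⟨a, ⟨hw, c, hc, h1.symm⟩, SimpleGraph.Reachable.refl _⟩
    · obtain ⟨x, hx, hr⟩ := ih hc
      exact ⟨x, hx, SimpleGraph.Reachable.trans (SimpleGraph.Adj.reachable ⟨h1, hw, hc⟩) hr⟩

end Connected

/-- A cluster that falls apart into three infinite pieces when a finite set `Λ` is removed has a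
trifurcation. -/
theorem exists_isTrifurcation {S : Set (Edge ℤ)} (v : Vertex ℤ) (Λ : Finset (Vertex ℤ))
    (W : Fin 3 → Set (Vertex ℤ))
    (hW : ∀ k, ∀ w ∈ W k, (clusterGraph S).Reachable v w)
    (hclosed : ∀ k, ∀ w ∈ W k, ∀ w', (clusterGraph S).Adj w w' → w' ∉ Λ → w' ∈ W k)
    (hdisj : ∀ k l, k ≠ l → Disjoint (W k) (W l)) (hinf : ∀ k, (W k).Infinite) :
    ∃ (R : Finset (Vertex ℤ)) (x : Fin 3 → Vertex ℤ),
      IsTrifurcation (clusterGraph S) (R : Set (Vertex ℤ)) x := by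
  classical
  obtain ⟨R, hvR, hΛR, hR⟩ := IsConnectedIn.exists_finset_superset (G := clusterGraph S) (v := v)
    (Λ.filter fun w => (clusterGraph S).Reachable v w) fun w hw => (Finset.mem_filter.1 hw).2
  have hstay : ∀ k, ∀ w ∈ W k, ∀ w',
      (avoiding (clusterGraph S) (R : Set (Vertex ℤ))).Reachable w w' → w' ∈ W k := by
    intro k w hw w' h
    rw [SimpleGraph.reachable_iff_reflTransGen] at h
    induction h with
    | refl => exact hw
    | @tail b c _ h2 ih =>
      refine hclosed k b ih c h2.1 fun hc => h2.2.2 (hΛR (Finset.mem_filter.2 ⟨hc, ?_⟩))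
      exact (hW k b ih).trans h2.1.reachable
  obtain ⟨L, hL⟩ := exists_subset_boxAt R
  have hroot : ∀ k, ∃ x ∈ W k, IsBranchRoot (clusterGraph S) (R : Set (Vertex ℤ)) x ∧
      {y | (avoiding (clusterGraph S) (R : Set (Vertex ℤ))).Reachable x y}.Infinite := by
    intro k
    by_contra! hcon
    have hfin : {x | x ∈ W k ∧ IsBranchRoot (clusterGraph S) (R : Set (Vertex ℤ)) x}.Finite := by
      refine (boxAt 0 (L + 1)).finite_toSet.subset ?_
      rintro x ⟨_, _, r, hr, hadj⟩
      exact clusterGraph_adj_mem_boxAt hadj (hL hr)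
    refine ((hinf k).sdiff R.finite_toSet) ((hfin.biUnion fun x hx =>
      hcon x hx.1 hx.2).subset fun w hw => ?_)
    obtain ⟨x, hx, hr⟩ := exists_isBranchRoot (hW k w hw.1).symm hvR hw.2
    exact Set.mem_biUnion (show x ∈ {x | x ∈ W k ∧ _} from ⟨hstay k w hw.1 x hr, hx⟩) hr.symm
  choose x hxW hxroot hxinf using hroot
  exact ⟨R, x, hR, hxroot, fun k l hkl h =>
    Set.disjoint_left.1 (hdisj k l hkl) (hstay k _ (hxW k) _ h) (hxW l), hxinf⟩

/-- If `S` encloses nothing, all clusters are infinite. -/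
theorem EnclosesNothing.infinite_cluster {S : Set (Edge ℤ)} (hS : EnclosesNothing S)
    (v : Vertex ℤ) : {w | (clusterGraph S).Reachable v w}.Infinite := by
  intro hfin
  refine hS hfin.toFinset ⟨v, by simp⟩ fun e he => ?_
  simp only [edgeBoundary, Set.Finite.coe_toFinset, Set.mem_ofPred_eq] at he
  by_contra heS
  have hadj := clusterGraph_adj_of_notMem heS
  rcases he with ⟨h1, h2⟩ | ⟨h1, h2⟩
  · exact h2 (h1.trans hadj.reachable)
  · exact h2 (h1.trans hadj.symm.reachable)

/-! ### The complement of the interface in the plane -/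

/-- The closed unit square centred at the vertex `v`. -/
def cell (v : Vertex ℤ) : Set (ℝ × ℝ) :=
  Set.Icc ((v.1 : ℝ) - 1 / 2) (v.1 + 1 / 2) ×ˢ Set.Icc ((v.2 : ℝ) - 1 / 2) (v.2 + 1 / 2)

theorem mem_cell {v : Vertex ℤ} {p : ℝ × ℝ} :
    p ∈ cell v ↔ ((v.1 : ℝ) - 1 / 2 ≤ p.1 ∧ p.1 ≤ v.1 + 1 / 2) ∧
      ((v.2 : ℝ) - 1 / 2 ≤ p.2 ∧ p.2 ≤ v.2 + 1 / 2) := Iff.rfl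

theorem isClosed_cell (v : Vertex ℤ) : IsClosed (cell v) := isClosed_Icc.prod isClosed_Icc

theorem isBounded_cell (v : Vertex ℤ) : Bornology.IsBounded (cell v) :=
  (Metric.isBounded_Icc _ _).prod (Metric.isBounded_Icc _ _)

theorem exists_mem_cell (p : ℝ × ℝ) : ∃ v, p ∈ cell v := by
  refine ⟨(round p.1, round p.2), ?_⟩
  have h1 := abs_le.1 (abs_sub_round p.1)
  have h2 := abs_le.1 (abs_sub_round p.2)
  rw [mem_cell]
  refine ⟨⟨?_, ?_⟩, ?_, ?_⟩ <;> linarith [h1.1, h1.2, h2.1, h2.2]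

theorem locallyFinite_cell : LocallyFinite cell := by
  intro p
  refine ⟨Metric.ball p 1, Metric.ball_mem_nhds p one_pos, ?_⟩
  refine ((Set.finite_Icc ⌊p.1 - 2⌋ ⌈p.1 + 2⌉).prod
    (Set.finite_Icc ⌊p.2 - 2⌋ ⌈p.2 + 2⌉)).subset ?_
  rintro v ⟨q, hq, hqp⟩
  rw [Metric.mem_ball, Prod.dist_eq, max_lt_iff, Real.dist_eq, Real.dist_eq, abs_lt, abs_lt] at hqp
  rw [mem_cell] at hq
  have h1 := Int.floor_le (p.1 - 2)
  have h2 := Int.le_ceil (p.1 + 2)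
  have h3 := Int.floor_le (p.2 - 2)
  have h4 := Int.le_ceil (p.2 + 2)
  refine ⟨⟨?_, ?_⟩, ?_, ?_⟩
  · have : ((⌊p.1 - 2⌋ : ℤ) : ℝ) ≤ v.1 := by linarith [hq.1.2, hqp.1.1]
    exact_mod_cast this
  · have : (v.1 : ℝ) ≤ (⌈p.1 + 2⌉ : ℤ) := by linarith [hq.1.1, hqp.1.2]
    exact_mod_cast this
  · have : ((⌊p.2 - 2⌋ : ℤ) : ℝ) ≤ v.2 := by linarith [hq.2.2, hqp.2.1]
    exact_mod_cast this
  · have : (v.2 : ℝ) ≤ (⌈p.2 + 2⌉ : ℤ) := by linarith [hq.2.1, hqp.2.2]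
    exact_mod_cast this

theorem isClosed_biUnion_cell (A : Set (Vertex ℤ)) : IsClosed (⋃ v ∈ A, cell v) := by
  rw [Set.biUnion_eq_iUnion]
  exact (locallyFinite_cell.comp_injective Subtype.val_injective).isClosed_iUnion
    fun v => isClosed_cell _

/-- The closed dual edge crossing `e` is the common side of the squares at the endpoints
of `e`. -/
theorem segment_dualEdge (e : Edge ℤ) :
    segment ℝ (dualPoint (dualEdge e).1) (dualPoint (dualEdge e).2) =
      cell (src e) ∩ cell (tgt e) := by
  obtain ⟨⟨x, y⟩, d⟩ := e
  cases d
  · have h : segment ℝ (dualPoint (dualEdge ((x, y), Dir.right)).1)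
        (dualPoint (dualEdge ((x, y), Dir.right)).2) =
        (fun t => ((x : ℝ) + 1 / 2, t)) '' Set.Icc ((y : ℝ) - 1 / 2) (y + 1 / 2) := by
      rw [← segment_eq_Icc (by linarith), Prod.image_mk_segment_right]
      simp only [dualPoint, dualEdge]
      push_cast
      congr 2
      ring
    rw [h]
    ext ⟨a, b⟩
    simp only [src, tgt, Set.mem_image, Set.mem_Icc, Prod.mk.injEq, Set.mem_inter_iff, mem_cell]
    push_cast
    constructor
    · rintro ⟨ht, h'⟩
      refine ⟨⟨⟨?_, ?_⟩, ?_, ?_⟩, ⟨?_, ?_⟩, ?_, ?_⟩ <;> linarith [ht.1, ht.2, h'.1, h'.2]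
    · rintro ⟨⟨h1, h2⟩, h3, h4⟩
      exact ⟨h2, by linarith [h1.2, h3.1], rfl⟩
  · have h : segment ℝ (dualPoint (dualEdge ((x, y), Dir.up)).1)
        (dualPoint (dualEdge ((x, y), Dir.up)).2) =
        (fun t => (t, (y : ℝ) + 1 / 2)) '' Set.Icc ((x : ℝ) - 1 / 2) (x + 1 / 2) := by
      rw [← segment_eq_Icc (by linarith), Prod.image_mk_segment_left]
      simp only [dualPoint, dualEdge]
      push_cast
      congr 2
      ring
    rw [h]
    ext ⟨a, b⟩
    simp only [src, tgt, Set.mem_image, Set.mem_Icc, Prod.mk.injEq, Set.mem_inter_iff, mem_cell]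
    push_cast
    constructor
    · rintro ⟨ht, h'⟩
      refine ⟨⟨⟨?_, ?_⟩, ?_, ?_⟩, ⟨?_, ?_⟩, ?_, ?_⟩ <;> linarith [ht.1, ht.2, h'.1, h'.2]
    · rintro ⟨⟨h1, h2⟩, h3, h4⟩
      exact ⟨h1, rfl, by linarith [h2.2, h4.1]⟩

theorem mem_dualRealization {S : Set (Edge ℤ)} {p : ℝ × ℝ} :
    p ∈ dualRealization S ↔ ∃ e ∈ S, p ∈ cell (src e) ∧ p ∈ cell (tgt e) := by
  simp only [dualRealization, Set.mem_iUnion, segment_dualEdge, Set.mem_inter_iff, exists_prop]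

/-- The open unit square centred at the vertex `v`. -/
def openCell (v : Vertex ℤ) : Set (ℝ × ℝ) :=
  Set.Ioo ((v.1 : ℝ) - 1 / 2) (v.1 + 1 / 2) ×ˢ Set.Ioo ((v.2 : ℝ) - 1 / 2) (v.2 + 1 / 2)

theorem openCell_subset_cell (v : Vertex ℤ) : openCell v ⊆ cell v :=
  Set.prod_mono Set.Ioo_subset_Icc_self Set.Ioo_subset_Icc_self

theorem center_mem_openCell (v : Vertex ℤ) : ((v.1 : ℝ), (v.2 : ℝ)) ∈ openCell v := by
  refine ⟨⟨?_, ?_⟩, ?_, ?_⟩ <;> simp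

theorem eq_of_mem_openCell {v w : Vertex ℤ} {p : ℝ × ℝ} (hv : p ∈ openCell v) (hw : p ∈ cell w) :
    w = v := by
  obtain ⟨⟨h1, h2⟩, h3, h4⟩ := hv
  obtain ⟨⟨h5, h6⟩, h7, h8⟩ := hw
  have a1 : (v.1 : ℝ) < w.1 + 1 := by linarith
  have a2 : (w.1 : ℝ) < v.1 + 1 := by linarith
  have a3 : (v.2 : ℝ) < w.2 + 1 := by linarith
  have a4 : (w.2 : ℝ) < v.2 + 1 := by linarith
  norm_cast at a1 a2 a3 a4
  exact Prod.ext (by omega) (by omega)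

theorem src_ne_tgt (e : Edge ℤ) : src e ≠ tgt e := by
  obtain ⟨⟨x, y⟩, d⟩ := e
  cases d <;> simp [src, tgt]

theorem openCell_subset_compl (S : Set (Edge ℤ)) (v : Vertex ℤ) :
    openCell v ⊆ (dualRealization S)ᶜ := by
  intro p hp hS
  obtain ⟨e, _, h1, h2⟩ := mem_dualRealization.1 hS
  exact src_ne_tgt e ((eq_of_mem_openCell hp h1).trans (eq_of_mem_openCell hp h2).symm)

theorem isPreconnected_cell_inter (S : Set (Edge ℤ)) (v : Vertex ℤ) :
    IsPreconnected (cell v ∩ (dualRealization S)ᶜ) := by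
  have hconv : Convex ℝ (openCell v) := (convex_Ioo _ _).prod (convex_Ioo _ _)
  refine hconv.isPreconnected.subset_closure
    (Set.subset_inter (openCell_subset_cell v) (openCell_subset_compl S v)) ?_
  rw [openCell, closure_prod_eq, closure_Ioo (by linarith), closure_Ioo (by linarith)]
  exact Set.inter_subset_left

/-- Adjacent squares of a cluster have a common point outside the interface. -/
theorem exists_mem_cell_inter_cell {S : Set (Edge ℤ)} {v w : Vertex ℤ}
    (h : (clusterGraph S).Adj v w) : ∃ p ∈ (dualRealization S)ᶜ, p ∈ cell v ∧ p ∈ cell w := by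
  have key : ∀ e : Edge ℤ, ∃ p, p ∈ cell (src e) ∧ p ∈ cell (tgt e) ∧
      ∀ e', p ∈ cell (src e') → p ∈ cell (tgt e') → e' = e := by
    rintro ⟨⟨x, y⟩, d⟩
    cases d
    · refine ⟨((x : ℝ) + 1 / 2, (y : ℝ)), ?_, ?_, ?_⟩
      · simp only [mem_cell, src]
        refine ⟨⟨?_, ?_⟩, ?_, ?_⟩ <;> linarith
      · simp only [mem_cell, tgt]
        push_cast
        refine ⟨⟨?_, ?_⟩, ?_, ?_⟩ <;> linarith
      · rintro ⟨⟨x', y'⟩, d'⟩ ⟨⟨h1, h2⟩, h3, h4⟩ ⟨⟨h5, h6⟩, h7, h8⟩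
        cases d' <;> simp only [src, tgt] at h1 h2 h3 h4 h5 h6 h7 h8 <;>
          push_cast at h1 h2 h3 h4 h5 h6 h7 h8
        · have a1 : (x' : ℝ) ≤ x := by linarith
          have a2 : (x : ℝ) ≤ x' := by linarith
          have a3 : (y' : ℝ) < y + 1 := by linarith
          have a4 : (y : ℝ) < y' + 1 := by linarith
          norm_cast at a1 a2 a3 a4
          obtain rfl : x' = x := by omega
          obtain rfl : y' = y := by omega
          rfl
        · have a1 : (y' : ℝ) < y := by linarith
          have a2 : (y : ℝ) < y' + 1 := by linarith
          norm_cast at a1 a2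
          omega
    · refine ⟨((x : ℝ), (y : ℝ) + 1 / 2), ?_, ?_, ?_⟩
      · simp only [mem_cell, src]
        refine ⟨⟨?_, ?_⟩, ?_, ?_⟩ <;> linarith
      · simp only [mem_cell, tgt]
        push_cast
        refine ⟨⟨?_, ?_⟩, ?_, ?_⟩ <;> linarith
      · rintro ⟨⟨x', y'⟩, d'⟩ ⟨⟨h1, h2⟩, h3, h4⟩ ⟨⟨h5, h6⟩, h7, h8⟩
        cases d' <;> simp only [src, tgt] at h1 h2 h3 h4 h5 h6 h7 h8 <;>
          push_cast at h1 h2 h3 h4 h5 h6 h7 h8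
        · have a1 : (x' : ℝ) < x := by linarith
          have a2 : (x : ℝ) < x' + 1 := by linarith
          norm_cast at a1 a2
          omega
        · have a1 : (y' : ℝ) ≤ y := by linarith
          have a2 : (y : ℝ) ≤ y' := by linarith
          have a3 : (x' : ℝ) < x + 1 := by linarith
          have a4 : (x : ℝ) < x' + 1 := by linarith
          norm_cast at a1 a2 a3 a4
          obtain rfl : x' = x := by omega
          obtain rfl : y' = y := by omega
          rfl
  obtain ⟨e, he, h⟩ := h
  obtain ⟨p, h1, h2, h3⟩ := key e
  refine ⟨p, fun hp => ?_, ?_⟩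
  · obtain ⟨e', he', h4, h5⟩ := mem_dualRealization.1 hp
    exact he (h3 e' h4 h5 ▸ he')
  · rcases h with ⟨rfl, rfl⟩ | ⟨rfl, rfl⟩
    · exact ⟨h1, h2⟩
    · exact ⟨h2, h1⟩

/-- The squares containing a given point outside the interface belong to the same cluster. -/
theorem reachable_of_mem_cell {S : Set (Edge ℤ)} {v w : Vertex ℤ} {p : ℝ × ℝ}
    (hp : p ∈ (dualRealization S)ᶜ) (hv : p ∈ cell v) (hw : p ∈ cell w) :
    (clusterGraph S).Reachable v w := by
  have hedge : ∀ e : Edge ℤ, p ∈ cell (src e) → p ∈ cell (tgt e) →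
      (clusterGraph S).Reachable (src e) (tgt e) := by
    intro e h1 h2
    exact (clusterGraph_adj_of_notMem fun he =>
      hp (mem_dualRealization.2 ⟨e, he, h1, h2⟩)).reachable
  have hx : ∀ x x' y : ℤ, p ∈ cell (x, y) → p ∈ cell (x', y) →
      (clusterGraph S).Reachable (x, y) (x', y) := by
    intro x x' y h h'
    have a1 : (x : ℝ) ≤ x' + 1 := by linarith [h.1.1, h'.1.2]
    have a2 : (x' : ℝ) ≤ x + 1 := by linarith [h.1.2, h'.1.1]
    norm_cast at a1 a2
    obtain rfl | rfl | rfl : x' = x ∨ x' = x + 1 ∨ x = x' + 1 := by omega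
    · exact SimpleGraph.Reachable.refl _
    · exact hedge ((x, y), Dir.right) h h'
    · exact (hedge ((x', y), Dir.right) h' h).symm
  have hy : ∀ x y y' : ℤ, p ∈ cell (x, y) → p ∈ cell (x, y') →
      (clusterGraph S).Reachable (x, y) (x, y') := by
    intro x y y' h h'
    have a1 : (y : ℝ) ≤ y' + 1 := by linarith [h.2.1, h'.2.2]
    have a2 : (y' : ℝ) ≤ y + 1 := by linarith [h.2.2, h'.2.1]
    norm_cast at a1 a2
    obtain rfl | rfl | rfl : y' = y ∨ y' = y + 1 ∨ y = y' + 1 := by omega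
    · exact SimpleGraph.Reachable.refl _
    · exact hedge ((x, y), Dir.up) h h'
    · exact (hedge ((x, y'), Dir.up) h' h).symm
  obtain ⟨x, y⟩ := v
  obtain ⟨x', y'⟩ := w
  have hmid : p ∈ cell (x', y) := ⟨hw.1, hv.2⟩
  exact (hx x x' y hv hmid).trans (hy x' y y' hmid hw)

/-- A connected subset of the complement of the interface meets the squares of one cluster
only. -/
theorem reachable_of_isPreconnected {S : Set (Edge ℤ)} {C : Set (ℝ × ℝ)} (hC : IsPreconnected C)
    (hCS : C ⊆ (dualRealization S)ᶜ) {v w : Vertex ℤ} {p q : ℝ × ℝ} (hp : p ∈ C)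
    (hpv : p ∈ cell v) (hq : q ∈ C) (hqw : q ∈ cell w) : (clusterGraph S).Reachable v w := by
  set A : Set (Vertex ℤ) := {u | (clusterGraph S).Reachable v u} with hA
  have hcover : C ⊆ (⋃ u ∈ A, cell u) ∪ ⋃ u ∈ Aᶜ, cell u := by
    intro z _
    obtain ⟨u, hu⟩ := exists_mem_cell z
    by_cases huA : u ∈ A
    · exact Or.inl (Set.mem_biUnion huA hu)
    · exact Or.inr (Set.mem_biUnion (show u ∈ Aᶜ from huA) hu)
  have hdisj : C ∩ ((⋃ u ∈ A, cell u) ∩ ⋃ u ∈ Aᶜ, cell u) = ∅ := by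
    refine Set.eq_empty_of_forall_notMem ?_
    rintro z ⟨hz, h1, h2⟩
    obtain ⟨u, hu, hzu⟩ := Set.mem_iUnion₂.1 h1
    obtain ⟨u', hu', hzu'⟩ := Set.mem_iUnion₂.1 h2
    exact hu' (SimpleGraph.Reachable.trans hu (reachable_of_mem_cell (hCS hz) hzu hzu'))
  rcases isPreconnected_iff_subset_of_disjoint_closed.1 hC _ _ (isClosed_biUnion_cell A)
    (isClosed_biUnion_cell Aᶜ) hcover hdisj with h | h
  · obtain ⟨u, hu, hqu⟩ := Set.mem_iUnion₂.1 (h hq)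
    exact SimpleGraph.Reachable.trans hu (reachable_of_mem_cell (hCS hq) hqu hqw)
  · obtain ⟨u, hu, hpu⟩ := Set.mem_iUnion₂.1 (h hp)
    exact absurd (reachable_of_mem_cell (hCS hp) hpv hpu) hu

/-- A connected set that meets a component of `X` and lies in `X` lies in that component. -/
theorem IsComponentOf.subset_of_isPreconnected {K X Z : Set (ℝ × ℝ)} (hK : IsComponentOf K X)
    (hZ : IsPreconnected Z) (hZX : Z ⊆ X) {q : ℝ × ℝ} (hqZ : q ∈ Z) (hqK : q ∈ K) : Z ⊆ K := by
  obtain ⟨p, hp, rfl⟩ := hK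
  rw [connectedComponentIn_eq hqK]
  exact hZ.subset_connectedComponentIn hqZ hZX

theorem IsComponentOf.subset {K X : Set (ℝ × ℝ)} (hK : IsComponentOf K X) : K ⊆ X := by
  obtain ⟨p, hp, rfl⟩ := hK
  exact connectedComponentIn_subset X p

theorem IsComponentOf.isPreconnected {K X : Set (ℝ × ℝ)} (hK : IsComponentOf K X) :
    IsPreconnected K := by
  obtain ⟨p, hp, rfl⟩ := hK
  exact isPreconnected_connectedComponentIn

theorem IsComponentOf.eq_of_mem {K K' X : Set (ℝ × ℝ)} (hK : IsComponentOf K X)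
    (hK' : IsComponentOf K' X) {q : ℝ × ℝ} (h : q ∈ K) (h' : q ∈ K') : K = K' :=
  Set.Subset.antisymm (hK'.subset_of_isPreconnected hK.isPreconnected hK.subset h h')
    (hK.subset_of_isPreconnected hK'.isPreconnected hK'.subset h' h)

/-- The component of the complement of the interface around a square contains the squares of the
whole cluster. -/
theorem IsComponentOf.cell_subset {S : Set (Edge ℤ)} {C : Set (ℝ × ℝ)}
    (hC : IsComponentOf C (dualRealization S)ᶜ) {p : ℝ × ℝ} (hp : p ∈ C) {v w : Vertex ℤ}
    (hpv : p ∈ cell v) (h : (clusterGraph S).Reachable v w) :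
    cell w ∩ (dualRealization S)ᶜ ⊆ C := by
  rw [SimpleGraph.reachable_iff_reflTransGen] at h
  induction h with
  | refl =>
    exact hC.subset_of_isPreconnected (isPreconnected_cell_inter S v) Set.inter_subset_right
      ⟨hpv, hC.subset hp⟩ hp
  | @tail b c _ hbc ih =>
    obtain ⟨q, hq, hqb, hqc⟩ := exists_mem_cell_inter_cell hbc
    exact hC.subset_of_isPreconnected (isPreconnected_cell_inter S c) Set.inter_subset_right
      ⟨hqc, hq⟩ (ih ⟨hqb, hq⟩)

theorem finite_setOf_cell_inter_nonempty {B : Set (ℝ × ℝ)} (hB : Bornology.IsBounded B) :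
    {v : Vertex ℤ | (cell v ∩ B).Nonempty}.Finite := by
  obtain ⟨r, hr⟩ := hB.subset_closedBall 0
  refine ((Set.finite_Icc ⌊-r - 1⌋ ⌈r + 1⌉).prod (Set.finite_Icc ⌊-r - 1⌋ ⌈r + 1⌉)).subset ?_
  rintro v ⟨q, hq, hqB⟩
  have hq' := hr hqB
  rw [Metric.mem_closedBall, Prod.dist_eq, max_le_iff, Real.dist_eq, Real.dist_eq, abs_le,
    abs_le] at hq'
  simp only [Prod.fst_zero, Prod.snd_zero, sub_zero] at hq'
  rw [mem_cell] at hq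
  have h1 := Int.floor_le (-r - 1)
  have h2 := Int.le_ceil (r + 1)
  refine ⟨⟨?_, ?_⟩, ?_, ?_⟩
  · have : ((⌊-r - 1⌋ : ℤ) : ℝ) ≤ v.1 := by linarith [hq.1.2, hq'.1.1]
    exact_mod_cast this
  · have : (v.1 : ℝ) ≤ (⌈r + 1⌉ : ℤ) := by linarith [hq.1.1, hq'.1.2]
    exact_mod_cast this
  · have : ((⌊-r - 1⌋ : ℤ) : ℝ) ≤ v.2 := by linarith [hq.2.2, hq'.2.1]
    exact_mod_cast this
  · have : (v.2 : ℝ) ≤ (⌈r + 1⌉ : ℤ) := by linarith [hq.2.1, hq'.2.2]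
    exact_mod_cast this

/-- If `S` encloses nothing, the components of its complement in the plane are unbounded. -/
theorem EnclosesNothing.not_isBounded {S : Set (Edge ℤ)} (hS : EnclosesNothing S)
    {C : Set (ℝ × ℝ)} (hC : IsComponentOf C (dualRealization S)ᶜ) : ¬ Bornology.IsBounded C := by
  intro hB
  obtain ⟨p, hp⟩ : C.Nonempty := by
    obtain ⟨p, hp, rfl⟩ := hC
    exact ⟨p, mem_connectedComponentIn hp⟩
  obtain ⟨v, hv⟩ := exists_mem_cell p
  refine hS.infinite_cluster v ((finite_setOf_cell_inter_nonempty hB).subset fun w hw => ?_)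
  refine ⟨_, openCell_subset_cell w (center_mem_openCell w), ?_⟩
  exact hC.cell_subset hp hv hw ⟨openCell_subset_cell w (center_mem_openCell w),
    openCell_subset_compl S w (center_mem_openCell w)⟩

/-- If the clusters of `S` have no trifurcations, the components of the complement of `S` have at
most two ends. -/
theorem hasAtMostTwoEnds_of_not_isTrifurcation {S : Set (Edge ℤ)}
    (hS : ∀ (R : Finset (Vertex ℤ)) (x : Fin 3 → Vertex ℤ),
      ¬ IsTrifurcation (clusterGraph S) (R : Set (Vertex ℤ)) x)
    {C : Set (ℝ × ℝ)} (hC : IsComponentOf C (dualRealization S)ᶜ) : HasAtMostTwoEnds C := by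
  intro B hB
  by_contra hcard
  rw [not_le] at hcard
  obtain ⟨t, ht, ht3⟩ := Set.exists_subset_encard_eq (k := 3) (Order.add_one_le_of_lt hcard)
  obtain ⟨K₀, K₁, K₂, h01, h02, h12, rfl⟩ := Set.encard_eq_three.1 ht3
  let K : Fin 3 → Set (ℝ × ℝ) := ![K₀, K₁, K₂]
  have hK : ∀ k, IsComponentOf (K k) (C \ B) ∧ ¬ Bornology.IsBounded (K k) := by
    intro k
    refine ht ?_
    fin_cases k <;> simp [K]
  have hKne : ∀ k l, k ≠ l → K k ≠ K l := by
    intro k l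
    fin_cases k <;> fin_cases l <;> simp [K, h01, h02, h12, h01.symm, h02.symm, h12.symm]
  obtain ⟨p, hp⟩ : C.Nonempty := by
    obtain ⟨p, hp, rfl⟩ := hC
    exact ⟨p, mem_connectedComponentIn hp⟩
  obtain ⟨v, hv⟩ := exists_mem_cell p
  set Λ := (finite_setOf_cell_inter_nonempty hB).toFinset with hΛ
  -- a square of the cluster that misses `B` lies in one component of `C \ B`
  have hcell : ∀ w, (clusterGraph S).Reachable v w → w ∉ Λ →
      cell w ∩ (dualRealization S)ᶜ ⊆ C \ B := by
    intro w hw hwΛ q hq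
    refine ⟨hC.cell_subset hp hv hw hq, fun hqB => hwΛ ?_⟩
    rw [hΛ, Set.Finite.mem_toFinset]
    exact ⟨q, hq.1, hqB⟩
  let W : Fin 3 → Set (Vertex ℤ) := fun k =>
    {w | (clusterGraph S).Reachable v w ∧ w ∉ Λ ∧ cell w ∩ (dualRealization S)ᶜ ⊆ K k}
  have hmemW : ∀ k w q, (clusterGraph S).Reachable v w → w ∉ Λ → q ∈ K k → q ∈ cell w →
      w ∈ W k := by
    intro k w q hw hwΛ hqK hqw
    exact ⟨hw, hwΛ, (hK k).1.subset_of_isPreconnected (isPreconnected_cell_inter S w)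
      (hcell w hw hwΛ) ⟨hqw, hC.subset ((hK k).1.subset hqK).1⟩ hqK⟩
  have hno : ¬ ∃ (R : Finset (Vertex ℤ)) (x : Fin 3 → Vertex ℤ),
      IsTrifurcation (clusterGraph S) (R : Set (Vertex ℤ)) x := fun ⟨R, x, h⟩ => hS R x h
  refine hno (exists_isTrifurcation v Λ W (fun k w hw => hw.1) ?_ ?_ ?_)
  · intro k w hw w' hadj hw'
    obtain ⟨q, hq, hqw, hqw'⟩ := exists_mem_cell_inter_cell hadj
    exact hmemW k w' q (hw.1.trans hadj.reachable) hw' (hw.2.2 ⟨hqw, hq⟩) hqw'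
  · intro k l hkl
    rw [Set.disjoint_left]
    intro w hwk hwl
    have hc : ((w.1 : ℝ), (w.2 : ℝ)) ∈ cell w ∩ (dualRealization S)ᶜ :=
      ⟨openCell_subset_cell w (center_mem_openCell w),
        openCell_subset_compl S w (center_mem_openCell w)⟩
    exact hKne k l hkl ((hK k).1.eq_of_mem (hK l).1 (hwk.2.2 hc) (hwl.2.2 hc))
  · intro k hfin
    refine (hK k).2 (((Bornology.isBounded_biUnion (hfin.union Λ.finite_toSet)).2
      fun w _ => isBounded_cell w).subset fun q hq => ?_)
    obtain ⟨w, hw⟩ := exists_mem_cell q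
    have hqC := ((hK k).1.subset hq).1
    have hvw := reachable_of_isPreconnected hC.isPreconnected hC.subset hp hv hqC hw
    refine Set.mem_biUnion ?_ hw
    by_cases hwΛ : w ∈ Λ
    · exact Or.inr hwΛ
    · exact Or.inl (hmemW k w q hvw hwΛ hq hw)

/-! ### Ground states on the half-plane -/

instance isZeroOrProbabilityMeasure_uniformGS (J : EdgeField ℕ) :
    IsZeroOrProbabilityMeasure (uniformGS J) := by
  unfold uniformGS uniformOn
  infer_instance

instance isProbabilityMeasure_couplingLaw (ν₀ : Measure ℝ) [IsProbabilityMeasure ν₀] :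
    IsProbabilityMeasure (couplingLaw ν₀) := by
  unfold couplingLaw
  infer_instance

/-- The kernel `J ↦ δ_J × μ_J × μ_J`. -/
def gsKernel (J : EdgeField ℕ) : Measure (EdgeField ℕ × SpinConf ℕ × SpinConf ℕ) :=
  (Measure.dirac J).prod ((uniformGS J).prod (uniformGS J))

theorem halfPlaneMeasure_eq (ν₀ : Measure ℝ) [IsProbabilityMeasure ν₀] :
    halfPlaneMeasure ν₀ = (couplingLaw ν₀).bind gsKernel := rfl

theorem gsKernel_apply_le (J : EdgeField ℕ) (s : Set (EdgeField ℕ × SpinConf ℕ × SpinConf ℕ)) :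
    gsKernel J s ≤ 1 := by
  refine (measure_mono (Set.subset_univ s)).trans ?_
  rw [gsKernel, ← Set.univ_prod_univ, Measure.prod_prod, ← Set.univ_prod_univ, Measure.prod_prod,
    measure_univ, one_mul]
  exact mul_le_one' prob_le_one prob_le_one

instance isFiniteMeasure_halfPlaneMeasure (ν₀ : Measure ℝ) [IsProbabilityMeasure ν₀] :
    IsFiniteMeasure (halfPlaneMeasure ν₀) := by
  refine ⟨?_⟩
  rw [halfPlaneMeasure_eq]
  refine (Measure.bind_apply_le _ MeasurableSet.univ).trans_lt ?_
  refine (lintegral_mono fun J => gsKernel_apply_le J _).trans_lt ?_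
  simp

/-- A linear combination of independent couplings without atoms has no atom at zero. -/
theorem couplingLaw_sum_eq_zero (ν₀ : Measure ℝ) [IsProbabilityMeasure ν₀] [NullSingletonClass ν₀]
    {B : Finset (Edge ℕ)} (hB : B.Nonempty) {c : Edge ℕ → ℝ} (hc : ∀ e, c e ≠ 0) :
    couplingLaw ν₀ {J | ∑ e ∈ B, c e * J e = 0} = 0 := by
  obtain ⟨e₀, he₀⟩ := hB
  have hind : iIndepFun (fun (e : Edge ℕ) (J : EdgeField ℕ) => c e * J e) (couplingLaw ν₀) :=
    iIndepFun_infinitePi (P := fun _ : Edge ℕ => ν₀) (X := fun e t => c e * t)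
      fun e => measurable_const_mul (c e)
  have hm : ∀ e, Measurable fun J : EdgeField ℕ => c e * J e := by
    intro e
    have h : Measurable fun J : EdgeField ℕ => J e := measurable_pi_apply e
    exact h.const_mul (c e)
  have hpair := hind.indepFun_finsetSum_of_notMem hm (Finset.notMem_erase e₀ B)
  have hm' : Measurable (∑ e ∈ B.erase e₀, fun J : EdgeField ℕ => c e * J e) := by
    have h : (∑ e ∈ B.erase e₀, fun J : EdgeField ℕ => c e * J e) =
        fun J => ∑ e ∈ B.erase e₀, c e * J e := by
      ext J
      exact Finset.sum_apply _ _ _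
    rw [h]
    exact Finset.measurable_sum _ fun e _ => hm e
  rw [indepFun_iff_map_prod_eq_prod_map_map hm'.aemeasurable (hm e₀).aemeasurable] at hpair
  have hset : MeasurableSet {q : ℝ × ℝ | q.1 + q.2 = 0} :=
    (measurable_fst.add measurable_snd) (measurableSet_singleton 0)
  have heq : {J : EdgeField ℕ | ∑ e ∈ B, c e * J e = 0} =
      (fun J => ((∑ e ∈ B.erase e₀, fun J : EdgeField ℕ => c e * J e) J, c e₀ * J e₀)) ⁻¹'
        {q : ℝ × ℝ | q.1 + q.2 = 0} := by
    ext J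
    simp only [Set.mem_ofPred_eq, Set.mem_preimage, Finset.sum_apply]
    rw [Finset.sum_erase_add _ _ he₀]
  rw [heq, ← Measure.map_apply (hm'.prodMk (hm e₀)) hset, hpair, Measure.measure_prod_null hset]
  refine Eventually.of_forall fun y => ?_
  have hpre : Prod.mk y ⁻¹' {q : ℝ × ℝ | q.1 + q.2 = 0} = {-y} := by
    ext t
    simp only [Set.mem_preimage, Set.mem_ofPred_eq, Set.mem_singleton_iff]
    constructor <;> intro h <;> linarith
  have hpre' : (fun J : EdgeField ℕ => c e₀ * J e₀) ⁻¹' {-y} =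
      (fun J : EdgeField ℕ => J e₀) ⁻¹' {-y / c e₀} := by
    ext J
    simp only [Set.mem_preimage, Set.mem_singleton_iff]
    rw [eq_div_iff (hc e₀), mul_comm]
  change (couplingLaw ν₀).map (fun J => c e₀ * J e₀)
    (Prod.mk y ⁻¹' {q : ℝ × ℝ | q.1 + q.2 = 0}) = 0
  rw [hpre, Measure.map_apply (hm e₀) (measurableSet_singleton _), hpre',
    ← Measure.map_apply (measurable_pi_apply e₀) (measurableSet_singleton _), couplingLaw,
    Measure.infinitePi_map_eval]
  exact measure_singleton _

theorem edgeBoundary_nonempty {A : Finset (Vertex ℕ)} (hA : A.Nonempty) :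
    (edgeBoundary (A : Set (Vertex ℕ))).Nonempty := by
  obtain ⟨v, hv, hmax⟩ := A.exists_max_image (fun v => v.1) hA
  refine ⟨(v, Dir.right), Or.inl ⟨hv, fun h => ?_⟩⟩
  have := hmax _ h
  obtain ⟨x, y⟩ := v
  simp only [tgt] at this
  omega

theorem measurable_bond (e : Edge ℕ) : Measurable fun σ : SpinConf ℕ => ((bond σ e : ℤ) : ℝ) := by
  have h : Measurable fun q : ℤˣ × ℤˣ => (((q.1 * q.2 : ℤˣ) : ℤ) : ℝ) := Measurable.of_discrete
  have h1 : Measurable fun σ : SpinConf ℕ => σ (src e) := measurable_pi_apply _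
  have h2 : Measurable fun σ : SpinConf ℕ => σ (tgt e) := measurable_pi_apply _
  exact h.comp (h1.prodMk h2)

theorem measurableSet_bond_ne (e : Edge ℕ) :
    MeasurableSet {p : SpinConf ℕ × SpinConf ℕ | bond p.1 e ≠ bond p.2 e} := by
  have h : MeasurableSet {p : SpinConf ℕ × SpinConf ℕ |
      ((bond p.1 e : ℤ) : ℝ) = ((bond p.2 e : ℤ) : ℝ)} :=
    measurableSet_eq_fun ((measurable_bond e).comp measurable_fst)
      ((measurable_bond e).comp measurable_snd)
  convert h.compl using 1
  ext p
  simp [Units.ext_iff]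

/-- Almost every configuration for the uniform measure satisfies each of the defining
inequalities of a ground state. -/
theorem ae_uniformGS (J : EdgeField ℕ) (A : Finset (Vertex ℕ)) :
    ∀ᵐ σ ∂(uniformGS J), 0 ≤ ∑ e ∈ (edgeBoundary_finite A).toFinset, J e * ((bond σ e : ℤ) : ℝ) := by
  have hm : MeasurableSet {σ : SpinConf ℕ |
      ¬ 0 ≤ ∑ e ∈ (edgeBoundary_finite A).toFinset, J e * ((bond σ e : ℤ) : ℝ)} :=
    (measurableSet_le measurable_const
      (Finset.measurable_sum _ fun e _ => (measurable_bond e).const_mul (J e))).compl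
  rw [ae_iff, uniformGS, uniformOn, cond_apply' hm]
  have hempty : groundStates J ∩ {σ : SpinConf ℕ |
      ¬ 0 ≤ ∑ e ∈ (edgeBoundary_finite A).toFinset, J e * ((bond σ e : ℤ) : ℝ)} = ∅ := by
    refine Set.eq_empty_of_forall_notMem fun σ hσ => hσ.2 ?_
    have := hσ.1 A
    rwa [finsum_mem_eq_finite_toFinset_sum _ (edgeBoundary_finite A)] at this
  rw [hempty, measure_empty, mul_zero]

/-- The set of pairs of spin configurations whose interface contains the boundary of `A`. -/
def boundaryInInterface (A : Finset (Vertex ℕ)) : Set (SpinConf ℕ × SpinConf ℕ) :=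
  {p | ∀ e ∈ edgeBoundary (A : Set (Vertex ℕ)), bond p.1 e ≠ bond p.2 e}

theorem measurableSet_boundaryInInterface (A : Finset (Vertex ℕ)) :
    MeasurableSet (boundaryInInterface A) := by
  have : boundaryInInterface A = ⋂ e ∈ edgeBoundary (A : Set (Vertex ℕ)),
      {p : SpinConf ℕ × SpinConf ℕ | bond p.1 e ≠ bond p.2 e} := by
    ext p
    simp [boundaryInInterface]
  rw [this]
  exact MeasurableSet.biInter (Set.to_countable _) fun e _ => measurableSet_bond_ne e

/-- Two ground states almost surely do not differ by the flip of a finite set: the boundary of the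
set would have zero energy, which has probability zero for couplings without atoms. -/
theorem halfPlaneMeasure_boundaryInInterface (ν₀ : Measure ℝ) [IsProbabilityMeasure ν₀]
    [NullSingletonClass ν₀] {A : Finset (Vertex ℕ)} (hA : A.Nonempty) :
    halfPlaneMeasure ν₀ {p | p.2 ∈ boundaryInInterface A} = 0 := by
  set B := (edgeBoundary_finite A).toFinset with hB
  have hBne : B.Nonempty := by
    obtain ⟨e, he⟩ := edgeBoundary_nonempty hA
    exact ⟨e, by simpa [hB] using he⟩
  have hgood : ∀ᵐ J ∂(couplingLaw ν₀), ∀ s : B → ℤˣ,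
      ∑ e ∈ B.attach, ((s e : ℤ) : ℝ) * J e ≠ 0 := by
    rw [ae_all_iff]
    intro s
    rw [ae_iff]
    classical
    let c : Edge ℕ → ℝ := fun e => if h : e ∈ B then ((s ⟨e, h⟩ : ℤ) : ℝ) else 1
    have hc : ∀ e, c e ≠ 0 := by
      intro e
      simp only [c]
      split_ifs with h
      · exact_mod_cast (s ⟨e, h⟩).ne_zero
      · exact one_ne_zero
    convert couplingLaw_sum_eq_zero ν₀ hBne hc using 2
    ext J
    rw [Set.mem_ofPred_eq, Set.mem_ofPred_eq, not_not, ← Finset.sum_attach B]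
    simp [c]
  have hmeas : MeasurableSet {p : EdgeField ℕ × SpinConf ℕ × SpinConf ℕ |
      p.2 ∈ boundaryInInterface A} := measurable_snd (measurableSet_boundaryInInterface A)
  refine le_antisymm ((Measure.bind_apply_le _ hmeas).trans ?_) (zero_le)
  rw [nonpos_iff_eq_zero]
  refine (lintegral_congr_ae ?_).trans lintegral_zero
  filter_upwards [hgood] with J hJ
  change gsKernel J {p | p.2 ∈ boundaryInInterface A} = 0
  rw [gsKernel, Measure.dirac_prod, Measure.map_apply measurable_prodMk_left hmeas]
  have h1 := Measure.quasiMeasurePreserving_fst (μ := uniformGS J) (ν := uniformGS J) |>.ae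
    (ae_uniformGS J A)
  have h2 := Measure.quasiMeasurePreserving_snd (μ := uniformGS J) (ν := uniformGS J) |>.ae
    (ae_uniformGS J A)
  refine measure_eq_zero_iff_ae_notMem.2 ?_
  filter_upwards [h1, h2] with p hp1 hp2 hp
  have hneg : ∀ e ∈ B, ((bond p.2 e : ℤ) : ℝ) = -((bond p.1 e : ℤ) : ℝ) := by
    intro e he
    have hne : bond p.1 e ≠ bond p.2 e := hp e (by simpa [hB] using he)
    rcases Int.units_eq_one_or (bond p.1 e) with h3 | h3 <;>
    rcases Int.units_eq_one_or (bond p.2 e) with h4 | h4 <;>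
    simp_all
  refine hJ (fun e => bond p.1 e) ?_
  rw [Finset.sum_attach B fun e => ((bond p.1 e : ℤ) : ℝ) * J e]
  have h3 : ∑ e ∈ B, J e * ((bond p.2 e : ℤ) : ℝ) = -∑ e ∈ B, J e * ((bond p.1 e : ℤ) : ℝ) := by
    rw [← Finset.sum_neg_distrib]
    exact Finset.sum_congr rfl fun e he => by rw [hneg e he, mul_neg]
  rw [← hB] at hp1 hp2
  rw [h3] at hp2
  simp only [mul_comm (_ : ℝ) (J _)]
  linarith

/-! ### Horizontal translations of the half-plane -/

/-- The horizontal translation by `-a` of the vertices of the half-plane. -/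
def hshiftVertex (a : ℤ) : Vertex ℕ ≃ Vertex ℕ where
  toFun v := (v.1 - a, v.2)
  invFun v := (v.1 + a, v.2)
  left_inv v := by simp
  right_inv v := by simp

/-- The horizontal translation by `-a` of the edges of the half-plane. -/
def hshiftEdge (a : ℤ) : Edge ℕ ≃ Edge ℕ := (hshiftVertex a).prodCongr (Equiv.refl Dir)

/-- The horizontal translation of spin configurations. -/
def hshiftSpins (a : ℤ) : SpinConf ℕ ≃ᵐ SpinConf ℕ :=
  MeasurableEquiv.piCongrLeft (fun _ => ℤˣ) (hshiftVertex a)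

/-- The horizontal translation of couplings. -/
def hshiftField (a : ℤ) : EdgeField ℕ ≃ᵐ EdgeField ℕ :=
  MeasurableEquiv.piCongrLeft (fun _ => ℝ) (hshiftEdge a)

theorem hshiftSpins_apply (a : ℤ) (σ : SpinConf ℕ) (v : Vertex ℕ) :
    hshiftSpins a σ v = σ (v.1 + a, v.2) := by
  have h := Equiv.piCongrLeft_apply_apply (fun _ => ℤˣ) (hshiftVertex a) σ (v.1 + a, v.2)
  have h' : hshiftVertex a (v.1 + a, v.2) = v := (hshiftVertex a).right_inv v
  rwa [h'] at h

theorem hshiftField_apply (a : ℤ) (J : EdgeField ℕ) (e : Edge ℕ) :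
    hshiftField a J e = J ((e.1.1 + a, e.1.2), e.2) := by
  have h := Equiv.piCongrLeft_apply_apply (fun _ => ℝ) (hshiftEdge a) J ((e.1.1 + a, e.1.2), e.2)
  have h' : hshiftEdge a ((e.1.1 + a, e.1.2), e.2) = e := (hshiftEdge a).right_inv e
  rwa [h'] at h

theorem map_hshiftField_couplingLaw (ν₀ : Measure ℝ) [IsProbabilityMeasure ν₀] (a : ℤ) :
    (couplingLaw ν₀).map (hshiftField a) = couplingLaw ν₀ :=
  Measure.infinitePi_map_piCongrLeft (fun _ : Edge ℕ => ν₀) (hshiftEdge a)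

theorem bond_hshiftSpins (a : ℤ) (σ : SpinConf ℕ) (e : Edge ℕ) :
    bond (hshiftSpins a σ) e = bond σ ((e.1.1 + a, e.1.2), e.2) := by
  obtain ⟨⟨x, y⟩, d⟩ := e
  cases d
  · simp only [bond, hshiftSpins_apply, src, tgt]
    rw [show x + 1 + a = x + a + 1 by ring]
  · simp only [bond, hshiftSpins_apply, src, tgt]

theorem hshiftSpins_mem_groundStates {a : ℤ} {J : EdgeField ℕ} {σ : SpinConf ℕ}
    (h : σ ∈ groundStates J) : hshiftSpins a σ ∈ groundStates (hshiftField a J) := by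
  intro A
  have hA := h (A.map (hshiftVertex (-a)).toEmbedding)
  have hmem : ∀ v : Vertex ℕ, (v.1 + a, v.2) ∈ A.map (hshiftVertex (-a)).toEmbedding ↔ v ∈ A := by
    intro v
    have : (v.1 + a, v.2) = hshiftVertex (-a) v := by simp [hshiftVertex]
    rw [this, Finset.mem_map_equiv, Equiv.symm_apply_apply]
  have hbd : ∀ e : Edge ℕ, hshiftEdge (-a) e ∈
      edgeBoundary ((A.map (hshiftVertex (-a)).toEmbedding : Finset _) : Set (Vertex ℕ)) ↔
      e ∈ edgeBoundary (A : Set (Vertex ℕ)) := by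
    rintro ⟨⟨x, y⟩, d⟩
    have h1 : hshiftEdge (-a) ((x, y), d) = ((x + a, y), d) := by
      simp [hshiftEdge, hshiftVertex]
    rw [h1]
    have h2 := hmem (x, y)
    simp only at h2
    cases d
    · have h3 := hmem (x + 1, y)
      simp only at h3
      rw [show x + 1 + a = x + a + 1 by ring] at h3
      simp only [edgeBoundary, src, tgt, Set.mem_ofPred_eq, Finset.mem_coe, h2, h3]
    · have h3 := hmem (x, y + 1)
      simp only at h3
      simp only [edgeBoundary, src, tgt, Set.mem_ofPred_eq, Finset.mem_coe, h2, h3]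
  refine hA.trans_eq (finsum_mem_eq_of_bijOn (hshiftEdge (-a)) ?_ ?_).symm
  · refine ⟨fun e he => (hbd e).2 he, (hshiftEdge (-a)).injective.injOn, fun e he => ?_⟩
    refine ⟨(hshiftEdge (-a)).symm e, (hbd _).1 ?_, Equiv.apply_symm_apply _ _⟩
    rwa [Equiv.apply_symm_apply]
  · intro e _
    have h1 : hshiftEdge (-a) e = ((e.1.1 + a, e.1.2), e.2) := by
      simp only [hshiftEdge, hshiftVertex, sub_neg_eq_add]
      rfl
    rw [hshiftField_apply, bond_hshiftSpins, h1]

theorem hshiftSpins_neg (a : ℤ) (σ : SpinConf ℕ) : hshiftSpins (-a) (hshiftSpins a σ) = σ := by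
  funext v
  rw [hshiftSpins_apply, hshiftSpins_apply]
  simp

theorem hshiftField_neg (a : ℤ) (J : EdgeField ℕ) : hshiftField (-a) (hshiftField a J) = J := by
  funext v
  rw [hshiftField_apply, hshiftField_apply]
  simp

theorem preimage_hshiftSpins_groundStates (a : ℤ) (J : EdgeField ℕ) :
    hshiftSpins a ⁻¹' groundStates (hshiftField a J) = groundStates J := by
  ext σ
  refine ⟨fun h => ?_, hshiftSpins_mem_groundStates⟩
  have := hshiftSpins_mem_groundStates (a := -a) h
  rwa [hshiftSpins_neg, hshiftField_neg] at this

theorem map_count_measurableEquiv {α : Type*} [MeasurableSpace α] (e : α ≃ᵐ α) :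
    (Measure.count : Measure α).map e = Measure.count := by
  ext s hs
  rw [e.map_apply, Measure.count_apply (e.measurable hs), Measure.count_apply hs]
  congr 1
  exact Set.encard_preimage_of_bijective e.bijective s

theorem map_hshiftSpins_uniformGS (a : ℤ) (J : EdgeField ℕ) :
    (uniformGS J).map (hshiftSpins a) = uniformGS (hshiftField a J) := by
  ext t ht
  rw [MeasurableEquiv.map_apply, uniformGS, uniformGS, uniformOn, uniformOn,
    cond_apply' ((hshiftSpins a).measurable ht), cond_apply' ht,
    ← preimage_hshiftSpins_groundStates a J, ← Set.preimage_inter, ← MeasurableEquiv.map_apply,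
    ← MeasurableEquiv.map_apply, map_count_measurableEquiv]

/-- The horizontal translation of triples `(J, σ, σ')`. -/
def hshiftTriple (a : ℤ) : EdgeField ℕ × SpinConf ℕ × SpinConf ℕ →
    EdgeField ℕ × SpinConf ℕ × SpinConf ℕ :=
  Prod.map (hshiftField a) (Prod.map (hshiftSpins a) (hshiftSpins a))

theorem measurable_hshiftTriple (a : ℤ) : Measurable (hshiftTriple a) :=
  (hshiftField a).measurable.prodMap
    ((hshiftSpins a).measurable.prodMap (hshiftSpins a).measurable)

theorem map_hshiftTriple_gsKernel (a : ℤ) (J : EdgeField ℕ) :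
    (gsKernel J).map (hshiftTriple a) = gsKernel (hshiftField a J) := by
  rw [gsKernel, gsKernel, hshiftTriple, ← Measure.map_prod_map _ _ (hshiftField a).measurable
    ((hshiftSpins a).measurable.prodMap (hshiftSpins a).measurable),
    ← Measure.map_prod_map _ _ (hshiftSpins a).measurable (hshiftSpins a).measurable,
    map_hshiftSpins_uniformGS, Measure.map_dirac' (hshiftField a).measurable]

/-- The measure `M` is invariant under horizontal translations. -/
theorem map_hshiftTriple_halfPlaneMeasure (ν₀ : Measure ℝ) [IsProbabilityMeasure ν₀]
    (hK : AEMeasurable gsKernel (couplingLaw ν₀)) (a : ℤ) :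
    (halfPlaneMeasure ν₀).map (hshiftTriple a) = halfPlaneMeasure ν₀ := by
  ext s hs
  have hs' := measurable_hshiftTriple a hs
  rw [Measure.map_apply (measurable_hshiftTriple a) hs, halfPlaneMeasure_eq,
    Measure.bind_apply hs' hK, Measure.bind_apply hs hK]
  have h1 : ∀ J, gsKernel J (hshiftTriple a ⁻¹' s) = gsKernel (hshiftField a J) s := fun J => by
    rw [← map_hshiftTriple_gsKernel, Measure.map_apply (measurable_hshiftTriple a) hs]
  simp only [h1]
  conv_rhs => rw [← map_hshiftField_couplingLaw ν₀ a]
  rw [lintegral_map_equiv]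

/-! ### The limit on the plane -/

theorem measurable_shiftSpin (k : ℕ) : Measurable (shiftSpin k) := by
  refine measurable_pi_lambda _ fun v => ?_
  unfold shiftSpin
  split_ifs
  · exact measurable_pi_apply _
  · exact measurable_const

theorem measurable_shiftEdge (k : ℕ) : Measurable (shiftEdge k) := by
  refine measurable_pi_lambda _ fun v => ?_
  unfold shiftEdge
  split_ifs
  · exact measurable_pi_apply _
  · exact measurable_const

theorem measurable_shiftConf (k : ℕ) : Measurable (shiftConf k) := by
  have h1 : Measurable fun ω : Conf ℕ => ω.2.2 := measurable_snd.comp measurable_snd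
  have h2 : Measurable fun ω : Conf ℕ => ω.2.2.2 := measurable_snd.comp h1
  exact ((measurable_shiftEdge k).comp measurable_fst).prodMk
    (((measurable_shiftSpin k).comp (measurable_fst.comp measurable_snd)).prodMk
    (((measurable_shiftSpin k).comp (measurable_fst.comp h1)).prodMk
    (((measurable_shiftEdge k).comp (measurable_fst.comp h2)).prodMk
    ((measurable_shiftEdge k).comp (measurable_snd.comp h2)))))

/-- The pair of spin configurations of a configuration on the plane. -/
def spinPair (ω : Conf ℤ) : SpinConf ℤ × SpinConf ℤ := (ω.2.1, ω.2.2.1)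

theorem continuous_spinPair : Continuous spinPair := by
  unfold spinPair
  fun_prop

/-- The pair of spin configurations of a triple `(J, σ, σ')`, moved down by `k`. -/
def shiftedPair (k : ℕ) (p : EdgeField ℕ × SpinConf ℕ × SpinConf ℕ) : SpinConf ℤ × SpinConf ℤ :=
  (shiftSpin k p.2.1, shiftSpin k p.2.2)

theorem measurable_shiftedPair (k : ℕ) : Measurable (shiftedPair k) :=
  ((measurable_shiftSpin k).comp (measurable_fst.comp measurable_snd)).prodMk
    ((measurable_shiftSpin k).comp (measurable_snd.comp measurable_snd))

/-- The existence of a limit of mass one excludes the degenerate case `M* = 0`. As push-forwards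
under maps that are not almost everywhere measurable are zero by convention, this yields the
measurability of the critical values and of the kernel `J ↦ δ_J × μ_J × μ_J`. -/
theorem IsPlaneLimit.extendedMeasure_ne_zero {ν₀ : Measure ℝ} [IsProbabilityMeasure ν₀]
    {Mt : Measure (Conf ℤ)} (hMt : IsPlaneLimit ν₀ Mt) : extendedMeasure ν₀ ≠ 0 := by
  intro h0
  obtain ⟨hprob, n, -, hlim⟩ := hMt
  have h1 := hlim (BoundedContinuousFunction.const _ 1)
  have h2 : ∀ m, averagedMeasure ν₀ m = 0 := fun m => by simp [averagedMeasure, h0]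
  simp only [h2, integral_zero_measure] at h1
  have h3 := tendsto_nhds_unique h1 tendsto_const_nhds
  simp at h3

theorem IsPlaneLimit.aemeasurable_adjoinCritical {ν₀ : Measure ℝ} [IsProbabilityMeasure ν₀]
    {Mt : Measure (Conf ℤ)} (hMt : IsPlaneLimit ν₀ Mt) :
    AEMeasurable adjoinCritical (halfPlaneMeasure ν₀) :=
  AEMeasurable.of_map_ne_zero hMt.extendedMeasure_ne_zero

theorem IsPlaneLimit.aemeasurable_gsKernel {ν₀ : Measure ℝ} [IsProbabilityMeasure ν₀]
    {Mt : Measure (Conf ℤ)} (hMt : IsPlaneLimit ν₀ Mt) :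
    AEMeasurable gsKernel (couplingLaw ν₀) := by
  by_contra h
  refine hMt.extendedMeasure_ne_zero ?_
  rw [extendedMeasure, halfPlaneMeasure_eq, Measure.bind, Measure.map_of_not_aemeasurable h,
    Measure.join_zero, Measure.map_zero]

instance isFiniteMeasure_extendedMeasure (ν₀ : Measure ℝ) [IsProbabilityMeasure ν₀] :
    IsFiniteMeasure (extendedMeasure ν₀) := by
  unfold extendedMeasure
  infer_instance

/-- The spins under the limit `M̃` are obtained from the spins under `M` by moving them down
and averaging. -/
theorem IsPlaneLimit.tendsto {ν₀ : Measure ℝ} [IsProbabilityMeasure ν₀]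
    {Mt : Measure (Conf ℤ)} (hMt : IsPlaneLimit ν₀ Mt) :
    ∃ n : ℕ → ℕ, Tendsto n atTop atTop ∧ ∀ f : (SpinConf ℤ × SpinConf ℤ) →ᵇ ℝ,
      Tendsto (fun j => ((n j + 1 : ℕ) : ℝ)⁻¹ * ∑ k ∈ Finset.range (n j + 1),
        ∫ p, f (shiftedPair k p) ∂(halfPlaneMeasure ν₀)) atTop
        (𝓝 (∫ q, f q ∂(Mt.map spinPair))) := by
  have hΦ := hMt.aemeasurable_adjoinCritical
  obtain ⟨hprob, n, hn, hlim⟩ := hMt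
  refine ⟨n, hn.tendsto_atTop, fun f => ?_⟩
  have hf : Continuous fun ω : Conf ℤ => f (spinPair ω) := f.continuous.comp continuous_spinPair
  have h := hlim (f.compContinuous ⟨spinPair, continuous_spinPair⟩)
  rw [integral_map continuous_spinPair.measurable.aemeasurable
    f.continuous.aestronglyMeasurable]
  refine h.congr fun j => ?_
  rw [averagedMeasure, integral_smul_measure, integral_finsetSum_measure, smul_eq_mul]
  · congr 1
    · rw [ENNReal.toReal_inv]
      norm_cast
    · refine Finset.sum_congr rfl fun k _ => ?_
      rw [integral_map (measurable_shiftConf k).aemeasurable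
        (BoundedContinuousFunction.continuous _).aestronglyMeasurable, extendedMeasure,
        integral_map hΦ]
      · rfl
      · exact ((BoundedContinuousFunction.continuous _).measurable.comp
          (measurable_shiftConf k)).aestronglyMeasurable
  · exact fun k _ => BoundedContinuousFunction.integrable _ _

/-! ### Translation invariance -/

/-- Translation of spin configurations on the plane. -/
def shiftPlane (v : ℤ × ℤ) (q : SpinConf ℤ × SpinConf ℤ) : SpinConf ℤ × SpinConf ℤ :=
  (fun w => q.1 (w + v), fun w => q.2 (w + v))

theorem continuous_shiftPlane (v : ℤ × ℤ) : Continuous (shiftPlane v) := by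
  unfold shiftPlane
  fun_prop

theorem shiftPlane_horizontal (a : ℤ) (k : ℕ) (p : EdgeField ℕ × SpinConf ℕ × SpinConf ℕ) :
    shiftPlane (a, 0) (shiftedPair k p) = shiftedPair k (hshiftTriple a p) := by
  refine Prod.ext (funext fun w => ?_) (funext fun w => ?_) <;>
  · simp only [shiftPlane, shiftedPair, hshiftTriple, Prod.map_snd, Prod.map_fst, shiftSpin,
      Prod.fst_add, Prod.snd_add, add_zero]
    split_ifs
    · rw [hshiftSpins_apply]
    · rfl

theorem shiftPlane_up (k : ℕ) (p : EdgeField ℕ × SpinConf ℕ × SpinConf ℕ) :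
    shiftPlane (0, 1) (shiftedPair k p) = shiftedPair (k + 1) p := by
  refine Prod.ext (funext fun w => ?_) (funext fun w => ?_) <;>
  · have h : w.2 + 1 + (k : ℤ) = w.2 + ((k + 1 : ℕ) : ℤ) := by push_cast; ring
    simp only [shiftPlane, shiftedPair, shiftSpin, Prod.fst_add, Prod.snd_add, add_zero, h]

theorem IsPlaneLimit.map_shiftPlane_horizontal {ν₀ : Measure ℝ} [IsProbabilityMeasure ν₀]
    {Mt : Measure (Conf ℤ)} (hMt : IsPlaneLimit ν₀ Mt) (a : ℤ) :
    (Mt.map spinPair).map (shiftPlane (a, 0)) = Mt.map spinPair := by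
  have hprob := hMt.1
  have hK := hMt.aemeasurable_gsKernel
  obtain ⟨n, -, hlim⟩ := hMt.tendsto
  refine ext_of_forall_integral_eq_of_IsFiniteMeasure fun f => ?_
  rw [integral_map (continuous_shiftPlane _).measurable.aemeasurable
    f.continuous.aestronglyMeasurable]
  refine tendsto_nhds_unique
    (hlim (f.compContinuous ⟨shiftPlane (a, 0), continuous_shiftPlane _⟩)) ((hlim f).congr ?_)
  intro j
  congr 1
  refine Finset.sum_congr rfl fun k _ => ?_
  conv_lhs => rw [← map_hshiftTriple_halfPlaneMeasure ν₀ hK a]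
  rw [integral_map (f := fun p => f (shiftedPair k p)) (measurable_hshiftTriple a).aemeasurable
    (f.continuous.measurable.comp (measurable_shiftedPair k)).aestronglyMeasurable]
  refine integral_congr_ae (Eventually.of_forall fun p => ?_)
  exact congrArg f (shiftPlane_horizontal a k p).symm

/-- The vertical translation changes an average over `k ≤ n` only in the two boundary terms. -/
theorem IsPlaneLimit.map_shiftPlane_up {ν₀ : Measure ℝ} [IsProbabilityMeasure ν₀]
    {Mt : Measure (Conf ℤ)} (hMt : IsPlaneLimit ν₀ Mt) :
    (Mt.map spinPair).map (shiftPlane (0, 1)) = Mt.map spinPair := by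
  have hprob := hMt.1
  obtain ⟨n, hn, hlim⟩ := hMt.tendsto
  refine ext_of_forall_integral_eq_of_IsFiniteMeasure fun f => ?_
  rw [integral_map (continuous_shiftPlane _).measurable.aemeasurable
    f.continuous.aestronglyMeasurable]
  set a : ℕ → ℝ := fun k => ∫ p, f (shiftedPair k p) ∂(halfPlaneMeasure ν₀) with ha
  have h1 : Tendsto (fun j => ((n j + 1 : ℕ) : ℝ)⁻¹ *
      ∑ k ∈ Finset.range (n j + 1), a (k + 1)) atTop
      (𝓝 (∫ q, f (shiftPlane (0, 1) q) ∂(Mt.map spinPair))) := by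
    refine (hlim (f.compContinuous ⟨shiftPlane (0, 1), continuous_shiftPlane _⟩)).congr ?_
    intro j
    congr 1
    refine Finset.sum_congr rfl fun k _ => integral_congr_ae (Eventually.of_forall fun p => ?_)
    exact congrArg f (shiftPlane_up k p)
  have hbound : ∀ k, |a k| ≤ ‖f‖ * (halfPlaneMeasure ν₀).real Set.univ := fun k =>
    norm_integral_le_of_norm_le_const (Eventually.of_forall fun p => f.norm_coe_le_norm _)
  set C := ‖f‖ * (halfPlaneMeasure ν₀).real Set.univ with hC
  have hn' : Tendsto (fun j => ((n j + 1 : ℕ) : ℝ)) atTop atTop :=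
    tendsto_natCast_atTop_atTop.comp ((tendsto_add_atTop_nat 1).comp hn)
  have h2 : Tendsto (fun j => ((n j + 1 : ℕ) : ℝ)⁻¹ * (a (n j + 1) - a 0)) atTop (𝓝 0) := by
    refine squeeze_zero_norm (a := fun j => ((n j + 1 : ℕ) : ℝ)⁻¹ * (2 * C)) (fun j => ?_) ?_
    · rw [norm_mul, Real.norm_of_nonneg (by positivity)]
      refine mul_le_mul_of_nonneg_left ?_ (by positivity)
      calc ‖a (n j + 1) - a 0‖ ≤ ‖a (n j + 1)‖ + ‖a 0‖ := norm_sub_le _ _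
        _ ≤ C + C := add_le_add (hbound _) (hbound _)
        _ = 2 * C := by ring
    · simpa using hn'.inv_tendsto_atTop.mul_const (2 * C)
  refine tendsto_nhds_unique h1 ?_
  have h3 := (hlim f).add h2
  rw [add_zero] at h3
  refine h3.congr fun j => ?_
  rw [← Finset.sum_range_sub a (n j + 1), ← mul_add, ← Finset.sum_add_distrib]
  congr 1
  exact Finset.sum_congr rfl fun k _ => by simp only [ha]; ring

/-- The interface of a pair of spin configurations. -/
def pairInterface (q : SpinConf ℤ × SpinConf ℤ) : Set (Edge ℤ) := interface q.1 q.2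

theorem continuous_bond (e : Edge ℤ) : Continuous fun σ : SpinConf ℤ => bond σ e := by
  unfold bond
  fun_prop

theorem isClopen_mem_pairInterface (e : Edge ℤ) : IsClopen {q | e ∈ pairInterface q} := by
  have h : Continuous fun q : SpinConf ℤ × SpinConf ℤ => (bond q.1 e, bond q.2 e) :=
    ((continuous_bond e).comp continuous_fst).prodMk ((continuous_bond e).comp continuous_snd)
  exact (isClopen_discrete {p : ℤˣ × ℤˣ | p.1 ≠ p.2}).preimage h

theorem measurable_pairInterface : Measurable pairInterface :=
  measurable_set_iff.2 fun e =>
    measurableSet_setOfPred.1 (isClopen_mem_pairInterface e).isOpen.measurableSet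

theorem pairInterface_shiftPlane (v : ℤ × ℤ) (q : SpinConf ℤ × SpinConf ℤ) :
    pairInterface (shiftPlane v q) = translate v (pairInterface q) := by
  obtain ⟨x, y⟩ := v
  ext ⟨⟨i, j⟩, d⟩
  rw [mem_translate]
  cases d
  · simp [pairInterface, interface, shiftPlane, bond, src, tgt, add_right_comm]
  · simp [pairInterface, interface, shiftPlane, bond, src, tgt, add_right_comm]

/-- The law of the interface under `M̃`. -/
def interfaceLaw (Mt : Measure (Conf ℤ)) : Measure (Set (Edge ℤ)) :=
  (Mt.map spinPair).map pairInterface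

theorem ae_isEven_interfaceLaw (Mt : Measure (Conf ℤ)) : ∀ᵐ S ∂(interfaceLaw Mt), IsEven S := by
  refine ae_all_iff.2 fun u => ?_
  have hm : MeasurableSet {S : Set (Edge ℤ) | Even (faceDegree S u)} :=
    measurable_faceDegree u (MeasurableSet.of_discrete (s := {m : ℕ | Even m}))
  refine (ae_map_iff measurable_pairInterface.aemeasurable hm).2 (Eventually.of_forall fun q => ?_)
  exact isEven_interface q.1 q.2 u

theorem measurePreserving_translate {Mt : Measure (Conf ℤ)} {v : ℤ × ℤ}
    (h : (Mt.map spinPair).map (shiftPlane v) = Mt.map spinPair) :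
    MeasurePreserving (translate v) (interfaceLaw Mt) (interfaceLaw Mt) := by
  refine ⟨measurable_translate v, ?_⟩
  rw [interfaceLaw, Measure.map_map (measurable_translate v) measurable_pairInterface]
  conv_rhs => rw [← h]
  rw [Measure.map_map measurable_pairInterface (continuous_shiftPlane v).measurable]
  congr 1
  funext q
  exact (pairInterface_shiftPlane v q).symm

theorem IsPlaneLimit.isStationary_interfaceLaw {ν₀ : Measure ℝ} [IsProbabilityMeasure ν₀]
    {Mt : Measure (Conf ℤ)} (hMt : IsPlaneLimit ν₀ Mt) : IsStationary (interfaceLaw Mt) := by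
  have hadd : ∀ v w, MeasurePreserving (translate v) (interfaceLaw Mt) (interfaceLaw Mt) →
      MeasurePreserving (translate w) (interfaceLaw Mt) (interfaceLaw Mt) →
      MeasurePreserving (translate (v + w)) (interfaceLaw Mt) (interfaceLaw Mt) := by
    intro v w hv hw
    have h : translate (v + w) = translate v ∘ translate w :=
      funext fun S => (translate_translate v w S).symm
    rw [h]
    exact hv.comp hw
  have hneg : ∀ v, MeasurePreserving (translate v) (interfaceLaw Mt) (interfaceLaw Mt) →
      MeasurePreserving (translate (-v)) (interfaceLaw Mt) (interfaceLaw Mt) := by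
    intro v hv
    refine ⟨measurable_translate _, ?_⟩
    conv_lhs => rw [← hv.map_eq]
    rw [Measure.map_map (measurable_translate _) (measurable_translate _)]
    have h : translate (-v) ∘ translate v = id := funext fun S => by
      simp [translate_translate, translate_zero]
    rw [h, Measure.map_id]
  have hup := measurePreserving_translate hMt.map_shiftPlane_up
  have hnat : ∀ b : ℕ, MeasurePreserving (translate (0, (b : ℤ)))
      (interfaceLaw Mt) (interfaceLaw Mt) := by
    intro b
    induction b with
    | zero => exact measurePreserving_translate (hMt.map_shiftPlane_horizontal 0)
    | succ b ih =>
      have h := hadd _ _ ih hup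
      simpa using h
  have hint : ∀ b : ℤ, MeasurePreserving (translate (0, b))
      (interfaceLaw Mt) (interfaceLaw Mt) := by
    intro b
    obtain ⟨m, rfl | rfl⟩ := b.eq_nat_or_neg
    · exact hnat m
    · simpa using hneg _ (hnat m)
  intro v
  have h := hadd _ _ (measurePreserving_translate (hMt.map_shiftPlane_horizontal v.1)) (hint v.2)
  simpa using h

/-! ### The interface encloses no finite set -/

theorem edgeBoundary_plane_finite (A : Finset (Vertex ℤ)) :
    (edgeBoundary (A : Set (Vertex ℤ))).Finite := by
  have h1 : (src ⁻¹' (A : Set (Vertex ℤ)) : Set (Edge ℤ)).Finite := by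
    refine (A.finite_toSet.prod (Set.finite_univ (α := Dir))).subset ?_
    intro e he
    exact ⟨he, trivial⟩
  have h2 : (tgt ⁻¹' (A : Set (Vertex ℤ)) : Set (Edge ℤ)).Finite := by
    have hinj : Function.Injective (fun e : Edge ℤ => (tgt e, e.2)) := by
      rintro ⟨⟨x, y⟩, d⟩ ⟨⟨x', y'⟩, d'⟩ h
      cases d <;> cases d' <;> simp_all [tgt]
    refine Set.Finite.subset
      ((A.finite_toSet.prod (Set.finite_univ (α := Dir))).preimage hinj.injOn) ?_
    intro e he
    exact ⟨he, trivial⟩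
  refine (h1.union h2).subset ?_
  rintro e (⟨h, -⟩ | ⟨h, -⟩)
  · exact Or.inl h
  · exact Or.inr h

theorem isClopen_edgeBoundary_subset (A : Finset (Vertex ℤ)) :
    IsClopen {q | edgeBoundary (A : Set (Vertex ℤ)) ⊆ pairInterface q} := by
  have h : {q | edgeBoundary (A : Set (Vertex ℤ)) ⊆ pairInterface q} =
      ⋂ e ∈ edgeBoundary (A : Set (Vertex ℤ)), {q | e ∈ pairInterface q} := by
    ext q
    simp [Set.subset_def]
  rw [h]
  exact (edgeBoundary_plane_finite A).isClopen_biInter fun e _ => isClopen_mem_pairInterface e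

theorem shiftSpin_apply (k : ℕ) (σ : SpinConf ℕ) (x : ℤ) (y : ℕ) :
    shiftSpin k σ (x, (y : ℤ) - k) = σ (x, y) := by
  simp [shiftSpin]

theorem bond_shiftSpin (k : ℕ) (σ : SpinConf ℕ) (e : Edge ℕ) :
    bond (shiftSpin k σ) ((e.1.1, (e.1.2 : ℤ) - k), e.2) = bond σ e := by
  obtain ⟨⟨x, y⟩, d⟩ := e
  cases d
  · simp only [bond, src, tgt, shiftSpin_apply]
  · have h : (y : ℤ) - k + 1 = ((y + 1 : ℕ) : ℤ) - k := by push_cast; ring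
    simp only [bond, src, tgt, h, shiftSpin_apply]

/-- The set of vertices of the half-plane which the translation by `(0, -k)` moves to `A`. -/
def liftVertices (k : ℕ) (A : Finset (Vertex ℤ)) : Finset (Vertex ℕ) :=
  A.image fun v : Vertex ℤ => (v.1, (v.2 + k).toNat)

theorem mem_liftVertices {k : ℕ} {A : Finset (Vertex ℤ)} (hk : ∀ v ∈ A, 0 ≤ v.2 + k)
    (w : Vertex ℕ) : w ∈ liftVertices k A ↔ (w.1, (w.2 : ℤ) - k) ∈ A := by
  rw [liftVertices, Finset.mem_image]
  constructor
  · rintro ⟨v, hv, rfl⟩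
    have := hk v hv
    convert hv using 2
    simp only
    omega
  · intro h
    refine ⟨_, h, ?_⟩
    simp

theorem edge_mem_edgeBoundary_iff {k : ℕ} {A : Finset (Vertex ℤ)} (hk : ∀ v ∈ A, 0 ≤ v.2 + k)
    (e : Edge ℕ) : e ∈ edgeBoundary (liftVertices k A : Set (Vertex ℕ)) ↔
      (((e.1.1, (e.1.2 : ℤ) - k), e.2) : Edge ℤ) ∈ edgeBoundary (A : Set (Vertex ℤ)) := by
  obtain ⟨⟨x, y⟩, d⟩ := e
  cases d
  · simp only [edgeBoundary, src, tgt, Set.mem_ofPred_eq, Finset.mem_coe, mem_liftVertices hk]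
  · have h : ((y + 1 : ℕ) : ℤ) - k = (y : ℤ) - k + 1 := by push_cast; ring
    simp only [edgeBoundary, src, tgt, Set.mem_ofPred_eq, Finset.mem_coe, mem_liftVertices hk, h]

theorem shiftedPair_edgeBoundary_subset {k : ℕ} {A : Finset (Vertex ℤ)}
    (hk : ∀ v ∈ A, 0 ≤ v.2 + k) {p : EdgeField ℕ × SpinConf ℕ × SpinConf ℕ}
    (h : edgeBoundary (A : Set (Vertex ℤ)) ⊆ pairInterface (shiftedPair k p)) :
    p.2 ∈ boundaryInInterface (liftVertices k A) := by
  intro e he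
  have := h ((edge_mem_edgeBoundary_iff hk e).1 he)
  simpa only [pairInterface, interface, shiftedPair, Set.mem_ofPred_eq, bond_shiftSpin] using this

/-- Almost surely the boundary of a given finite set of vertices of the plane is not contained in
the interface: the translates of this event have probability zero as soon as they
concern vertices of the half-plane only. -/
theorem IsPlaneLimit.ae_not_edgeBoundary_subset {ν₀ : Measure ℝ} [IsProbabilityMeasure ν₀]
    [NullSingletonClass ν₀] {Mt : Measure (Conf ℤ)} (hMt : IsPlaneLimit ν₀ Mt)
    {A : Finset (Vertex ℤ)} (hA : A.Nonempty) :
    ∀ᵐ q ∂(Mt.map spinPair), ¬ edgeBoundary (A : Set (Vertex ℤ)) ⊆ pairInterface q := by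
  have hprob := hMt.1
  obtain ⟨n, hn, hlim⟩ := hMt.tendsto
  set E := {q | edgeBoundary (A : Set (Vertex ℤ)) ⊆ pairInterface q} with hE
  have hclopen : IsClopen E := isClopen_edgeBoundary_subset A
  set f := BoundedContinuousFunction.indicator E hclopen with hf
  have hfE : ∀ q, f q = E.indicator (fun _ => 1) q := fun q => rfl
  obtain ⟨K, hK⟩ : ∃ K : ℕ, ∀ v ∈ A, 0 ≤ v.2 + (K : ℤ) := by
    refine ⟨A.sup fun v => v.2.natAbs, fun v hv => ?_⟩
    have : v.2.natAbs ≤ A.sup fun v => v.2.natAbs :=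
      Finset.le_sup (f := fun v : Vertex ℤ => v.2.natAbs) hv
    omega
  have hzero : ∀ k, K ≤ k → ∫ p, f (shiftedPair k p) ∂(halfPlaneMeasure ν₀) = 0 := by
    intro k hkK
    have hk : ∀ v ∈ A, 0 ≤ v.2 + (k : ℤ) := fun v hv => by
      have := hK v hv
      omega
    refine integral_eq_zero_of_ae ?_
    have hnull := halfPlaneMeasure_boundaryInInterface ν₀
      (A := liftVertices k A) (hA.image _)
    filter_upwards [measure_eq_zero_iff_ae_notMem.1 hnull] with p hp
    rw [hfE]
    exact Set.indicator_of_notMem (fun h => hp (shiftedPair_edgeBoundary_subset hk h)) _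
  have hces : Tendsto (fun m : ℕ => (m : ℝ)⁻¹ * ∑ k ∈ Finset.range m,
      ∫ p, f (shiftedPair k p) ∂(halfPlaneMeasure ν₀)) atTop (𝓝 0) :=
    Tendsto.cesaro (tendsto_const_nhds.congr' (by
      filter_upwards [eventually_ge_atTop K] with k hk
      exact (hzero k hk).symm))
  have h0 := tendsto_nhds_unique (hlim f) (hces.comp ((tendsto_add_atTop_nat 1).comp hn))
  have h1 : ∫ q, f q ∂(Mt.map spinPair) = (Mt.map spinPair).real E := by
    simp only [hfE]
    exact integral_indicator_one hclopen.isOpen.measurableSet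
  have hP : IsProbabilityMeasure (Mt.map spinPair) :=
    Measure.isProbabilityMeasure_map continuous_spinPair.measurable.aemeasurable
  rw [h1, measureReal_eq_zero_iff] at h0
  exact measure_eq_zero_iff_ae_notMem.1 h0

theorem measurableSet_edgeBoundary_subset (A : Finset (Vertex ℤ)) :
    MeasurableSet {S : Set (Edge ℤ) | edgeBoundary (A : Set (Vertex ℤ)) ⊆ S} := by
  have h : {S : Set (Edge ℤ) | edgeBoundary (A : Set (Vertex ℤ)) ⊆ S} =
      ⋂ e ∈ edgeBoundary (A : Set (Vertex ℤ)), {S : Set (Edge ℤ) | e ∈ S} := by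
    ext q
    simp [Set.subset_def]
  rw [h]
  exact MeasurableSet.biInter (Set.to_countable _) fun e _ => measurableSet_mem_edges e

theorem IsPlaneLimit.ae_enclosesNothing {ν₀ : Measure ℝ} [IsProbabilityMeasure ν₀]
    [NullSingletonClass ν₀] {Mt : Measure (Conf ℤ)} (hMt : IsPlaneLimit ν₀ Mt) :
    ∀ᵐ S ∂(interfaceLaw Mt), EnclosesNothing S := by
  refine ae_all_iff.2 fun A => ?_
  by_cases hA : A.Nonempty
  · refine ((ae_map_iff measurable_pairInterface.aemeasurable
      (measurableSet_edgeBoundary_subset A).compl).2 (hMt.ae_not_edgeBoundary_subset hA)).mono ?_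
    exact fun S hS _ => hS
  · exact Eventually.of_forall fun S h => absurd h hA

end EdwardsAnderson

end

theorem proposition3p7
    (ν₀ : Measure ℝ) [IsProbabilityMeasure ν₀]
    -- the law of a coupling is continuous, with support `ℝ`
    [NullSingletonClass ν₀] [ν₀.IsOpenPosMeasure]
    -- the number of ground states on the half-plane is finite
    (hfin : ∀ᵐ J ∂(couplingLaw ν₀), (groundStates J).Finite)
    (Mt : Measure (Conf ℤ)) (hMt : IsPlaneLimit ν₀ Mt) :
    ∀ᵐ ω ∂Mt, ∀ S : Set (Edge ℤ), S = interface ω.2.1 ω.2.2.1 → S.Nonempty →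
      -- 1. positive density
      HasPositiveDensity S ∧
      -- 2. no dangling ends, no three-branching points
      (∀ u : DualVertex, dualDegree S u ≠ 1 ∧ dualDegree S u ≠ 3) ∧
      -- 3. no four-branching points; domain walls are doubly infinite dual paths;
      -- the components of the complement are unbounded, with at most two ends
      (∀ u : DualVertex, dualDegree S u ≠ 4) ∧
      (∀ D : Set DualVertex, IsDomainWall S D →
        (∀ u ∈ D, dualDegree S u = 2) ∧ IsDoublyInfinitePath S D) ∧
      (∀ C : Set (ℝ × ℝ), IsComponentOf C (dualRealization S)ᶜ →
        ¬ Bornology.IsBounded C ∧ HasAtMostTwoEnds C) := by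
  have hprob := hMt.1
  have hP : IsProbabilityMeasure (interfaceLaw Mt) := by
    have : IsProbabilityMeasure (Mt.map spinPair) :=
      Measure.isProbabilityMeasure_map continuous_spinPair.measurable.aemeasurable
    exact Measure.isProbabilityMeasure_map measurable_pairInterface.aemeasurable
  have hstat := hMt.isStationary_interfaceLaw
  have henc := hMt.ae_enclosesNothing
  have heven := ae_isEven_interfaceLaw Mt
  have key := hstat.hasPositiveDensity.and (hstat.not_isTrifurcation.and
    (henc.and (heven.and (hstat.faceDegree_ne_four heven henc))))
  have key' := ae_of_ae_map continuous_spinPair.measurable.aemeasurable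
    (ae_of_ae_map measurable_pairInterface.aemeasurable key)
  filter_upwards [key'] with ω hω S hS hne
  change S = pairInterface (spinPair ω) at hS
  rw [← hS] at hω
  obtain ⟨hdens, htri, hnone, hev, hfour⟩ := hω
  refine ⟨hdens hne, fun u => ?_, fun u => ?_, fun D hD => hD.isDoublyInfinitePath hev hnone hfour,
    fun C hC => ⟨hnone.not_isBounded hC, hasAtMostTwoEnds_of_not_isTrifurcation htri hC⟩⟩
  · have h := hev u
    rw [← dualDegree_eq_faceDegree] at h
    constructor <;> intro h' <;> rw [h'] at h <;> revert h <;> decide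
  · rw [dualDegree_eq_faceDegree]
    exact hfour u
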